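/- Let $\nu\in\mathbb{C}$ with $\Re(\nu)>-1$, let $f:(0,\infty)\to\mathbb{C}$ be measurable and let $y>0$. For a function $g$ on $(0,\infty)$ and $y>0$ put $$\mathscr{H}_\nu\{g(x);y\}=\int_0^\infty\sqrt{xy}\,J_\nu(xy)\,g(x)\,dx,\qquad \mathscr{K}_\nu\{g(x);y\}=\int_0^\infty\sqrt{xy}\,K_\nu(xy)\,g(x)\,dx,\qquad \mathscr{P}\{g(x);y\}=\int_0^\infty\frac{x\,g(x)}{x^2+y^2}\,dx,$$ where $J_\nu$ is the Bessel function of the first kind and $K_\nu$ the modified Bessel function of the second kind (Macdonald function), and where $\int_0^\infty$ means $\lim_{a\to0^+,\,b\to\infty}\int_a^b$. Then the following hold. 1. If $\mathscr{P}\{x^{-\nu-1/2}f(x);u\}$ converges absolutely for every $u>0$, $\mathscr{K}_\nu\{f(x);y\}$ converges absolutely, and the outer integral on the left-hand side below converges (possibly only conditionally), then $$\mathscr{H}_\nu\big\{u^{\nu+1/2}\,\mathscr{P}\{x^{-\nu-1/2}f(x);u\};y\big\}=\mathscr{K}_\nu\{f(x);y\}.$$ 2. If $\mathscr{H}_\nu\{f(x);u\}$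 converges absolutely for every $u>0$, $\mathscr{K}_\nu\{f(x);y\}$ converges absolutely, and the outer integral on the left-hand side below converges (possibly only conditionally), then $$\mathscr{P}\big\{u^{\nu-1/2}\,\mathscr{H}_\nu\{f(x);u\};y\big\}=y^{\nu-1/2}\,\mathscr{K}_\nu\{f(x);y\}.$$ 3. If the hypotheses of both 1 and 2 hold, then $$\mathscr{H}_\nu\big\{u^{\nu+1/2}\,\mathscr{P}\{x^{-\nu-1/2}f(x);u\};y\big\}=y^{-\nu+1/2}\,\mathscr{P}\big\{u^{\nu-1/2}\,\mathscr{H}_\nu\{f(x);u\};y\big\}.$$ -/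

import Mathlib

open Set Filter Topology MeasureTheory

noncomputable section

namespace IterationIdentities

/-- Bessel function of the first kind of complex order `ν`, for a positive real argument:
`J_ν(x) = (x/2)^ν ∑ (-1)^k / (k! Γ(ν+k+1)) (x/2)^(2k)`. -/
def besselJ (ν : ℂ) (x : ℝ) : ℂ :=
  ((x / 2 : ℝ) : ℂ) ^ ν *
    ∑' k : ℕ, (-1 : ℂ) ^ k / ((k.factorial : ℂ) * Complex.Gamma (ν + k + 1)) *
      ((x / 2 : ℝ) : ℂ) ^ (2 * k)

/-- Modified Bessel function of the second kind (Macdonald function) of complex order `ν`, for a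
positive real argument: `K_ν(x) = ∫_0^∞ exp(-x cosh t) cosh(ν t) dt`.
The integral converges absolutely for every complex `ν` and every `x > 0`. -/
def besselK (ν : ℂ) (x : ℝ) : ℂ :=
  ∫ t in Ioi (0 : ℝ), (Real.exp (-x * Real.cosh t) : ℂ) * Complex.cosh (ν * t)

/-- The integral of `g` over `(0, ∞)` converges, possibly only conditionally at `0` and at `∞`:
`g` is integrable on compact subsets of `(0, ∞)` and `∫_a^b g` has a limit as `a → 0+` and
`b → ∞` independently. -/
def ImproperConverges (g : ℝ → ℂ) : Prop :=
  LocallyIntegrableOn g (Ioi (0 : ℝ)) ∧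
    ∃ c : ℂ, Tendsto (fun p : ℝ × ℝ => ∫ x in p.1..p.2, g x) (𝓝[>] (0 : ℝ) ×ˢ atTop) (𝓝 c)

/-- The integral of `g` over `(0, ∞)` converges absolutely. -/
def AbsConverges (g : ℝ → ℂ) : Prop :=
  IntegrableOn g (Ioi (0 : ℝ))

/-- The integral `∫_0^∞ g(x) dx`, as the limit of `∫_a^b g` for `a → 0+` and `b → ∞`.
It is the Lebesgue integral when the latter converges absolutely. -/
def improperIntegral (g : ℝ → ℂ) : ℂ :=
  limUnder (𝓝[>] (0 : ℝ) ×ˢ atTop) (fun p : ℝ × ℝ => ∫ x in p.1..p.2, g x)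

/-- The integrand `√(xy) J_ν(xy) f(x)` of the Hankel transform at `y`. -/
def hankelIntegrand (ν : ℂ) (f : ℝ → ℂ) (y x : ℝ) : ℂ :=
  (Real.sqrt (x * y) : ℂ) * besselJ ν (x * y) * f x

/-- The integrand `√(xy) K_ν(xy) f(x)` of the `K_ν`-transform at `y`. -/
def macdonaldIntegrand (ν : ℂ) (f : ℝ → ℂ) (y x : ℝ) : ℂ :=
  (Real.sqrt (x * y) : ℂ) * besselK ν (x * y) * f x

/-- The integrand `x f(x) / (x² + y²)` of the Widder potential transform at `y`. -/
def widderIntegrand (f : ℝ → ℂ) (y x : ℝ) : ℂ :=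
  (x : ℂ) * f x / ((x : ℂ) ^ 2 + (y : ℂ) ^ 2)

/-- The Hankel transform `H_ν{f; y}`. -/
def hankel (ν : ℂ) (f : ℝ → ℂ) (y : ℝ) : ℂ :=
  improperIntegral (hankelIntegrand ν f y)

/-- The `K_ν`-transform `K_ν{f; y}`. -/
def macdonald (ν : ℂ) (f : ℝ → ℂ) (y : ℝ) : ℂ :=
  improperIntegral (macdonaldIntegrand ν f y)

/-- The Widder potential transform `P{f; y}`. -/
def widder (f : ℝ → ℂ) (y : ℝ) : ℂ :=
  improperIntegral (widderIntegrand f y)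

/-- The function `x ↦ x^s f(x)`. -/
def powMul (s : ℂ) (f : ℝ → ℂ) (x : ℝ) : ℂ :=
  (x : ℂ) ^ s * f x

/-- Every member of `H_ν{u^(ν+1/2) P{x^(-ν-1/2) f; u}; y} = K_ν{f; y}` exists: the transforms of
`f` itself converge absolutely, the outer Hankel integral converges (perhaps conditionally). -/
def HankelWidderExists (ν : ℂ) (f : ℝ → ℂ) (y : ℝ) : Prop :=
  (∀ u : ℝ, 0 < u → AbsConverges (widderIntegrand (powMul (-ν - 1 / 2) f) u)) ∧
  AbsConverges (macdonaldIntegrand ν f y) ∧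
  ImproperConverges
    (hankelIntegrand ν (powMul (ν + 1 / 2) (widder (powMul (-ν - 1 / 2) f))) y)

/-- Every member of `P{u^(ν-1/2) H_ν{f; u}; y} = y^(ν-1/2) K_ν{f; y}` exists: the transforms of
`f` itself converge absolutely, the outer Widder integral converges (perhaps conditionally). -/
def WidderHankelExists (ν : ℂ) (f : ℝ → ℂ) (y : ℝ) : Prop :=
  (∀ u : ℝ, 0 < u → AbsConverges (hankelIntegrand ν f u)) ∧
  AbsConverges (macdonaldIntegrand ν f y) ∧
  ImproperConverges (widderIntegrand (powMul (ν - 1 / 2) (hankel ν f)) y)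

end IterationIdentities

end

/-!
Both identities are one exchange of the order of integration. Formally,
`∫_0^∞ u^(ν+1) J_ν(uy) / (x² + u²) du = x^ν K_ν(xy)`,
and inserting this kernel, with the roles of `x` and `y` as they stand or interchanged, into the
iterated transform gives the `K_ν`-transform of `f`. The kernel integral need not converge
absolutely, and for large `Re ν` it does not converge at all; neither need the outer integral of the
transform converge absolutely. So the exchange is made after regularization.

The outer integrand `g(u)` is replaced by `exp(-ε u²) g(u)` on `(ε, ∞)`. Since a Gaussian mean is an
average of truncated integrals, this recovers the improper integral as `ε → 0`
(`tendsto_integral_gaussian`). For fixed `ε` Fubini's theorem applies, and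
`eq_integral_of_gaussian_means` reduces the claim to two facts about the means
`∫_ε^∞ exp(-ε u²) u^(ν+1) J_ν(uy) / (x² + u²) du`: they converge to `x^ν K_ν(xy)`, and they are
dominated in `ε` by something integrable against `f`.

For the integral over all of `(0, ∞)`, writing `1/(x² + u²)` as a Laplace integral and applying
Weber's integral `∫_0^∞ u^(ν+1) J_ν(uy) exp(-t u²) du = y^ν (2t)^(-ν-1) exp(-y²/(4t))`
(`integral_besselKernel_mul_gaussian`) gives `exp(ε x²) x^ν` times the part over `(T, ∞)` of the
integral `K_ν(z) = ½ ∫ exp(-z cosh τ - ν τ) dτ`, with `z = xy` and `T = log(2 x ε / y)`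
(`integral_gaussian_potentialKernel_eq_incomplete`). Convergence is then plain. Domination near
`z = 0` comes from `|K_ν(z)|` itself, which has the size of the integral of absolute values when
`Re ν ≠ 0` or `ν = 0` (`exists_norm_incompleteBesselK_le_besselK`). For imaginary `ν ≠ 0` this
fails, as `K_ν` has zeros accumulating at `0`; there integration by parts shows that the incomplete
integrals are bounded (`norm_incompleteBesselK_le_of_re_eq_zero`). The part over `(0, ε)` is
estimated in the same way.

Absolute convergence of the inner transforms has to supply the integrability of the remaining
majorants. For the potential transform this is immediate. For the Hankel transform, `J_ν` has zeros,
so no single `u` suffices; but by Baire's theorem the absolute integrals are bounded for `u` in some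
interval, and averaging over this interval together with the lower bound `exists_le_integral_norm`
for the mean of `|√z J_ν(z)|`, an energy estimate for Bessel's equation, shows that `f` is
integrable at infinity (`exists_integrableOn_Ioi_of_hankel`).
-/

namespace IterationIdentities

/-! ### Abel means of improper integrals -/

theorem improperIntegral_eq_of_tendsto {g : ℝ → ℂ} {c : ℂ}
    (h : Tendsto (fun p : ℝ × ℝ => ∫ x in p.1..p.2, g x) (𝓝[>] (0 : ℝ) ×ˢ atTop) (𝓝 c)) :
    improperIntegral g = c :=
  h.limUnder_eq

theorem improperIntegral_eq_integral {g : ℝ → ℂ} (hg : AbsConverges g) :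
    improperIntegral g = ∫ x in Ioi (0 : ℝ), g x := by
  apply improperIntegral_eq_of_tendsto
  have hcov : AECover (volume.restrict (Ioi (0 : ℝ))) (𝓝[>] (0 : ℝ) ×ˢ atTop)
      (fun p : ℝ × ℝ => Ioc p.1 p.2) := by
    refine ⟨?_, fun _ => measurableSet_Ioc⟩
    filter_upwards [ae_restrict_mem measurableSet_Ioi] with x hx
    have h1 : ∀ᶠ a in 𝓝[>] (0 : ℝ), a < x := eventually_nhdsWithin_of_eventually_nhds
      (gt_mem_nhds hx)
    exact (h1.prod_mk (eventually_ge_atTop x)).mono fun p hp => ⟨hp.1, hp.2⟩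
  refine (hcov.integral_tendsto_of_countably_generated hg).congr' ?_
  have h1 : ∀ᶠ a in 𝓝[>] (0 : ℝ), a ∈ Ioo (0 : ℝ) 1 := Ioo_mem_nhdsGT one_pos
  filter_upwards [h1.prod_mk (eventually_ge_atTop (1 : ℝ))] with p hp
  rw [intervalIntegral.integral_of_le (hp.1.2.le.trans hp.2), Measure.restrict_restrict
    measurableSet_Ioc, inter_eq_left.2]
  exact fun x hx => hp.1.1.trans hx.1

theorem integrableOn_Icc_of_locallyIntegrableOn {g : ℝ → ℂ}
    (hg : LocallyIntegrableOn g (Ioi (0 : ℝ))) {a b : ℝ} (ha : 0 < a) :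
    IntegrableOn g (Icc a b) :=
  hg.integrableOn_compact_subset (fun _ hx => ha.trans_le hx.1) isCompact_Icc

theorem intervalIntegrable_of_locallyIntegrableOn {g : ℝ → ℂ}
    (hg : LocallyIntegrableOn g (Ioi (0 : ℝ))) {a b : ℝ} (ha : 0 < a) (hb : 0 < b) :
    IntervalIntegrable g volume a b := by
  rw [intervalIntegrable_iff]
  exact (integrableOn_Icc_of_locallyIntegrableOn hg (lt_min ha hb)).mono_set
    (uIoc_subset_uIcc)

/-- The truncated integrals of a convergent improper integral are bounded, uniformly in the upper
limit, once the lower limit is small. -/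
theorem exists_bound_truncated {g : ℝ → ℂ} {c : ℂ} (hg : LocallyIntegrableOn g (Ioi (0 : ℝ)))
    (hc : Tendsto (fun p : ℝ × ℝ => ∫ x in p.1..p.2, g x) (𝓝[>] (0 : ℝ) ×ˢ atTop) (𝓝 c)) :
    ∃ M : ℝ, ∀ᶠ a in 𝓝[>] (0 : ℝ), ∀ b, a ≤ b → ‖∫ x in a..b, g x‖ ≤ M := by
  have h1 : ∀ᶠ p in 𝓝[>] (0 : ℝ) ×ˢ (atTop : Filter ℝ), ‖∫ x in p.1..p.2, g x‖ < ‖c‖ + 1 :=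
    hc.norm.eventually (gt_mem_nhds (lt_add_one _))
  obtain ⟨P, hP, Q, hQ, hPQ⟩ := eventually_prod_iff.1 h1
  obtain ⟨a₀, ha₀, hP'⟩ := mem_nhdsGT_iff_exists_Ioo_subset.1 hP
  obtain ⟨b₀, hb₀⟩ := eventually_atTop.1 hQ
  have ha₀ : 0 < a₀ := ha₀
  set B := max b₀ 1 with hB
  have hB0 : 0 < B := lt_of_lt_of_le one_pos (le_max_right _ _)
  have hsmall : ∀ a b, 0 < a → a < a₀ → B ≤ b → ‖∫ x in a..b, g x‖ < ‖c‖ + 1 :=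
    fun a b h0 h1 h2 => hPQ (hP' ⟨h0, h1⟩) (hb₀ b ((le_max_left _ _).trans h2))
  refine ⟨(‖c‖ + 1) + ((‖c‖ + 1) + ∫ x in Icc a₀ B, ‖g x‖), ?_⟩
  have hI : 0 ≤ ∫ x in Icc a₀ B, ‖g x‖ := integral_nonneg fun _ => norm_nonneg _
  have hc0 := norm_nonneg c
  filter_upwards [Ioo_mem_nhdsGT ha₀] with a ha b hab
  rcases le_or_gt B b with hb | hb
  · linarith [hsmall a b ha.1 ha.2 hb]
  have hb0 : 0 < b := ha.1.trans_le hab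
  have hadd := intervalIntegral.integral_add_adjacent_intervals
    (intervalIntegrable_of_locallyIntegrableOn hg ha.1 hb0)
    (intervalIntegrable_of_locallyIntegrableOn hg hb0 hB0)
  rw [eq_sub_of_add_eq hadd]
  have h2 : ‖∫ x in b..B, g x‖ ≤ (‖c‖ + 1) + ∫ x in Icc a₀ B, ‖g x‖ := by
    rcases lt_or_ge b a₀ with hba | hba
    · linarith [hsmall b B hb0 hba le_rfl]
    · refine (intervalIntegral.norm_integral_le_integral_norm hb.le).trans ?_
      rw [intervalIntegral.integral_of_le hb.le]
      have := setIntegral_mono_set (s := Ioc b B) (t := Icc a₀ B)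
        (integrableOn_Icc_of_locallyIntegrableOn hg ha₀ (b := B)).norm
        (ae_of_all _ fun _ => norm_nonneg _)
        (Eventually.of_forall fun x hx => ⟨hba.trans (le_of_lt hx.1), hx.2⟩)
      linarith
  refine (norm_sub_le _ _).trans ?_
  linarith [hsmall a B ha.1 ha.2 le_rfl]

theorem hasDerivAt_neg_exp_neg_sq (v : ℝ) :
    HasDerivAt (fun v : ℝ => -Real.exp (-v ^ 2)) (2 * v * Real.exp (-v ^ 2)) v := by
  have := ((hasDerivAt_pow 2 v).neg.exp).neg
  refine this.congr_deriv ?_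
  simp; ring

theorem tendsto_neg_exp_neg_sq :
    Tendsto (fun v : ℝ => -Real.exp (-v ^ 2)) atTop (𝓝 0) := by
  rw [← neg_zero]
  exact (Real.tendsto_exp_neg_atTop_nhds_zero.comp (tendsto_pow_atTop two_ne_zero)).neg

theorem integrableOn_two_mul_exp_neg_sq {c : ℝ} (hc : 0 ≤ c) :
    IntegrableOn (fun v : ℝ => 2 * v * Real.exp (-v ^ 2)) (Ioi c) :=
  integrableOn_Ioi_deriv_of_nonneg' (fun v _ => hasDerivAt_neg_exp_neg_sq v)
    (fun v hv => by have : 0 < v := hc.trans_lt hv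
                    positivity) tendsto_neg_exp_neg_sq

theorem integral_two_mul_exp_neg_sq {c : ℝ} (hc : 0 ≤ c) :
    ∫ v in Ioi c, 2 * v * Real.exp (-v ^ 2) = Real.exp (-c ^ 2) := by
  rw [integral_Ioi_of_hasDerivAt_of_tendsto' (fun v _ => hasDerivAt_neg_exp_neg_sq v)
    (integrableOn_two_mul_exp_neg_sq hc) tendsto_neg_exp_neg_sq]
  simp

/-- A Gaussian mean of `g` is an average of its truncated integrals, because
`exp(-ε u²) = ∫_{v > u √ε} 2 v exp(-v²) dv`. -/
theorem integral_gaussian_eq_average {g : ℝ → ℂ} {ε : ℝ} (hε : 0 < ε)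
    (hint : IntegrableOn (fun u : ℝ => (Real.exp (-ε * u ^ 2) : ℂ) * g u) (Ioi ε)) :
    ∫ u in Ioi ε, (Real.exp (-ε * u ^ 2) : ℂ) * g u =
      ∫ v in Ioi (0 : ℝ), ((2 * v * Real.exp (-v ^ 2) : ℝ) : ℂ) *
        ∫ u in ε..max ε (v / √ε), g u := by
  have hs : 0 < √ε := Real.sqrt_pos.2 hε
  set k : ℝ → ℝ := fun v => 2 * v * Real.exp (-v ^ 2) with hk
  set F : ℝ → ℝ → ℂ := fun u v => ({p : ℝ × ℝ | p.1 * √ε < p.2}.indicator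
    (fun p => (k p.2 : ℂ) * g p.1)) (u, v) with hF
  have hF' : ∀ u v, F u v = (Ioi (u * √ε)).indicator (fun v => (k v : ℂ) * g u) v := by
    intro u v; simp [hF, indicator]
  have hFn : ∀ u v, ‖F u v‖ = (Ioi (u * √ε)).indicator (fun v => |k v| * ‖g u‖) v := by
    intro u v; rw [hF']; by_cases h : v ∈ Ioi (u * √ε) <;> simp [h]
  have hmeas : AEStronglyMeasurable g (volume.restrict (Ioi ε)) := by
    have h1 : AEStronglyMeasurable (fun u : ℝ => (Real.exp (ε * u ^ 2) : ℂ) *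
        ((Real.exp (-ε * u ^ 2) : ℂ) * g u)) (volume.restrict (Ioi ε)) :=
      (Continuous.aestronglyMeasurable (by fun_prop)).mul hint.aestronglyMeasurable
    refine h1.congr (ae_of_all _ fun u => ?_)
    simp only [← mul_assoc, ← Complex.ofReal_mul, ← Real.exp_add]
    simp
  have hIk : ∀ u : ℝ, u ∈ Ioi ε → ∫ v in Ioi (0 : ℝ), (Ioi (u * √ε)).indicator
      (fun v => |k v| * ‖g u‖) v = Real.exp (-ε * u ^ 2) * ‖g u‖ := by
    intro u hu
    have hu0 : 0 ≤ u * √ε := mul_nonneg (hε.le.trans (le_of_lt hu)) hs.le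
    rw [setIntegral_indicator measurableSet_Ioi, Ioi_inter_Ioi, max_eq_right hu0,
      integral_mul_const]
    congr 1
    have : ∫ v in Ioi (u * √ε), |k v| = ∫ v in Ioi (u * √ε), k v := by
      refine setIntegral_congr_fun measurableSet_Ioi fun v hv => abs_of_nonneg ?_
      have : 0 ≤ v := hu0.trans (le_of_lt hv)
      simp only [hk]; positivity
    rw [this, hk, integral_two_mul_exp_neg_sq hu0, mul_pow, Real.sq_sqrt hε.le]
    congr 1; ring
  have hkint : ∀ u : ℝ, IntegrableOn (F u) (Ioi 0) := by
    intro u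
    have : F u = (Ioi (u * √ε)).indicator (fun v => (k v : ℂ) * g u) := funext (hF' u)
    rw [this]
    refine Integrable.indicator ?_ measurableSet_Ioi
    exact (integrableOn_two_mul_exp_neg_sq le_rfl).ofReal.mul_const _
  have hFint : Integrable (Function.uncurry F)
      ((volume.restrict (Ioi ε)).prod (volume.restrict (Ioi (0 : ℝ)))) := by
    rw [integrable_prod_iff]
    · refine ⟨ae_of_all _ hkint, ?_⟩
      refine hint.norm.congr ?_
      filter_upwards [ae_restrict_mem measurableSet_Ioi] with u hu
      simp only [Function.uncurry, hFn]
      rw [hIk u hu]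
      rw [norm_mul, Complex.norm_real, Real.norm_of_nonneg (Real.exp_pos _).le]
    · refine AEStronglyMeasurable.indicator ?_ (measurableSet_lt (by fun_prop) (by fun_prop))
      refine AEStronglyMeasurable.mul ?_ hmeas.comp_fst
      exact Continuous.aestronglyMeasurable (by simp only [hk]; fun_prop)
  have hswap := integral_integral_swap hFint
  have hleft : ∫ u in Ioi ε, ∫ v in Ioi (0 : ℝ), F u v =
      ∫ u in Ioi ε, (Real.exp (-ε * u ^ 2) : ℂ) * g u := by
    refine setIntegral_congr_fun measurableSet_Ioi fun u hu => ?_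
    have hu0 : 0 ≤ u * √ε := mul_nonneg (hε.le.trans (le_of_lt hu)) hs.le
    simp only [hF']
    rw [setIntegral_indicator measurableSet_Ioi, Ioi_inter_Ioi, max_eq_right hu0,
      integral_mul_const, integral_complex_ofReal, integral_two_mul_exp_neg_sq hu0, mul_pow,
      Real.sq_sqrt hε.le]
    congr 4; ring
  rw [← hleft, hswap]
  refine setIntegral_congr_fun measurableSet_Ioi fun v hv => ?_
  have h1 : ∀ u, F u v = (Iio (v / √ε)).indicator (fun u => (k v : ℂ) * g u) u := by
    intro u; simp [hF, indicator, lt_div_iff₀ hs]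
  simp only [h1]
  rw [setIntegral_indicator measurableSet_Iio, Ioi_inter_Iio, integral_const_mul,
    intervalIntegral.integral_of_le (le_max_left _ _), integral_Ioc_eq_integral_Ioo]
  rcases le_total (v / √ε) ε with h | h
  · simp [h]
  · rw [max_eq_right h]

/-- Abel summation with Gaussian weights: it assigns to a convergent improper integral its value. -/
theorem tendsto_integral_gaussian {g : ℝ → ℂ} {c : ℂ} (hg : LocallyIntegrableOn g (Ioi (0 : ℝ)))
    (hc : Tendsto (fun p : ℝ × ℝ => ∫ x in p.1..p.2, g x) (𝓝[>] (0 : ℝ) ×ˢ atTop) (𝓝 c))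
    (hint : ∀ᶠ ε in 𝓝[>] (0 : ℝ),
      IntegrableOn (fun u : ℝ => (Real.exp (-ε * u ^ 2) : ℂ) * g u) (Ioi ε)) :
    Tendsto (fun ε : ℝ => ∫ u in Ioi ε, (Real.exp (-ε * u ^ 2) : ℂ) * g u) (𝓝[>] 0) (𝓝 c) := by
  obtain ⟨M, hM⟩ := exists_bound_truncated hg hc
  have hlim : Tendsto (fun ε : ℝ => ∫ v in Ioi (0 : ℝ), ((2 * v * Real.exp (-v ^ 2) : ℝ) : ℂ) *
        ∫ u in ε..max ε (v / √ε), g u) (𝓝[>] 0)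
        (𝓝 (∫ v in Ioi (0 : ℝ), ((2 * v * Real.exp (-v ^ 2) : ℝ) : ℂ) * c)) := by
    refine tendsto_integral_filter_of_dominated_convergence
      (fun v => 2 * v * Real.exp (-v ^ 2) * M) ?_ ?_
      ((integrableOn_two_mul_exp_neg_sq le_rfl).mul_const _) ?_
    · filter_upwards [self_mem_nhdsWithin] with ε hε
      have hε : 0 < ε := hε
      refine AEStronglyMeasurable.mul (Continuous.aestronglyMeasurable (by fun_prop)) ?_
      have hcont : ContinuousOn (fun b => ∫ u in ε..b, g u) (Ici ε) := by
        intro b hb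
        have h2 : ContinuousOn (fun b => ∫ u in ε..b, g u) (uIcc ε (b + 1)) :=
          intervalIntegral.continuousOn_primitive_interval
            (by
              rw [uIcc_of_le (by linarith [mem_Ici.1 hb])]
              exact integrableOn_Icc_of_locallyIntegrableOn hg hε)
        rw [uIcc_of_le (by linarith [mem_Ici.1 hb])] at h2
        refine (h2 b ⟨hb, by linarith⟩).mono_of_mem_nhdsWithin ?_
        filter_upwards [self_mem_nhdsWithin, mem_nhdsWithin_of_mem_nhds
          (Iio_mem_nhds (lt_add_one b))] with x hx hx'
        exact ⟨hx, le_of_lt hx'⟩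
      exact (hcont.comp_continuous (by fun_prop)
        (fun v => mem_Ici.2 (le_max_left _ _))).aestronglyMeasurable
    · filter_upwards [hM] with ε hε
      filter_upwards [ae_restrict_mem measurableSet_Ioi] with v hv
      have hv : 0 < v := hv
      rw [norm_mul, Complex.norm_real, Real.norm_of_nonneg (by positivity)]
      gcongr
      exact hε _ (le_max_left _ _)
    · filter_upwards [ae_restrict_mem measurableSet_Ioi] with v hv
      have hv : 0 < v := hv
      -- For fixed `v > 0` the upper limit `v / √ε` tends to infinity.
      refine Tendsto.const_mul _ (hc.comp (f := fun ε : ℝ => (ε, max ε (v / √ε))) ?_)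
      refine tendsto_id.prodMk (tendsto_atTop_mono (fun ε => le_max_right _ _) ?_)
      refine Tendsto.const_mul_atTop hv (Tendsto.inv_tendsto_nhdsGT_zero ?_)
      refine tendsto_nhdsWithin_iff.2 ⟨?_, ?_⟩
      · have := (Real.continuous_sqrt.tendsto 0).mono_left (nhdsWithin_le_nhds (s := Ioi 0))
        simpa using this
      · filter_upwards [self_mem_nhdsWithin] with ε hε using Real.sqrt_pos.2 hε
  rw [integral_mul_const, integral_complex_ofReal, integral_two_mul_exp_neg_sq le_rfl] at hlim
  simp only [ne_eq, OfNat.ofNat_ne_zero, not_false_eq_true, zero_pow, neg_zero, Real.exp_zero,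
    Complex.ofReal_one, one_mul] at hlim
  refine hlim.congr' ?_
  filter_upwards [self_mem_nhdsWithin, hint] with ε hε h
  exact (integral_gaussian_eq_average hε h).symm

/-! ### Bessel functions of the first kind -/

/-- The coefficients of the power series of `(z/2)^(-ν) J_ν(z)` in the variable `(z/2)²`. -/
noncomputable def besselCoeff (ν : ℂ) (k : ℕ) : ℂ :=
  (-1 : ℂ) ^ k / ((k.factorial : ℂ) * Complex.Gamma (ν + k + 1))

/-- The entire function `t ↦ ∑ (-1)^k t^k / (k! Γ(ν+k+1))`, on the real axis; `J_ν(z)` is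
`(z/2)^ν` times its value at `(z/2)²`. -/
noncomputable def besselSeries (ν : ℂ) (t : ℝ) : ℂ :=
  ∑' k : ℕ, besselCoeff ν k * (t : ℂ) ^ k

theorem besselJ_eq (ν : ℂ) (x : ℝ) :
    besselJ ν x = ((x / 2 : ℝ) : ℂ) ^ ν * besselSeries ν ((x / 2) ^ 2) := by
  simp only [besselJ, besselSeries, besselCoeff, Complex.ofReal_pow, ← pow_mul]

theorem gamma_ne_zero_of_re {ν : ℂ} (hν : -1 < ν.re) (k : ℕ) : Complex.Gamma (ν + k + 1) ≠ 0 := by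
  refine Complex.Gamma_ne_zero_of_re_pos ?_
  have : (0 : ℝ) ≤ k := Nat.cast_nonneg k
  simp; linarith

theorem add_nat_add_one_ne_zero {ν : ℂ} (hν : -1 < ν.re) (k : ℕ) : ν + k + 1 ≠ 0 := by
  intro h
  have := congrArg Complex.re h
  have h2 : (0 : ℝ) ≤ k := Nat.cast_nonneg k
  simp at this; linarith

theorem gamma_add_nat_succ {ν : ℂ} (hν : -1 < ν.re) (k : ℕ) :
    Complex.Gamma (ν + (k + 1 : ℕ) + 1) = (ν + k + 1) * Complex.Gamma (ν + k + 1) := by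
  rw [← Complex.Gamma_add_one _ (add_nat_add_one_ne_zero hν k)]
  push_cast; ring_nf

theorem exists_norm_gamma_inv_le {ν : ℂ} (hν : -1 < ν.re) :
    ∃ C : ℝ, 0 ≤ C ∧ ∀ k : ℕ, ‖(Complex.Gamma (ν + k + 1))⁻¹‖ ≤ C := by
  refine ⟨‖(Complex.Gamma (ν + (0 : ℕ) + 1))⁻¹‖ + ‖(Complex.Gamma (ν + (1 : ℕ) + 1))⁻¹‖,
    by positivity, fun k => ?_⟩
  rcases k with _ | k
  · linarith [norm_nonneg (Complex.Gamma (ν + (1 : ℕ) + 1))⁻¹]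
  have : ‖(Complex.Gamma (ν + (k + 1 : ℕ) + 1))⁻¹‖ ≤ ‖(Complex.Gamma (ν + (1 : ℕ) + 1))⁻¹‖ := by
    induction k with
    | zero => simp
    | succ k ih =>
      refine le_trans ?_ ih
      rw [gamma_add_nat_succ hν (k + 1), mul_inv, norm_mul]
      refine mul_le_of_le_one_left (norm_nonneg _) ?_
      rw [norm_inv]
      refine inv_le_one_of_one_le₀ (le_trans ?_ (Complex.re_le_norm _))
      have h2 : (0 : ℝ) ≤ k := Nat.cast_nonneg k
      simp; linarith
  linarith [norm_nonneg (Complex.Gamma (ν + (0 : ℕ) + 1))⁻¹]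

theorem exists_norm_besselCoeff_le {ν : ℂ} (hν : -1 < ν.re) :
    ∃ C : ℝ, 0 ≤ C ∧ ∀ k : ℕ, ‖besselCoeff ν k‖ ≤ C / k.factorial := by
  obtain ⟨C, hC, h⟩ := exists_norm_gamma_inv_le hν
  refine ⟨C, hC, fun k => ?_⟩
  have := h k
  rw [besselCoeff, norm_div, norm_mul, norm_pow, norm_neg, norm_one, one_pow, Complex.norm_natCast,
    div_mul_eq_div_div_swap, one_div, ← norm_inv]
  gcongr

theorem summable_besselSeries {ν : ℂ} (hν : -1 < ν.re) (t : ℝ) :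
    Summable fun k : ℕ => besselCoeff ν k * (t : ℂ) ^ k := by
  obtain ⟨C, hC, h⟩ := exists_norm_besselCoeff_le hν
  refine Summable.of_norm_bounded (g := fun k : ℕ => C * (|t| ^ k / k.factorial))
    ((Real.summable_pow_div_factorial _).mul_left _) fun k => ?_
  rw [norm_mul, norm_pow, Complex.norm_real, Real.norm_eq_abs]
  calc _ ≤ C / k.factorial * |t| ^ k := by gcongr; exact h k
    _ = _ := by ring

theorem besselCoeff_succ_mul (ν : ℂ) (k : ℕ) :
    besselCoeff ν (k + 1) * ((k + 1 : ℕ) : ℂ) = -besselCoeff (ν + 1) k := by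
  have h1 : ((k + 1 : ℕ) : ℂ) ≠ 0 := Nat.cast_ne_zero.2 (Nat.succ_ne_zero k)
  have h2 : (k.factorial : ℂ) ≠ 0 := Nat.cast_ne_zero.2 (Nat.factorial_ne_zero k)
  have h3 : ν + ((k + 1 : ℕ) : ℂ) + 1 = ν + 1 + k + 1 := by push_cast; ring
  rw [besselCoeff, besselCoeff, h3, Nat.factorial_succ, Nat.cast_mul]
  by_cases h4 : Complex.Gamma (ν + 1 + k + 1) = 0
  · simp [h4]
  · field_simp; ring

theorem hasDerivAt_besselSeries {ν : ℂ} (hν : -1 < ν.re) (t : ℝ) :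
    HasDerivAt (besselSeries ν) (-besselSeries (ν + 1) t) t := by
  obtain ⟨C, hC, h⟩ := exists_norm_besselCoeff_le hν
  set R : ℝ := |t| + 1
  have hR : 0 < R := by positivity
  have hsum : Summable fun k : ℕ => C / k.factorial * (k * R ^ (k - 1)) := by
    rw [← summable_nat_add_iff 1]
    refine ((Real.summable_pow_div_factorial R).mul_left C).congr fun k => ?_
    rw [Nat.factorial_succ]
    push_cast
    have : (k.factorial : ℝ) ≠ 0 := Nat.cast_ne_zero.2 (Nat.factorial_ne_zero k)
    have : (k : ℝ) + 1 ≠ 0 := by positivity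
    field_simp
  have hder : ∀ (k : ℕ) (s : ℝ), HasDerivAt (fun s : ℝ => besselCoeff ν k * (s : ℂ) ^ k)
      (besselCoeff ν k * (k * (s : ℂ) ^ (k - 1))) s := by
    intro k s
    simpa using ((hasDerivAt_pow k (s : ℂ)).comp_ofReal).const_mul (besselCoeff ν k)
  have key := hasDerivAt_tsum_of_isPreconnected hsum (Metric.isOpen_ball (x := (0 : ℝ)) (ε := R))
    (convex_ball (0 : ℝ) R).isPreconnected (fun k s _ => hder k s) (fun k s hs => ?_)
    (Metric.mem_ball_self hR) (summable_besselSeries hν 0)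
    (show t ∈ Metric.ball 0 R by simp [R])
  · refine key.congr_deriv ?_
    have hs' : Summable fun k : ℕ => besselCoeff ν k * (k * (t : ℂ) ^ (k - 1)) := by
      refine Summable.of_norm_bounded hsum fun k => ?_
      rw [norm_mul, norm_mul, norm_pow, Complex.norm_real, Complex.norm_natCast, Real.norm_eq_abs]
      gcongr
      · exact h k
      · simp [R]
    rw [hs'.tsum_eq_zero_add, besselSeries, ← tsum_neg]
    simp only [Nat.cast_zero, zero_mul, mul_zero, zero_add, Nat.add_sub_cancel]
    refine tsum_congr fun k => ?_
    rw [← mul_assoc, besselCoeff_succ_mul, neg_mul]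
  · rw [norm_mul, norm_mul, norm_pow, Complex.norm_real, Complex.norm_natCast]
    have : ‖s‖ ≤ R := by simpa using (le_of_lt (by simpa using hs : |s| < R))
    gcongr
    exact h k

theorem besselSeries_recurrence {ν : ℂ} (hν : -1 < ν.re) (t : ℝ) :
    besselSeries ν t = (ν + 1) * besselSeries (ν + 1) t - t * besselSeries (ν + 1 + 1) t := by
  have h1 : -1 < (ν + 1).re := by simp; linarith
  have h2 : -1 < (ν + 1 + 1).re := by simp; linarith
  have s0 := summable_besselSeries hν t
  have s1 := summable_besselSeries h1 t
  have s2 := summable_besselSeries h2 t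
  have hcoef : ∀ k : ℕ, besselCoeff ν (k + 1) =
      (ν + 1) * besselCoeff (ν + 1) (k + 1) - besselCoeff (ν + 1 + 1) k := by
    intro k
    rw [← neg_eq_iff_eq_neg.2 (besselCoeff_succ_mul (ν + 1) k)]
    have hg := gamma_add_nat_succ hν (k + 1)
    have h5 : ν + 1 + ((k + 1 : ℕ) : ℂ) + 1 = ν + ((k + 1 + 1 : ℕ) : ℂ) + 1 := by push_cast; ring
    rw [besselCoeff, besselCoeff, h5, hg]
    have h3 := add_nat_add_one_ne_zero hν (k + 1)
    have h4 := gamma_ne_zero_of_re hν (k + 1)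
    have h6 : ((k + 1).factorial : ℂ) ≠ 0 := Nat.cast_ne_zero.2 (Nat.factorial_ne_zero _)
    field_simp
    ring
  have h0 : besselCoeff ν 0 = (ν + 1) * besselCoeff (ν + 1) 0 := by
    have hg := gamma_add_nat_succ hν 0
    have h3 := add_nat_add_one_ne_zero hν 0
    have h4 := gamma_ne_zero_of_re hν 0
    simp only [Nat.cast_zero, add_zero, zero_add, Nat.cast_one] at hg h3 h4
    simp only [besselCoeff, pow_zero, Nat.factorial_zero, Nat.cast_one, one_mul, Nat.cast_zero,
      add_zero, hg]
    field_simp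
  rw [besselSeries, s0.tsum_eq_zero_add, besselSeries, s1.tsum_eq_zero_add, besselSeries,
    mul_add, ← tsum_mul_left, ← tsum_mul_left, add_sub_assoc,
    ← (((summable_nat_add_iff 1).2 s1).mul_left _).tsum_sub (s2.mul_left _)]
  congr 1
  · rw [h0]; ring
  · refine tsum_congr fun k => ?_
    rw [hcoef]; ring

theorem continuous_besselSeries {ν : ℂ} (hν : -1 < ν.re) : Continuous (besselSeries ν) :=
  continuous_iff_continuousAt.2 fun t => (hasDerivAt_besselSeries hν t).continuousAt

theorem besselSeries_zero (ν : ℂ) : besselSeries ν 0 = (Complex.Gamma (ν + 1))⁻¹ := by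
  rw [besselSeries, tsum_eq_single 0]
  · simp [besselCoeff]
  · intro k hk; simp [hk]

/-- `√z J_ν(z)`, the solution of `w'' + (1 - (ν² - 1/4)/z²) w = 0` attached to `J_ν`. -/
noncomputable def sqrtBesselJ (ν : ℂ) (z : ℝ) : ℂ := (√z : ℂ) * besselJ ν z

theorem sqrtBesselJ_eq (ν : ℂ) {z : ℝ} (hz : 0 < z) :
    sqrtBesselJ ν z = (2 : ℂ) ^ (-ν) * ((z : ℂ) ^ (ν + 1 / 2) * besselSeries ν ((z / 2) ^ 2)) := by
  have hz' : (z : ℂ) ≠ 0 := Complex.ofReal_ne_zero.2 hz.ne'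
  have h1 : ((z / 2 : ℝ) : ℂ) ^ ν = (2 : ℂ) ^ (-ν) * (z : ℂ) ^ ν := by
    rw [div_eq_inv_mul, Complex.ofReal_mul, Complex.mul_cpow_ofReal_nonneg (by norm_num) hz.le,
      Complex.cpow_neg]
    congr 1
    push_cast
    rw [Complex.inv_cpow _ _ (by
      rw [show (2 : ℂ) = ((2 : ℝ) : ℂ) by norm_num, Complex.arg_ofReal_of_nonneg (by norm_num)]
      exact Real.pi_pos.ne)]
  have h2 : (√z : ℂ) = (z : ℂ) ^ (1 / 2 : ℂ) := by
    rw [Real.sqrt_eq_rpow, Complex.ofReal_cpow hz.le]; norm_num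
  rw [sqrtBesselJ, besselJ_eq, h1, h2, Complex.cpow_add _ _ hz']
  ring

theorem hasDerivAt_cpow_mul_besselSeries {ν : ℂ} (hν : -1 < ν.re) (κ : ℂ) {z : ℝ} (hz : 0 < z) :
    HasDerivAt (fun z : ℝ => (z : ℂ) ^ κ * besselSeries ν ((z / 2) ^ 2))
      (κ / z * ((z : ℂ) ^ κ * besselSeries ν ((z / 2) ^ 2)) -
        (z / 2) * ((z : ℂ) ^ κ * besselSeries (ν + 1) ((z / 2) ^ 2))) z := by
  have hz' : (z : ℂ) ≠ 0 := Complex.ofReal_ne_zero.2 hz.ne'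
  have h1 : HasDerivAt (fun z : ℝ => (z : ℂ) ^ κ) (κ / z * (z : ℂ) ^ κ) z := by
    have := (Complex.hasStrictDerivAt_cpow_const (x := (z : ℂ)) (c := κ)
      (Complex.ofReal_mem_slitPlane.2 hz)).hasDerivAt.comp_ofReal
    refine this.congr_deriv ?_
    rw [Complex.cpow_sub _ _ hz', Complex.cpow_one]; ring
  have h2 : HasDerivAt (fun z : ℝ => (z / 2) ^ 2) (z / 2) z := by
    refine (((hasDerivAt_id z).div_const 2).pow 2).congr_deriv ?_
    simp; ring
  have h3 := (hasDerivAt_besselSeries hν ((z / 2) ^ 2)).scomp z h2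
  refine (h1.mul h3).congr_deriv ?_
  simp only [Function.comp, Complex.real_smul]
  push_cast
  ring

/-- The derivative of `√z J_ν(z)`. -/
noncomputable def sqrtBesselJ' (ν : ℂ) (z : ℝ) : ℂ :=
  (ν + 1 / 2) / z * sqrtBesselJ ν z -
    (2 : ℂ) ^ (-(ν + 1)) * ((z : ℂ) ^ (ν + 1 + 1 / 2) * besselSeries (ν + 1) ((z / 2) ^ 2))

theorem hasDerivAt_sqrtBesselJ {ν : ℂ} (hν : -1 < ν.re) {z : ℝ} (hz : 0 < z) :
    HasDerivAt (sqrtBesselJ ν) (sqrtBesselJ' ν z) z := by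
  have hz' : (z : ℂ) ≠ 0 := Complex.ofReal_ne_zero.2 hz.ne'
  have h := (hasDerivAt_cpow_mul_besselSeries hν (ν + 1 / 2) hz).const_mul ((2 : ℂ) ^ (-ν))
  refine (h.congr_of_eventuallyEq ?_).congr_deriv ?_
  · filter_upwards [Ioi_mem_nhds hz] with x hx using sqrtBesselJ_eq ν hx
  · rw [sqrtBesselJ', sqrtBesselJ_eq ν hz, show ν + 1 + 1 / 2 = (ν + 1 / 2) + 1 by ring,
      Complex.cpow_add (ν + 1 / 2) 1 hz', Complex.cpow_one, neg_add,
      Complex.cpow_add _ _ two_ne_zero, Complex.cpow_neg_one]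
    ring

/-- Bessel's equation, in the normal form satisfied by `√z J_ν(z)`. -/
theorem hasDerivAt_sqrtBesselJ' {ν : ℂ} (hν : -1 < ν.re) {z : ℝ} (hz : 0 < z) :
    HasDerivAt (sqrtBesselJ' ν)
      (-sqrtBesselJ ν z + ((ν ^ 2 - 1 / 4) / (z : ℂ) ^ 2) * sqrtBesselJ ν z) z := by
  have hz' : (z : ℂ) ≠ 0 := Complex.ofReal_ne_zero.2 hz.ne'
  have hν1 : -1 < (ν + 1).re := by simp; linarith
  have h1 := (hasDerivAt_cpow_mul_besselSeries hν1 (ν + 1 + 1 / 2) hz).const_mul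
    ((2 : ℂ) ^ (-(ν + 1)))
  have h2 : HasDerivAt (fun z : ℝ => (ν + 1 / 2) / (z : ℂ)) (-(ν + 1 / 2) / (z : ℂ) ^ 2) z := by
    have := ((hasDerivAt_inv hz').comp_ofReal).const_mul (ν + 1 / 2)
    simp only [div_eq_mul_inv]
    refine this.congr_deriv ?_
    ring
  refine ((h2.mul (hasDerivAt_sqrtBesselJ hν hz)).sub h1).congr_deriv ?_
  rw [sqrtBesselJ', sqrtBesselJ_eq ν hz, besselSeries_recurrence hν,
    show ν + 1 + 1 / 2 = (ν + 1 / 2) + 1 by ring,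
      Complex.cpow_add (ν + 1 / 2) 1 hz', Complex.cpow_one, neg_add ν 1,
      Complex.cpow_add _ _ two_ne_zero, Complex.cpow_neg_one]
  push_cast
  field_simp
  ring


section Energy

variable {w p : ℝ → ℂ} {q : ℂ}

open scoped InnerProductSpace in
theorem hasDerivAt_energy (hw : ∀ z : ℝ, 0 < z → HasDerivAt w (p z) z)
    (hp : ∀ z : ℝ, 0 < z → HasDerivAt p (-w z + (q / (z : ℂ) ^ 2) * w z) z) {z : ℝ} (hz : 0 < z) :
    HasDerivAt (fun z => ‖w z‖ ^ 2 + ‖p z‖ ^ 2) (2 * ⟪p z, (q / (z : ℂ) ^ 2) * w z⟫_ℝ) z := by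
  refine ((hw z hz).norm_sq.add (hp z hz).norm_sq).congr_deriv ?_
  rw [inner_add_right, inner_neg_right, real_inner_comm (p z) (w z)]
  ring

open scoped InnerProductSpace in
theorem abs_inner_perturbation_le (w p q : ℂ) {z : ℝ} (hz : 0 < z) :
    |2 * ⟪p, (q / (z : ℂ) ^ 2) * w⟫_ℝ| ≤ ‖q‖ / z ^ 2 * (‖w‖ ^ 2 + ‖p‖ ^ 2) := by
  have h1 := abs_real_inner_le_norm p ((q / (z : ℂ) ^ 2) * w)
  rw [norm_mul, norm_div, norm_pow, Complex.norm_real, Real.norm_of_nonneg hz.le] at h1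
  rw [abs_mul, abs_two]
  have h2 : 0 ≤ ‖q‖ / z ^ 2 := by positivity
  nlinarith [mul_nonneg h2 (sq_nonneg (‖w‖ - ‖p‖))]

theorem hasDerivAt_exp_div (Q : ℝ) {z : ℝ} (hz : 0 < z) :
    HasDerivAt (fun z : ℝ => Real.exp (Q / z)) (-(Q / z ^ 2) * Real.exp (Q / z)) z := by
  have := ((hasDerivAt_inv hz.ne').const_mul Q).exp
  simp only [← div_eq_mul_inv] at this
  refine this.congr_deriv ?_
  ring

/-- Gronwall's inequality for the energy `|w|² + |w'|²` of a solution of `w'' + (1 - q/z²) w = 0`: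
its logarithmic derivative is at most `|q|/z²` in absolute value. -/
theorem monotoneOn_energy (hw : ∀ z : ℝ, 0 < z → HasDerivAt w (p z) z)
    (hp : ∀ z : ℝ, 0 < z → HasDerivAt p (-w z + (q / (z : ℂ) ^ 2) * w z) z) :
    MonotoneOn (fun z => (‖w z‖ ^ 2 + ‖p z‖ ^ 2) * Real.exp (-‖q‖ / z)) (Ioi 0) := by
  have hd := fun z (hz : 0 < z) => (hasDerivAt_energy hw hp hz).mul (hasDerivAt_exp_div (-‖q‖) hz)
  refine monotoneOn_of_deriv_nonneg (convex_Ioi 0)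
    (fun z hz => (hd z hz).continuousAt.continuousWithinAt) ?_ ?_
  · rw [interior_Ioi]
    exact fun z hz => (hd z hz).differentiableAt.differentiableWithinAt
  · rw [interior_Ioi]
    intro z hz
    refine le_of_le_of_eq ?_ (hd z hz).deriv.symm
    have h1 := (abs_le.1 (abs_inner_perturbation_le (w z) (p z) q hz)).1
    have h2 := Real.exp_pos (-‖q‖ / z)
    have h3 := mul_nonneg (sub_nonneg.2 h1) h2.le
    simp only [neg_div] at h3 ⊢
    linarith

theorem antitoneOn_energy (hw : ∀ z : ℝ, 0 < z → HasDerivAt w (p z) z)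
    (hp : ∀ z : ℝ, 0 < z → HasDerivAt p (-w z + (q / (z : ℂ) ^ 2) * w z) z) :
    AntitoneOn (fun z => (‖w z‖ ^ 2 + ‖p z‖ ^ 2) * Real.exp (‖q‖ / z)) (Ioi 0) := by
  have hd := fun z (hz : 0 < z) => (hasDerivAt_energy hw hp hz).mul (hasDerivAt_exp_div ‖q‖ hz)
  refine antitoneOn_of_deriv_nonpos (convex_Ioi 0)
    (fun z hz => (hd z hz).continuousAt.continuousWithinAt) ?_ ?_
  · rw [interior_Ioi]
    exact fun z hz => (hd z hz).differentiableAt.differentiableWithinAt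
  · rw [interior_Ioi]
    intro z hz
    refine le_of_eq_of_le (hd z hz).deriv ?_
    have h1 := (abs_le.1 (abs_inner_perturbation_le (w z) (p z) q hz)).2
    have h2 := Real.exp_pos (‖q‖ / z)
    have h3 := mul_nonneg (sub_nonneg.2 h1) h2.le
    linarith

/-- Solutions of `w'' + (1 - q/z²) w = 0` are bounded at infinity together with their
derivatives. -/
theorem energy_le (hw : ∀ z : ℝ, 0 < z → HasDerivAt w (p z) z)
    (hp : ∀ z : ℝ, 0 < z → HasDerivAt p (-w z + (q / (z : ℂ) ^ 2) * w z) z) {z : ℝ} (hz : 1 ≤ z) :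
    ‖w z‖ ^ 2 + ‖p z‖ ^ 2 ≤ (‖w 1‖ ^ 2 + ‖p 1‖ ^ 2) * Real.exp ‖q‖ := by
  have hz0 : 0 < z := one_pos.trans_le hz
  have h1 := antitoneOn_energy hw hp (mem_Ioi.2 one_pos) (mem_Ioi.2 hz0) hz
  have h2 : 1 ≤ Real.exp (‖q‖ / z) := Real.one_le_exp (by positivity)
  simp only [div_one] at h1
  exact (le_mul_of_one_le_right (by positivity) h2).trans h1

theorem le_energy (hw : ∀ z : ℝ, 0 < z → HasDerivAt w (p z) z)
    (hp : ∀ z : ℝ, 0 < z → HasDerivAt p (-w z + (q / (z : ℂ) ^ 2) * w z) z)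
    {z₀ z : ℝ} (hz₀ : 0 < z₀) (hz : z₀ ≤ z) :
    (‖w z₀‖ ^ 2 + ‖p z₀‖ ^ 2) * Real.exp (-‖q‖ / z₀) ≤ ‖w z‖ ^ 2 + ‖p z‖ ^ 2 := by
  have hz0 : 0 < z := hz₀.trans_le hz
  have h1 := monotoneOn_energy hw hp (mem_Ioi.2 hz₀) (mem_Ioi.2 hz0) hz
  have h2 : Real.exp (-‖q‖ / z) ≤ 1 := Real.exp_le_one_iff.2
    (div_nonpos_of_nonpos_of_nonneg (neg_nonpos.2 (norm_nonneg _)) hz0.le)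
  exact h1.trans (mul_le_of_le_one_right (by positivity) h2)

open scoped InnerProductSpace in
/-- A nontrivial solution of `w'' + (1 - q/z²) w = 0` has mean modulus bounded away from zero on
long intervals: `Re (conj w · w')` is bounded and has derivative `|w'|² - |w|² + O(z⁻²)`, so that
`|w|²` takes half of the energy on average. -/
theorem exists_le_integral_norm (hw : ∀ z : ℝ, 0 < z → HasDerivAt w (p z) z)
    (hp : ∀ z : ℝ, 0 < z → HasDerivAt p (-w z + (q / (z : ℂ) ^ 2) * w z) z)
    {z₁ : ℝ} (hz₁ : 0 < z₁) (hw₁ : w z₁ ≠ 0) :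
    ∃ c > 0, ∃ C : ℝ, ∃ z₀ > 0, ∀ P Q : ℝ, z₀ ≤ P → P ≤ Q →
      c * (Q - P) - C ≤ ∫ z in P..Q, ‖w z‖ := by
  -- The energy stays between `e` and `A` on `[z₀, ∞)`.
  set e : ℝ := (‖w z₁‖ ^ 2 + ‖p z₁‖ ^ 2) * Real.exp (-‖q‖ / z₁) with he
  have he0 : 0 < e := by
    have : 0 < ‖w z₁‖ := norm_pos_iff.2 hw₁
    positivity
  set A : ℝ := (‖w 1‖ ^ 2 + ‖p 1‖ ^ 2) * Real.exp ‖q‖ with hA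
  have hA0 : 0 ≤ A := by positivity
  set D : ℝ := √A + 1 with hD
  have hD0 : 0 < D := by positivity
  have hwD : ∀ z, 1 ≤ z → ‖w z‖ ≤ D := fun z hz => by
    have h1 := energy_le hw hp hz
    have h2 : ‖w z‖ ≤ √A := Real.le_sqrt_of_sq_le (by nlinarith [sq_nonneg ‖p z‖])
    linarith
  set z₀ : ℝ := max (max 1 z₁) (2 * (‖q‖ * A) / e + 1)
  have hz₀1 : 1 ≤ z₀ := (le_max_left _ _).trans (le_max_left _ _)
  have hz₀2 : z₁ ≤ z₀ := (le_max_right _ _).trans (le_max_left _ _)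
  have hz₀3 : 2 * (‖q‖ * A) / e ≤ z₀ := by
    linarith [le_max_right (max 1 z₁) (2 * (‖q‖ * A) / e + 1)]
  have hM : ∀ z, 0 < z → HasDerivAt (fun z => ⟪w z, p z⟫_ℝ)
      (⟪w z, -w z + (q / (z : ℂ) ^ 2) * w z⟫_ℝ + ⟪p z, p z⟫_ℝ) z :=
    fun z hz => (hw z hz).inner ℝ (hp z hz)
  have hMle : ∀ z, 1 ≤ z → |⟪w z, p z⟫_ℝ| ≤ A := fun z hz => by
    have h1 := energy_le hw hp hz
    have h2 := abs_real_inner_le_norm (w z) (p z)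
    nlinarith [sq_nonneg (‖w z‖ - ‖p z‖), sq_nonneg ‖w z‖, sq_nonneg ‖p z‖]
  have hcw : ContinuousOn w (Ioi 0) := fun z hz => (hw z hz).continuousAt.continuousWithinAt
  have hcp : ContinuousOn p (Ioi 0) := fun z hz => (hp z hz).continuousAt.continuousWithinAt
  refine ⟨e / 4 / D, by positivity, A / D, z₀, by linarith, fun P Q hP hPQ => ?_⟩
  have hsub : uIcc P Q ⊆ Ioi 0 := by
    rw [uIcc_of_le hPQ]; intro z hz; exact mem_Ioi.2 (by linarith [hz.1])
  have hcw' := hcw.mono hsub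
  have hcp' := hcp.mono hsub
  have hcq : ContinuousOn (fun z : ℝ => q / (z : ℂ) ^ 2) (uIcc P Q) := by
    refine ContinuousOn.div continuousOn_const (by fun_prop) fun z hz => ?_
    have : 0 < z := hsub hz
    exact pow_ne_zero _ (Complex.ofReal_ne_zero.2 this.ne')
  have hderc : ContinuousOn
      (fun z : ℝ => ⟪w z, -w z + (q / (z : ℂ) ^ 2) * w z⟫_ℝ + ⟪p z, p z⟫_ℝ) (uIcc P Q) :=
    (hcw'.inner (𝕜 := ℝ) (hcw'.neg.add (hcq.mul hcw'))).add (hcp'.inner (𝕜 := ℝ) hcp')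
  have hftc := intervalIntegral.integral_eq_sub_of_hasDerivAt (fun z hz => hM z (hsub hz))
    hderc.intervalIntegrable
  have hmono : ∫ z in P..Q, (e / 2 - 2 * ‖w z‖ ^ 2) ≤
      ∫ z in P..Q, (⟪w z, -w z + (q / (z : ℂ) ^ 2) * w z⟫_ℝ + ⟪p z, p z⟫_ℝ) := by
    refine intervalIntegral.integral_mono_on hPQ
      (ContinuousOn.intervalIntegrable (by fun_prop)) hderc.intervalIntegrable fun z hz => ?_
    have hz1 : 1 ≤ z := hz₀1.trans (hP.trans hz.1)
    have hz0 : 0 < z := one_pos.trans_le hz1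
    have h1 := le_energy hw hp hz₁ (hz₀2.trans (hP.trans hz.1))
    have h2 := energy_le hw hp hz1
    have h3 := abs_real_inner_le_norm (w z) ((q / (z : ℂ) ^ 2) * w z)
    rw [norm_mul, norm_div, norm_pow, Complex.norm_real, Real.norm_of_nonneg hz0.le] at h3
    have h4 : ‖q‖ / z ^ 2 * A ≤ e / 2 := by
      rw [div_mul_eq_mul_div, div_le_iff₀ (by positivity)]
      rw [div_le_iff₀ he0] at hz₀3
      have h5 : z₀ * e ≤ z * e := mul_le_mul_of_nonneg_right (hP.trans hz.1) he0.le
      nlinarith [mul_le_mul_of_nonneg_right hz1 (mul_pos hz0 he0).le]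
    have h5 : ‖w z‖ * (‖q‖ / z ^ 2 * ‖w z‖) ≤ ‖q‖ / z ^ 2 * A := by
      have : ‖w z‖ ^ 2 ≤ A := by nlinarith [sq_nonneg ‖p z‖]
      calc _ = ‖q‖ / z ^ 2 * ‖w z‖ ^ 2 := by ring
        _ ≤ _ := by gcongr
    rw [inner_add_right, inner_neg_right, real_inner_self_eq_norm_sq, real_inner_self_eq_norm_sq]
    have h6 := (abs_le.1 h3).1
    rw [← he] at h1
    linarith
  have hint : IntervalIntegrable (fun z => ‖w z‖ ^ 2) volume P Q :=
    ContinuousOn.intervalIntegrable (by fun_prop)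
  rw [intervalIntegral.integral_sub (by simp) (hint.const_mul _),
    intervalIntegral.integral_const, intervalIntegral.integral_const_mul, smul_eq_mul, hftc] at hmono
  have hb1 := (abs_le.1 (hMle P (hz₀1.trans hP))).1
  have hb2 := (abs_le.1 (hMle Q (hz₀1.trans (hP.trans hPQ)))).2
  -- The bound passes from `|w|²` to `|w|` because `|w| ≤ D`.
  have hsq : ∫ z in P..Q, ‖w z‖ ^ 2 ≤ D * ∫ z in P..Q, ‖w z‖ := by
    rw [← intervalIntegral.integral_const_mul]
    refine intervalIntegral.integral_mono_on hPQ hint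
      (ContinuousOn.intervalIntegrable (by fun_prop)) fun z hz => ?_
    rw [sq]
    gcongr
    exact hwD z (hz₀1.trans (hP.trans hz.1))
  have : e / 4 / D * (Q - P) - A / D = (e / 4 * (Q - P) - A) / D := by ring
  rw [this, div_le_iff₀ hD0]
  linarith

end Energy

/-- The order of magnitude of `√z J_ν(z)` with `s = Re ν + 1/2`: it is `z^s` near zero and `1`
at infinity. -/
noncomputable def besselWeight (s x : ℝ) : ℝ := if x ≤ 1 then x ^ s else 1

theorem besselWeight_pos (s : ℝ) {x : ℝ} (hx : 0 < x) : 0 < besselWeight s x := by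
  unfold besselWeight; split_ifs <;> positivity

theorem measurable_besselWeight (s : ℝ) : Measurable (besselWeight s) :=
  Measurable.ite measurableSet_Iic (by fun_prop) measurable_const

theorem besselWeight_mul_le (s : ℝ) {x u : ℝ} (hx : 0 < x) (hu : 0 < u) :
    besselWeight s (x * u) ≤ besselWeight s x * (1 + u ^ s) := by
  have hus : 0 < u ^ s := Real.rpow_pos_of_pos hu s
  have hxs : 0 < x ^ s := Real.rpow_pos_of_pos hx s
  have hxu := Real.mul_rpow hx.le hu.le (z := s)
  unfold besselWeight
  split_ifs with h1 h2 h2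
  · rw [hxu]; nlinarith
  · rw [one_mul]
    rcases le_total 0 s with hs | hs
    · have := Real.rpow_le_one (mul_pos hx hu).le h1 hs
      linarith
    · rw [hxu]
      have := Real.rpow_le_one_of_one_le_of_nonpos (not_le.1 h2).le hs
      nlinarith
  · rcases le_total 0 s with hs | hs
    · have := Real.one_le_rpow (not_le.1 h1).le hs
      rw [hxu] at this
      linarith
    · have := Real.one_le_rpow_of_pos_of_le_one_of_nonpos hx h2 hs
      nlinarith
  · linarith

theorem norm_ofReal_cpow {x : ℝ} (hx : 0 < x) (a : ℂ) : ‖(x : ℂ) ^ a‖ = x ^ a.re :=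
  Complex.norm_cpow_eq_rpow_re_of_pos hx a

theorem norm_sqrtBesselJ_eq (ν : ℂ) {z : ℝ} (hz : 0 < z) :
    ‖sqrtBesselJ ν z‖ =
      ‖(2 : ℂ) ^ (-ν)‖ * (z ^ (ν.re + 1 / 2) * ‖besselSeries ν ((z / 2) ^ 2)‖) := by
  rw [sqrtBesselJ_eq ν hz, norm_mul, norm_mul, norm_ofReal_cpow hz]
  norm_num

theorem norm_two_cpow_pos (a : ℂ) : 0 < ‖(2 : ℂ) ^ a‖ := by
  rw [norm_pos_iff]
  simp [Complex.cpow_eq_zero_iff]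

theorem exists_norm_sqrtBesselJ_le {ν : ℂ} (hν : -1 < ν.re) :
    ∃ C : ℝ, 0 ≤ C ∧ ∀ z : ℝ, 0 < z → ‖sqrtBesselJ ν z‖ ≤ C * besselWeight (ν.re + 1 / 2) z := by
  obtain ⟨B, hB⟩ := (isCompact_Icc (a := (0 : ℝ)) (b := 1)).exists_bound_of_continuousOn
    (continuous_besselSeries hν).continuousOn
  have hB0 : 0 ≤ B := (norm_nonneg _).trans (hB 0 (by simp))
  set A := (‖sqrtBesselJ ν 1‖ ^ 2 + ‖sqrtBesselJ' ν 1‖ ^ 2) * Real.exp ‖ν ^ 2 - 1 / 4‖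
  refine ⟨‖(2 : ℂ) ^ (-ν)‖ * B + √A, by positivity, fun z hz => ?_⟩
  unfold besselWeight
  split_ifs with h1
  · have h2 : ‖besselSeries ν ((z / 2) ^ 2)‖ ≤ B := hB _ ⟨by positivity, by nlinarith⟩
    rw [norm_sqrtBesselJ_eq ν hz]
    have h3 : 0 < z ^ (ν.re + 1 / 2) := Real.rpow_pos_of_pos hz _
    calc _ ≤ ‖(2 : ℂ) ^ (-ν)‖ * (z ^ (ν.re + 1 / 2) * B) := by gcongr
      _ ≤ _ := by nlinarith [mul_nonneg (Real.sqrt_nonneg A) h3.le]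
  · have h2 := energy_le (fun z hz => hasDerivAt_sqrtBesselJ hν hz)
      (fun z hz => hasDerivAt_sqrtBesselJ' hν hz) (not_le.1 h1).le
    have h3 : ‖sqrtBesselJ ν z‖ ≤ √A :=
      Real.le_sqrt_of_sq_le (by nlinarith [sq_nonneg ‖sqrtBesselJ' ν z‖])
    nlinarith [mul_nonneg (norm_nonneg ((2 : ℂ) ^ (-ν))) hB0]

theorem exists_le_norm_sqrtBesselJ {ν : ℂ} (hν : -1 < ν.re) :
    ∃ c > 0, ∃ z₁ > 0, ∀ z : ℝ, 0 < z → z ≤ z₁ →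
      c * z ^ (ν.re + 1 / 2) ≤ ‖sqrtBesselJ ν z‖ := by
  have h0 : besselSeries ν 0 ≠ 0 := by
    rw [besselSeries_zero]
    have := gamma_ne_zero_of_re hν 0
    simpa using this
  have hcont : Continuous fun z : ℝ => ‖besselSeries ν ((z / 2) ^ 2)‖ :=
    ((continuous_besselSeries hν).comp (by fun_prop)).norm
  have hev : ∀ᶠ z in 𝓝 (0 : ℝ), ‖besselSeries ν 0‖ / 2 < ‖besselSeries ν ((z / 2) ^ 2)‖ := by
    refine (hcont.tendsto 0).eventually (lt_mem_nhds ?_)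
    simpa using h0
  obtain ⟨δ, hδ, hb⟩ := Metric.eventually_nhds_iff.1 hev
  refine ⟨‖(2 : ℂ) ^ (-ν)‖ * (‖besselSeries ν 0‖ / 2), ?_, δ / 2, by positivity,
    fun z hz hz1 => ?_⟩
  · have := norm_two_cpow_pos (-ν)
    have := norm_pos_iff.2 h0
    positivity
  · have h1 := hb (show dist z 0 < δ by
      rw [Real.dist_eq, sub_zero, abs_of_pos hz]; linarith)
    rw [norm_sqrtBesselJ_eq ν hz]
    calc _ = ‖(2 : ℂ) ^ (-ν)‖ * (z ^ (ν.re + 1 / 2) * (‖besselSeries ν 0‖ / 2)) := by ring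
      _ ≤ _ := by gcongr

theorem exists_le_integral_norm_sqrtBesselJ {ν : ℂ} (hν : -1 < ν.re) :
    ∃ c > 0, ∃ C : ℝ, ∃ z₀ > 0, ∀ P Q : ℝ, z₀ ≤ P → P ≤ Q →
      c * (Q - P) - C ≤ ∫ z in P..Q, ‖sqrtBesselJ ν z‖ := by
  obtain ⟨c, hc, z₁, hz₁, h⟩ := exists_le_norm_sqrtBesselJ hν
  refine exists_le_integral_norm (fun z hz => hasDerivAt_sqrtBesselJ hν hz)
    (fun z hz => hasDerivAt_sqrtBesselJ' hν hz) hz₁ (norm_pos_iff.1 ?_)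
  exact lt_of_lt_of_le (by positivity) (h z₁ hz₁ le_rfl)

theorem continuousOn_sqrtBesselJ {ν : ℂ} (hν : -1 < ν.re) :
    ContinuousOn (sqrtBesselJ ν) (Ioi 0) :=
  fun _ hz => (hasDerivAt_sqrtBesselJ hν hz).continuousAt.continuousWithinAt

theorem continuousOn_besselJ {ν : ℂ} (hν : -1 < ν.re) : ContinuousOn (besselJ ν) (Ioi 0) := by
  have h1 : ContinuousOn (fun z : ℝ => ((√z : ℝ) : ℂ)⁻¹ * sqrtBesselJ ν z) (Ioi 0) := by
    refine ContinuousOn.mul (ContinuousOn.inv₀ (by fun_prop) fun z hz => ?_)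
      (continuousOn_sqrtBesselJ hν)
    exact Complex.ofReal_ne_zero.2 (Real.sqrt_pos.2 hz).ne'
  refine h1.congr fun z hz => ?_
  have : ((√z : ℝ) : ℂ) ≠ 0 := Complex.ofReal_ne_zero.2 (Real.sqrt_pos.2 hz).ne'
  simp only [sqrtBesselJ]
  field_simp

/-- The weight `u^(ν+1) J_ν(uy)`, common to both transforms, against which `1/(u² + x²)` is
integrated. -/
noncomputable def besselKernel (ν : ℂ) (y u : ℝ) : ℂ := (u : ℂ) ^ (ν + 1) * besselJ ν (u * y)

theorem continuousOn_besselKernel {ν : ℂ} (hν : -1 < ν.re) :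
    ContinuousOn (fun p : ℝ × ℝ => besselKernel ν p.1 p.2) (Ioi 0 ×ˢ Ioi 0) := by
  refine ContinuousOn.mul (fun p hp => ?_) ?_
  · have h1 : ContinuousAt (fun u : ℂ => u ^ (ν + 1)) (p.2 : ℂ) :=
      continuousAt_cpow_const (Complex.ofReal_mem_slitPlane.2 hp.2)
    exact (ContinuousAt.comp (f := fun p : ℝ × ℝ => (p.2 : ℂ)) h1
      (by fun_prop)).continuousWithinAt
  · exact (continuousOn_besselJ hν).comp (f := fun p : ℝ × ℝ => p.2 * p.1) (by fun_prop)
      fun p hp => mem_Ioi.2 (mul_pos hp.2 hp.1)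

theorem sqrt_mul_besselKernel (ν : ℂ) {y u : ℝ} (hy : 0 < y) (hu : 0 < u) :
    (√y : ℂ) * besselKernel ν y u = (u : ℂ) ^ (ν + 1 / 2) * sqrtBesselJ ν (y * u) := by
  have hu' : (u : ℂ) ≠ 0 := Complex.ofReal_ne_zero.2 hu.ne'
  have h2 : (√u : ℂ) = (u : ℂ) ^ (1 / 2 : ℂ) := by
    rw [Real.sqrt_eq_rpow, Complex.ofReal_cpow hu.le]; norm_num
  rw [besselKernel, sqrtBesselJ, Real.sqrt_mul hy.le, Complex.ofReal_mul, h2,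
    show ν + 1 = ν + 1 / 2 + 1 / 2 by ring, Complex.cpow_add _ _ hu', mul_comm u y]
  ring

theorem exists_norm_besselKernel_le {ν : ℂ} (hν : -1 < ν.re) :
    ∃ C : ℝ, 0 ≤ C ∧ ∀ y u : ℝ, 0 < y → 0 < u → √y * ‖besselKernel ν y u‖ ≤
      C * besselWeight (ν.re + 1 / 2) y * (u ^ (ν.re + 1 / 2) + u ^ (2 * ν.re + 1)) := by
  obtain ⟨C, hC, h⟩ := exists_norm_sqrtBesselJ_le hν
  refine ⟨C, hC, fun y u hy hu => ?_⟩
  have h1 := congrArg norm (sqrt_mul_besselKernel ν hy hu)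
  rw [norm_mul, norm_mul, Complex.norm_real, Real.norm_of_nonneg (Real.sqrt_nonneg _),
    norm_ofReal_cpow hu] at h1
  rw [h1]
  have h2 : (ν + 1 / 2).re = ν.re + 1 / 2 := by norm_num
  rw [h2]
  calc _ ≤ u ^ (ν.re + 1 / 2) *
        (C * (besselWeight (ν.re + 1 / 2) y * (1 + u ^ (ν.re + 1 / 2)))) := by
        gcongr
        refine (h _ (mul_pos hy hu)).trans ?_
        gcongr
        exact besselWeight_mul_le _ hy hu
    _ = C * besselWeight (ν.re + 1 / 2) y *
        (u ^ (ν.re + 1 / 2) + u ^ (ν.re + 1 / 2) * u ^ (ν.re + 1 / 2)) := by ring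
    _ = _ := by rw [← Real.rpow_add hu]; ring_nf

/-! ### Weber's integral -/

theorem integral_cpow_mul_gaussian {a : ℂ} (ha : 0 < a.re) {p : ℝ} (hp : 0 < p) :
    ∫ u in Ioi (0 : ℝ), (u : ℂ) ^ (2 * a - 1) * (Real.exp (-p * u ^ 2) : ℂ) =
      1 / 2 * ((1 / p) ^ a * Complex.Gamma a) := by
  rw [← Complex.integral_cpow_mul_exp_neg_mul_Ioi ha hp, ← integral_comp_rpow_Ioi_of_pos
      (g := fun t : ℝ => (t : ℂ) ^ (a - 1) * Complex.exp (-(p * t))) two_pos,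
    ← integral_const_mul]
  refine setIntegral_congr_fun measurableSet_Ioi fun u hu => ?_
  have hu : 0 < u := hu
  have hu' : (u : ℂ) ≠ 0 := Complex.ofReal_ne_zero.2 hu.ne'
  have h1 : ((u ^ (2 : ℝ) : ℝ) : ℂ) ^ (a - 1) = (u : ℂ) ^ (2 * a - 1) * (u : ℂ)⁻¹ := by
    rw [Real.rpow_two, sq, Complex.ofReal_mul, Complex.mul_cpow_ofReal_nonneg hu.le hu.le,
      ← Complex.cpow_neg_one, ← Complex.cpow_add _ _ hu', ← Complex.cpow_add _ _ hu']
    ring_nf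
  simp only [h1]
  rw [Real.rpow_two, Complex.real_smul, show (2 : ℝ) - 1 = 1 by norm_num, Real.rpow_one]
  push_cast
  field_simp

theorem integral_rpow_mul_gaussian {a : ℝ} (ha : 0 < a) {p : ℝ} (hp : 0 < p) :
    ∫ u in Ioi (0 : ℝ), u ^ (2 * a - 1) * Real.exp (-p * u ^ 2) =
      1 / 2 * ((1 / p) ^ a * Real.Gamma a) := by
  have h := integral_rpow_mul_exp_neg_mul_rpow (p := 2) (q := 2 * a - 1) two_pos (by linarith) hp
  simp only [Real.rpow_two] at h
  rw [h, one_div p, Real.inv_rpow hp.le, ← Real.rpow_neg hp.le]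
  ring_nf

/-- The quotients `Γ(Re ν + k + 1) / |Γ(ν + k + 1)|` do not increase with `k`. -/
theorem exists_norm_gamma_inv_mul_gamma_le {ν : ℂ} (hν : -1 < ν.re) :
    ∃ C : ℝ, 0 ≤ C ∧ ∀ k : ℕ,
      ‖(Complex.Gamma (ν + k + 1))⁻¹‖ * Real.Gamma (ν.re + k + 1) ≤ C := by
  have hpos : ∀ k : ℕ, 0 < ν.re + k + 1 := fun k => by
    have h2 : (0 : ℝ) ≤ k := Nat.cast_nonneg k
    linarith
  refine ⟨‖(Complex.Gamma (ν + (0 : ℕ) + 1))⁻¹‖ * Real.Gamma (ν.re + (0 : ℕ) + 1),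
    mul_nonneg (norm_nonneg _) (Real.Gamma_pos_of_pos (hpos 0)).le, fun k => ?_⟩
  induction k with
  | zero => exact le_rfl
  | succ k ih =>
    refine le_trans ?_ ih
    have h1 : ν.re + ((k + 1 : ℕ) : ℝ) + 1 = (ν.re + k + 1) + 1 := by push_cast; ring
    rw [gamma_add_nat_succ hν k, h1, Real.Gamma_add_one (hpos k).ne', mul_inv, norm_mul, norm_inv]
    have h3 : ν.re + k + 1 ≤ ‖ν + k + 1‖ := by
      simpa using Complex.re_le_norm (ν + k + 1)
    have h4 : ‖ν + k + 1‖⁻¹ * (ν.re + k + 1) ≤ 1 := by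
      rw [inv_mul_le_iff₀ ((hpos k).trans_le h3)]; linarith
    have h5 := Real.Gamma_pos_of_pos (hpos k)
    calc _ = (‖ν + k + 1‖⁻¹ * (ν.re + k + 1)) *
          (‖(Complex.Gamma (ν + k + 1))⁻¹‖ * Real.Gamma (ν.re + k + 1)) := by ring
      _ ≤ _ := mul_le_of_le_one_left (by positivity) h4

/-- The function `y^ν (2t)^(-ν-1) exp(-y²/(4t))`, the value of `∫_0^∞ u^(ν+1) J_ν(uy) exp(-t u²) du`
and up to normalization a heat kernel. -/
noncomputable def besselHeat (ν : ℂ) (y t : ℝ) : ℂ :=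
  (y : ℂ) ^ ν * ((2 * t : ℝ) : ℂ) ^ (-ν - 1) * (Real.exp (-y ^ 2 / (4 * t)) : ℂ)

theorem besselKernel_mul_eq_tsum (ν : ℂ) {y u : ℝ} (hy : 0 < y) (hu : 0 < u) (c : ℂ) :
    besselKernel ν y u * c = ∑' k : ℕ, besselCoeff ν k * (((y / 2 : ℝ) : ℂ) ^ ν *
      (((y / 2) ^ 2 : ℝ) : ℂ) ^ k) * ((u : ℂ) ^ (2 * (ν + k + 1) - 1) * c) := by
  have hu' : (u : ℂ) ≠ 0 := Complex.ofReal_ne_zero.2 hu.ne'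
  have h1 : ((u * y / 2 : ℝ) : ℂ) ^ ν = (u : ℂ) ^ ν * ((y / 2 : ℝ) : ℂ) ^ ν := by
    rw [mul_div_assoc, Complex.ofReal_mul, Complex.mul_cpow_ofReal_nonneg hu.le (by positivity)]
  rw [besselKernel, besselJ_eq, besselSeries, h1, ← tsum_mul_left, ← tsum_mul_left,
    ← tsum_mul_right]
  refine tsum_congr fun k => ?_
  have h2 : (u : ℂ) ^ (2 * (ν + k + 1) - 1) = (u : ℂ) ^ (ν + 1) * (u : ℂ) ^ ν * ((u : ℂ) ^ 2) ^ k := by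
    rw [show 2 * (ν + k + 1) - 1 = (ν + 1) + ν + ((2 * k : ℕ) : ℂ) by push_cast; ring,
      Complex.cpow_add _ _ hu', Complex.cpow_add _ _ hu', Complex.cpow_natCast, pow_mul]
  rw [h2]
  push_cast
  ring

/-- Weber's first exponential integral, by termwise integration of the power series. -/
theorem integral_besselKernel_mul_gaussian {ν : ℂ} (hν : -1 < ν.re) {y p : ℝ} (hy : 0 < y)
    (hp : 0 < p) :
    ∫ u in Ioi (0 : ℝ), besselKernel ν y u * (Real.exp (-p * u ^ 2) : ℂ) = besselHeat ν y p := by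
  obtain ⟨C, hC, hCk⟩ := exists_norm_gamma_inv_mul_gamma_le hν
  have hpos : ∀ k : ℕ, 0 < ν.re + k + 1 := fun k => by
    have h2 : (0 : ℝ) ≤ k := Nat.cast_nonneg k
    linarith
  have hre : ∀ k : ℕ, (ν + k + 1).re = ν.re + k + 1 := fun k => by simp
  set F : ℕ → ℝ → ℂ := fun k u => besselCoeff ν k * (((y / 2 : ℝ) : ℂ) ^ ν *
      (((y / 2) ^ 2 : ℝ) : ℂ) ^ k) * ((u : ℂ) ^ (2 * (ν + k + 1) - 1) *
        (Real.exp (-p * u ^ 2) : ℂ)) with hF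
  have hnorm : ∀ k u, u ∈ Ioi (0 : ℝ) → ‖F k u‖ = ‖besselCoeff ν k‖ * ((y / 2) ^ ν.re *
      ((y / 2) ^ 2) ^ k) * (u ^ (2 * (ν.re + k + 1) - 1) * Real.exp (-p * u ^ 2)) := by
    intro k u hu
    simp only [hF, norm_mul, norm_pow, norm_ofReal_cpow (mem_Ioi.1 hu),
      norm_ofReal_cpow (half_pos hy), Complex.norm_real, Real.norm_of_nonneg (Real.exp_pos _).le,
      Real.norm_of_nonneg (sq_nonneg (y / 2))]
    congr 3
    simp
  have hmeas : ∀ k, AEStronglyMeasurable (F k) (volume.restrict (Ioi 0)) := by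
    intro k
    refine ContinuousOn.aestronglyMeasurable (fun u hu => ?_) measurableSet_Ioi
    have h1 : ContinuousAt (fun u : ℂ => u ^ (2 * (ν + k + 1) - 1)) (u : ℂ) :=
      continuousAt_cpow_const (Complex.ofReal_mem_slitPlane.2 hu)
    have h2 : ContinuousAt (fun u : ℝ => (u : ℂ) ^ (2 * (ν + k + 1) - 1)) u :=
      ContinuousAt.comp (f := fun u : ℝ => (u : ℂ)) h1 (by fun_prop)
    exact ((h2.mul (by fun_prop)).const_mul _).continuousWithinAt
  have hint : ∀ k, Integrable (F k) (volume.restrict (Ioi 0)) := by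
    intro k
    refine Integrable.mono' (((integrableOn_rpow_mul_exp_neg_mul_sq hp
      (s := 2 * (ν.re + k + 1) - 1) (by linarith [hpos k])).const_mul (‖besselCoeff ν k‖ *
        ((y / 2) ^ ν.re * ((y / 2) ^ 2) ^ k)))) (hmeas k) ?_
    filter_upwards [ae_restrict_mem measurableSet_Ioi] with u hu
    exact (hnorm k u hu).le
  have hnormint : ∀ k, ∫ u in Ioi (0 : ℝ), ‖F k u‖ ≤
      ((y / 2) ^ ν.re * (1 / 2 * (1 / p) ^ (ν.re + 1) * C)) *
        (((y / 2) ^ 2 / p) ^ k / k.factorial) := by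
    intro k
    rw [setIntegral_congr_fun measurableSet_Ioi (hnorm k), integral_const_mul,
      integral_rpow_mul_gaussian (hpos k) hp, besselCoeff, norm_div, norm_mul, norm_pow, norm_neg,
      norm_one, one_pow, Complex.norm_natCast,
      show ν.re + k + 1 = (ν.re + 1) + k by ring, Real.rpow_add (by positivity),
      Real.rpow_natCast, div_pow ((y / 2) ^ 2) p k]
    have := hCk k
    rw [show ν.re + k + 1 = (ν.re + 1) + k by ring, norm_inv] at this
    calc _ = ((y / 2) ^ ν.re * (1 / 2 * (1 / p) ^ (ν.re + 1) *
          (‖Complex.Gamma (ν + k + 1)‖⁻¹ * Real.Gamma (ν.re + 1 + k)))) *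
          (((y / 2) ^ 2) ^ k / p ^ k / k.factorial) := by
          rw [one_div p, inv_pow]; field_simp
      _ ≤ _ := by gcongr
  have hsum : Summable fun k => ∫ u in Ioi (0 : ℝ), ‖F k u‖ :=
    Summable.of_nonneg_of_le (fun k => integral_nonneg fun _ => norm_nonneg _) hnormint
      ((Real.summable_pow_div_factorial _).mul_left _)
  have key := hasSum_integral_of_summable_integral_norm hint hsum
  rw [setIntegral_congr_fun measurableSet_Ioi
    (fun u hu => besselKernel_mul_eq_tsum ν hy (mem_Ioi.1 hu) _), ← key.tsum_eq]
  have hterm : ∀ k, ∫ u in Ioi (0 : ℝ), F k u =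
      ((y : ℂ) ^ ν * ((2 * p : ℝ) : ℂ) ^ (-ν - 1)) *
        (((-y ^ 2 / (4 * p) : ℝ) : ℂ) ^ k / k.factorial) := by
    intro k
    simp only [hF]
    rw [integral_const_mul, integral_cpow_mul_gaussian (by rw [hre]; exact hpos k) hp, besselCoeff]
    have hp' : (p : ℂ) ≠ 0 := Complex.ofReal_ne_zero.2 hp.ne'
    have hg := gamma_ne_zero_of_re hν k
    have h6 : (k.factorial : ℂ) ≠ 0 := Nat.cast_ne_zero.2 (Nat.factorial_ne_zero _)
    have h7 : (1 / (p : ℂ)) ^ (ν + k + 1) = (p : ℂ) ^ (-ν - 1) * ((p : ℂ) ^ k)⁻¹ := by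
      rw [one_div, Complex.inv_cpow _ _ (by
        rw [Complex.arg_ofReal_of_nonneg hp.le]; exact Real.pi_pos.ne), ← Complex.cpow_neg,
        show -(ν + k + 1) = (-ν - 1) - (k : ℂ) by ring, Complex.cpow_sub _ _ hp',
        Complex.cpow_natCast, div_eq_mul_inv]
    have h8 : ((y / 2 : ℝ) : ℂ) ^ ν = (2 : ℂ) ^ (-ν) * (y : ℂ) ^ ν := by
      rw [div_eq_inv_mul, Complex.ofReal_mul, Complex.mul_cpow_ofReal_nonneg (by norm_num) hy.le,
        Complex.cpow_neg]
      congr 1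
      push_cast
      rw [Complex.inv_cpow _ _ (by
        rw [show (2 : ℂ) = ((2 : ℝ) : ℂ) by norm_num, Complex.arg_ofReal_of_nonneg (by norm_num)]
        exact Real.pi_pos.ne)]
    have h9 : ((2 * p : ℝ) : ℂ) ^ (-ν - 1) = (2 : ℂ) ^ (-ν) * 2⁻¹ * (p : ℂ) ^ (-ν - 1) := by
      rw [Complex.ofReal_mul, Complex.mul_cpow_ofReal_nonneg (by norm_num) hp.le,
        Complex.cpow_sub _ _ (by norm_num), Complex.cpow_one]
      push_cast; ring
    have h10 : ((-y ^ 2 / (4 * p) : ℝ) : ℂ) ^ k =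
        (-1) ^ k * (((y / 2) ^ 2 : ℝ) : ℂ) ^ k * ((p : ℂ) ^ k)⁻¹ := by
      rw [← inv_pow, ← mul_pow, ← mul_pow]
      congr 1
      push_cast
      field_simp
      norm_num
    rw [h7, h8, h9, h10]
    field_simp
  simp only [hterm]
  rw [tsum_mul_left, besselHeat]
  congr 1
  rw [Complex.ofReal_exp, Complex.exp_eq_exp_ℂ, NormedSpace.exp_eq_tsum_div]

/-! ### The Macdonald function and its incomplete version -/

/-- The integrand in `K_ν(z) = ½ ∫_{-∞}^∞ exp(-z cosh τ) exp(-ν τ) dτ`. -/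
noncomputable def macdonaldDensity (ν : ℂ) (z τ : ℝ) : ℂ :=
  (Real.exp (-z * Real.cosh τ) : ℂ) * Complex.exp (-ν * τ)

theorem norm_macdonaldDensity (ν : ℂ) (z τ : ℝ) :
    ‖macdonaldDensity ν z τ‖ = Real.exp (-z * Real.cosh τ + -ν.re * τ) := by
  rw [macdonaldDensity, norm_mul, Complex.norm_real, Real.norm_of_nonneg (Real.exp_pos _).le,
    Complex.norm_exp, ← Real.exp_add]
  simp

theorem continuous_macdonaldDensity (ν : ℂ) (z : ℝ) : Continuous (macdonaldDensity ν z) := by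
  unfold macdonaldDensity; fun_prop

theorem integral_image_mul_exp {b : ℝ} (hb : 0 < b) {A : Set ℝ} (hA : MeasurableSet A)
    (g : ℝ → ℂ) :
    ∫ t in (fun τ => b * Real.exp τ) '' A, g t =
      ∫ τ in A, (b * Real.exp τ) • g (b * Real.exp τ) := by
  rw [integral_image_eq_integral_abs_deriv_smul hA
    (fun τ _ => ((Real.hasDerivAt_exp τ).const_mul b).hasDerivWithinAt)]
  · refine setIntegral_congr_fun hA fun τ _ => ?_
    simp only [abs_of_pos (mul_pos hb (Real.exp_pos τ))]
  · exact fun x _ y _ h => Real.exp_injective (mul_left_cancel₀ hb.ne' h)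

theorem image_mul_exp_univ {b : ℝ} (hb : 0 < b) :
    (fun τ => b * Real.exp τ) '' univ = Ioi 0 := by
  ext t
  simp only [image_univ, mem_range, mem_Ioi]
  constructor
  · rintro ⟨τ, rfl⟩; positivity
  · intro ht
    exact ⟨Real.log (t / b), by rw [Real.exp_log (by positivity)]; field_simp⟩

theorem image_mul_exp_Ioi {b ε : ℝ} (hb : 0 < b) (hε : 0 < ε) :
    (fun τ => b * Real.exp τ) '' Ioi (Real.log (ε / b)) = Ioi ε := by
  ext t
  simp only [mem_image, mem_Ioi]
  constructor
  · rintro ⟨τ, hτ, rfl⟩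
    rw [Real.log_lt_iff_lt_exp (by positivity), div_lt_iff₀ hb] at hτ
    linarith
  · intro ht
    have ht0 := hε.trans ht
    refine ⟨Real.log (t / b), Real.log_lt_log (by positivity) (by gcongr), ?_⟩
    rw [Real.exp_log (by positivity)]; field_simp

theorem integrable_exp_neg_exp {N z : ℝ} (hN : 0 < N) (hz : 0 < z) :
    Integrable (fun τ : ℝ => Real.exp (-(z / 2) * Real.exp τ + N * τ)) ∧
      ∫ τ : ℝ, Real.exp (-(z / 2) * Real.exp τ + N * τ) = (2 / z) ^ N * Real.Gamma N := by
  have himg := image_mul_exp_univ one_pos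
  simp only [one_mul] at himg
  have hcongr : ∀ τ : ℝ, |Real.exp τ| • ((Real.exp τ) ^ (N - 1) *
      Real.exp (-((z / 2) * Real.exp τ))) = Real.exp (-(z / 2) * Real.exp τ + N * τ) := by
    intro τ
    rw [abs_of_pos (Real.exp_pos τ), smul_eq_mul, ← Real.exp_mul, ← Real.exp_add, ← Real.exp_add]
    congr 1; ring
  constructor
  · have h1 : IntegrableOn (fun s : ℝ => s ^ (N - 1) * Real.exp (-((z / 2) * s))) (Ioi 0) := by
      have := integrableOn_rpow_mul_exp_neg_mul_rpow (p := 1) (s := N - 1) (b := z / 2)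
        (by linarith) one_pos (by positivity)
      simpa only [Real.rpow_one, neg_mul] using this
    rw [← himg, integrableOn_image_iff_integrableOn_abs_deriv_smul MeasurableSet.univ
      (fun τ _ => (Real.hasDerivAt_exp τ).hasDerivWithinAt) Real.exp_injective.injOn,
      integrableOn_univ] at h1
    exact h1.congr (ae_of_all _ hcongr)
  · have h1 := Real.integral_rpow_mul_exp_neg_mul_Ioi hN (half_pos hz)
    rw [← himg, integral_image_eq_integral_abs_deriv_smul MeasurableSet.univ
      (fun τ _ => (Real.hasDerivAt_exp τ).hasDerivWithinAt) Real.exp_injective.injOn,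
      setIntegral_univ] at h1
    rw [← integral_congr_ae (ae_of_all _ hcongr), h1, one_div_div]

/-- A majorant made of two Gamma integrands, since `cosh τ ≥ exp |τ| / 2`. -/
theorem norm_macdonaldDensity_le {ν : ℂ} {N : ℝ} (hN : |ν.re| ≤ N) {z : ℝ} (hz : 0 < z) (τ : ℝ) :
    ‖macdonaldDensity ν z τ‖ ≤ Real.exp (-(z / 2) * Real.exp τ + N * τ) +
      Real.exp (-(z / 2) * Real.exp (-τ) + N * -τ) := by
  rw [norm_macdonaldDensity]
  have h1 := abs_le.1 hN
  have hc := Real.cosh_eq τ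
  rcases le_total 0 τ with h | h
  · refine le_add_of_le_of_nonneg (Real.exp_le_exp.2 ?_) (Real.exp_pos _).le
    rw [hc]
    nlinarith [mul_pos hz (Real.exp_pos (-τ))]
  · refine le_add_of_nonneg_of_le (Real.exp_pos _).le (Real.exp_le_exp.2 ?_)
    rw [hc]
    nlinarith [mul_pos hz (Real.exp_pos τ)]

theorem integrable_macdonaldDensity (ν : ℂ) {z : ℝ} (hz : 0 < z) :
    Integrable (macdonaldDensity ν z) := by
  have h1 := (integrable_exp_neg_exp (N := |ν.re| + 1) (by positivity) hz).1
  exact (h1.add h1.comp_neg).mono' (continuous_macdonaldDensity ν z).aestronglyMeasurable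
    (ae_of_all _ (norm_macdonaldDensity_le (by linarith) hz))

theorem integral_norm_macdonaldDensity_le {ν : ℂ} {N : ℝ} (hN0 : 0 < N) (hN : |ν.re| ≤ N) {z : ℝ}
    (hz : 0 < z) : ∫ τ : ℝ, ‖macdonaldDensity ν z τ‖ ≤ 2 * ((2 / z) ^ N * Real.Gamma N) := by
  obtain ⟨h1, h2⟩ := integrable_exp_neg_exp hN0 hz
  refine (integral_mono (integrable_macdonaldDensity ν hz).norm (h1.add h1.comp_neg)
    (norm_macdonaldDensity_le hN hz)).trans (le_of_eq ?_)
  have h3 := integral_neg_eq_self (fun τ : ℝ => Real.exp (-(z / 2) * Real.exp τ + N * τ)) volume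
  simp only [Pi.add_apply]
  rw [integral_add h1 h1.comp_neg, h3, h2]
  ring

theorem besselK_eq_integral (ν : ℂ) {z : ℝ} (hz : 0 < z) :
    besselK ν z = 1 / 2 * ∫ τ : ℝ, macdonaldDensity ν z τ := by
  have hi := integrable_macdonaldDensity ν hz
  rw [← intervalIntegral.integral_Iic_add_Ioi (b := 0) hi.integrableOn hi.integrableOn]
  have h1 := integral_comp_neg_Iic 0 (fun τ => macdonaldDensity ν z (-τ))
  simp only [neg_neg, neg_zero] at h1
  rw [h1, ← integral_add hi.comp_neg.integrableOn hi.integrableOn, besselK, ← integral_const_mul]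
  refine setIntegral_congr_fun measurableSet_Ioi fun t _ => ?_
  simp only [macdonaldDensity, Real.cosh_neg, Complex.cosh]
  push_cast
  ring_nf

theorem besselK_neg (ν : ℂ) (z : ℝ) : besselK (-ν) z = besselK ν z := by
  simp only [besselK, neg_mul, Complex.cosh_neg]

/-- The part `½ ∫_T^∞ exp(-z cosh τ) exp(-ν τ) dτ` of the integral for `K_ν(z)`. -/
noncomputable def incompleteBesselK (ν : ℂ) (T z : ℝ) : ℂ :=
  1 / 2 * ∫ τ in Ioi T, macdonaldDensity ν z τ

theorem norm_incompleteBesselK_le (ν : ℂ) {T z : ℝ} (hz : 0 < z) :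
    ‖incompleteBesselK ν T z‖ ≤ 1 / 2 * ∫ τ : ℝ, ‖macdonaldDensity ν z τ‖ := by
  rw [incompleteBesselK, norm_mul]
  have h1 : ‖(1 / 2 : ℂ)‖ = 1 / 2 := by norm_num
  rw [h1]
  gcongr
  refine (norm_integral_le_integral_norm _).trans ?_
  exact setIntegral_le_integral (integrable_macdonaldDensity ν hz).norm
    (ae_of_all _ fun _ => norm_nonneg _)

theorem ofReal_exp_cpow (τ : ℝ) (a : ℂ) : ((Real.exp τ : ℝ) : ℂ) ^ a = Complex.exp (a * τ) := by
  rw [Complex.cpow_def_of_ne_zero (Complex.ofReal_ne_zero.2 (Real.exp_pos τ).ne'),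
    ← Complex.ofReal_log (Real.exp_pos τ).le, Real.log_exp, mul_comm]

/-- The substitution `t = (y / (2x)) exp τ` turns `exp(-x² t) besselHeat ν y t dt` into the integrand
of the two-sided integral for `K_ν(xy)`. -/
theorem exp_mul_besselHeat (ν : ℂ) {x y : ℝ} (hx : 0 < x) (hy : 0 < y) (τ : ℝ) :
    (y / (2 * x) * Real.exp τ) • ((Real.exp (-x ^ 2 * (y / (2 * x) * Real.exp τ)) : ℂ) *
      besselHeat ν y (y / (2 * x) * Real.exp τ)) =
      (x : ℂ) ^ ν * (1 / 2) * macdonaldDensity ν (x * y) τ := by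
  have hx' : (x : ℂ) ≠ 0 := Complex.ofReal_ne_zero.2 hx.ne'
  have hy' : (y : ℂ) ≠ 0 := Complex.ofReal_ne_zero.2 hy.ne'
  have h1 : ((2 * (y / (2 * x) * Real.exp τ) : ℝ) : ℂ) ^ (-ν - 1) =
      ((y : ℂ) ^ ν)⁻¹ * (y : ℂ)⁻¹ * ((x : ℂ) ^ ν * x) *
        (Complex.exp (-ν * τ) * (Real.exp τ : ℂ)⁻¹) := by
    rw [show 2 * (y / (2 * x) * Real.exp τ) = y * x⁻¹ * Real.exp τ by field_simp,
      Complex.ofReal_mul, Complex.mul_cpow_ofReal_nonneg (by positivity) (Real.exp_pos _).le,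
      Complex.ofReal_mul, Complex.mul_cpow_ofReal_nonneg hy.le (by positivity), ofReal_exp_cpow]
    have h2 : (y : ℂ) ^ (-ν - 1) = ((y : ℂ) ^ ν)⁻¹ * (y : ℂ)⁻¹ := by
      rw [Complex.cpow_sub _ _ hy', Complex.cpow_neg, Complex.cpow_one, div_eq_mul_inv]
    have h3 : ((x⁻¹ : ℝ) : ℂ) ^ (-ν - 1) = (x : ℂ) ^ ν * x := by
      rw [Complex.ofReal_inv, Complex.inv_cpow _ _ (by
        rw [Complex.arg_ofReal_of_nonneg hx.le]; exact Real.pi_pos.ne), ← Complex.cpow_neg,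
        show -(-ν - 1) = ν + 1 by ring, Complex.cpow_add _ _ hx', Complex.cpow_one]
    have h4 : Complex.exp ((-ν - 1) * τ) = Complex.exp (-ν * τ) * (Real.exp τ : ℂ)⁻¹ := by
      rw [Complex.ofReal_exp, ← Complex.exp_neg, ← Complex.exp_add]
      congr 1; ring
    rw [h2, h3, h4]
  have h5 : Real.exp (-x ^ 2 * (y / (2 * x) * Real.exp τ)) *
      Real.exp (-y ^ 2 / (4 * (y / (2 * x) * Real.exp τ))) =
      Real.exp (-(x * y) * Real.cosh τ) := by
    rw [← Real.exp_add]
    congr 1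
    rw [Real.cosh_eq, Real.exp_neg]
    have := (Real.exp_pos τ).ne'
    field_simp
    ring
  have h6 : (y : ℂ) ^ ν ≠ 0 := by simp [Complex.cpow_eq_zero_iff, hy']
  have h7 : (Real.exp τ : ℂ) ≠ 0 := Complex.ofReal_ne_zero.2 (Real.exp_pos τ).ne'
  rw [besselHeat, macdonaldDensity, ← h5, h1, Complex.real_smul, Complex.ofReal_mul,
    Complex.ofReal_mul]
  have h8 : ((y / (2 * x) : ℝ) : ℂ) = y / (2 * x) := by push_cast; rfl
  rw [h8]
  generalize ((Real.exp (-x ^ 2 * (y / (2 * x) * Real.exp τ)) : ℝ) : ℂ) = e1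
  generalize ((Real.exp (-y ^ 2 / (4 * (y / (2 * x) * Real.exp τ))) : ℝ) : ℂ) = e2
  generalize ((Real.exp τ : ℝ) : ℂ) = e3 at *
  field_simp

theorem integral_besselHeat_Ioi_zero (ν : ℂ) {x y : ℝ} (hx : 0 < x) (hy : 0 < y) :
    ∫ t in Ioi (0 : ℝ), (Real.exp (-x ^ 2 * t) : ℂ) * besselHeat ν y t =
      (x : ℂ) ^ ν * besselK ν (x * y) := by
  have hb : 0 < y / (2 * x) := by positivity
  rw [← image_mul_exp_univ hb, integral_image_mul_exp hb MeasurableSet.univ, setIntegral_univ]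
  simp only [exp_mul_besselHeat ν hx hy]
  rw [integral_const_mul, besselK_eq_integral ν (mul_pos hx hy), mul_assoc]

theorem integral_besselHeat_Ioi (ν : ℂ) {x y ε : ℝ} (hx : 0 < x) (hy : 0 < y) (hε : 0 < ε) :
    ∫ t in Ioi ε, (Real.exp (-x ^ 2 * t) : ℂ) * besselHeat ν y t =
      (x : ℂ) ^ ν * incompleteBesselK ν (Real.log (ε / (y / (2 * x)))) (x * y) := by
  have hb : 0 < y / (2 * x) := by positivity
  rw [← image_mul_exp_Ioi hb hε, integral_image_mul_exp hb measurableSet_Ioi]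
  simp only [exp_mul_besselHeat ν hx hy]
  rw [integral_const_mul, incompleteBesselK, mul_assoc]

theorem integral_Ioi_shift (h : ℝ → ℂ) (x ε : ℝ) :
    ∫ s in Ioi (0 : ℝ), (Real.exp (-x ^ 2 * s) : ℂ) * h (s + ε) =
      (Real.exp (ε * x ^ 2) : ℂ) * ∫ t in Ioi ε, (Real.exp (-x ^ 2 * t) : ℂ) * h t := by
  rw [← integral_const_mul, ← integral_indicator measurableSet_Ioi,
    ← integral_indicator measurableSet_Ioi,
    ← integral_add_right_eq_self ((Ioi ε).indicator _) ε]
  congr 1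
  ext s
  by_cases hs : 0 < s
  · rw [indicator_of_mem (mem_Ioi.2 hs), indicator_of_mem (mem_Ioi.2 (by linarith)), ← mul_assoc,
      ← Complex.ofReal_mul, ← Real.exp_add]
    congr 3
    ring_nf
  · rw [indicator_of_notMem (by simpa using hs), indicator_of_notMem (by simpa using hs)]

theorem rpow_mul_exp_neg_le {a r : ℝ} (ha : 0 < a) (hr : 0 < r) :
    r ^ a * Real.exp (-r) ≤ a ^ a := by
  have h1 : (r / a) ^ a ≤ Real.exp r := by
    have h2 : r / a ≤ Real.exp (r / a) := by linarith [Real.add_one_le_exp (r / a)]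
    calc (r / a) ^ a ≤ (Real.exp (r / a)) ^ a := Real.rpow_le_rpow (by positivity) h2 ha.le
      _ = Real.exp r := by rw [← Real.exp_mul]; congr 1; field_simp
  rw [Real.div_rpow hr.le ha.le, div_le_iff₀ (by positivity)] at h1
  rw [Real.exp_neg, ← div_eq_mul_inv, div_le_iff₀ (Real.exp_pos r)]
  linarith

theorem exists_norm_besselHeat_le {ν : ℂ} (hν : -1 < ν.re) {y : ℝ} (hy : 0 < y) :
    ∃ C : ℝ, 0 ≤ C ∧ ∀ t : ℝ, 0 < t → ‖besselHeat ν y t‖ ≤ C := by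
  have ha : 0 < ν.re + 1 := by linarith
  refine ⟨y ^ ν.re * ((2 / y ^ 2) ^ (ν.re + 1) * (ν.re + 1) ^ (ν.re + 1)), by positivity,
    fun t ht => ?_⟩
  rw [besselHeat, norm_mul, norm_mul, norm_ofReal_cpow hy, norm_ofReal_cpow (by positivity),
    Complex.norm_real, Real.norm_of_nonneg (Real.exp_pos _).le]
  have h1 := rpow_mul_exp_neg_le ha (r := y ^ 2 / (4 * t)) (by positivity)
  have h2 : (2 * t) ^ (-ν - 1).re = (2 / y ^ 2) ^ (ν.re + 1) * (y ^ 2 / (4 * t)) ^ (ν.re + 1) := by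
    rw [← Real.mul_rpow (by positivity) (by positivity),
      show 2 / y ^ 2 * (y ^ 2 / (4 * t)) = (2 * t)⁻¹ by field_simp; norm_num,
      Real.inv_rpow (by positivity), ← Real.rpow_neg (by positivity)]
    congr 1
    simp; ring
  rw [h2, mul_assoc, mul_assoc, neg_div]
  gcongr

theorem continuousOn_besselHeat (ν : ℂ) (y : ℝ) : ContinuousOn (besselHeat ν y) (Ioi 0) := by
  intro t ht
  have ht : 0 < t := ht
  have h1 : ContinuousAt (fun u : ℂ => u ^ (-ν - 1)) ((2 * t : ℝ) : ℂ) :=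
    continuousAt_cpow_const (Complex.ofReal_mem_slitPlane.2 (by positivity))
  have h2 : ContinuousAt (fun t : ℝ => ((2 * t : ℝ) : ℂ) ^ (-ν - 1)) t :=
    ContinuousAt.comp (f := fun t : ℝ => ((2 * t : ℝ) : ℂ)) h1 (by fun_prop)
  have h3 : ContinuousAt (fun t : ℝ => (Real.exp (-y ^ 2 / (4 * t)) : ℂ)) t := by
    have : ContinuousAt (fun t : ℝ => -y ^ 2 / (4 * t)) t :=
      ContinuousAt.div (by fun_prop) (by fun_prop) (by positivity)
    exact (Complex.continuous_ofReal.comp Real.continuous_exp).continuousAt.comp this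
  exact ((continuousAt_const.mul h2).mul h3).continuousWithinAt

/-! ### Gaussian means of the potential kernel -/

/-- The kernel `u^(ν+1) J_ν(uy) / (x² + u²)`, whose integral over `u` is formally
`x^ν K_ν(xy)`. -/
noncomputable def potentialKernel (ν : ℂ) (x y u : ℝ) : ℂ :=
  besselKernel ν y u * ((x ^ 2 + u ^ 2 : ℝ) : ℂ)⁻¹

theorem integrableOn_rpow_add_rpow_gaussian {μ : ℝ} (hμ : -1 < μ) {ε : ℝ} (hε : 0 < ε) :
    IntegrableOn (fun u : ℝ => (u ^ (μ + 1 / 2) + u ^ (2 * μ + 1)) * Real.exp (-ε * u ^ 2))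
      (Ioi 0) := by
  simp only [add_mul]
  exact (integrableOn_rpow_mul_exp_neg_mul_sq hε (by linarith)).add
    (integrableOn_rpow_mul_exp_neg_mul_sq hε (by linarith))

theorem exists_norm_besselKernel_le_const {ν : ℂ} (hν : -1 < ν.re) {y : ℝ} (hy : 0 < y) :
    ∃ C : ℝ, 0 ≤ C ∧ ∀ u : ℝ, 0 < u →
      ‖besselKernel ν y u‖ ≤ C * (u ^ (ν.re + 1 / 2) + u ^ (2 * ν.re + 1)) := by
  obtain ⟨C, hC, h⟩ := exists_norm_besselKernel_le hν
  have hs : 0 < √y := Real.sqrt_pos.2 hy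
  have hw := besselWeight_pos (ν.re + 1 / 2) hy
  refine ⟨C * besselWeight (ν.re + 1 / 2) y / √y, by positivity, fun u hu => ?_⟩
  have := h y u hy hu
  rw [div_mul_eq_mul_div, le_div_iff₀ hs]
  linarith

theorem continuousOn_besselKernel_right {ν : ℂ} (hν : -1 < ν.re) {y : ℝ} (hy : 0 < y) :
    ContinuousOn (besselKernel ν y) (Ioi 0) :=
  (continuousOn_besselKernel hν).comp (f := fun u : ℝ => (y, u)) (by fun_prop) fun _ hu => ⟨hy, hu⟩

theorem integrableOn_besselKernel_gaussian {ν : ℂ} (hν : -1 < ν.re) {y ε : ℝ} (hy : 0 < y)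
    (hε : 0 < ε) :
    IntegrableOn (fun u : ℝ => besselKernel ν y u * (Real.exp (-ε * u ^ 2) : ℂ)) (Ioi 0) := by
  obtain ⟨C, hC, h⟩ := exists_norm_besselKernel_le_const hν hy
  refine Integrable.mono' ((integrableOn_rpow_add_rpow_gaussian hν hε).const_mul C) ?_ ?_
  · exact ((continuousOn_besselKernel_right hν hy).mul (by fun_prop)).aestronglyMeasurable
      measurableSet_Ioi
  · filter_upwards [ae_restrict_mem measurableSet_Ioi] with u hu
    rw [norm_mul, Complex.norm_real, Real.norm_of_nonneg (Real.exp_pos _).le, ← mul_assoc]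
    gcongr
    exact h u hu

theorem continuousOn_potentialKernel {ν : ℂ} (hν : -1 < ν.re) {x y : ℝ} (hx : 0 < x) (hy : 0 < y) :
    ContinuousOn (potentialKernel ν x y) (Ioi 0) := by
  refine (continuousOn_besselKernel_right hν hy).mul (ContinuousOn.inv₀ (by fun_prop) ?_)
  intro u _
  exact Complex.ofReal_ne_zero.2 (by positivity)

theorem norm_potentialKernel (ν : ℂ) {x y u : ℝ} :
    ‖potentialKernel ν x y u‖ = ‖besselKernel ν y u‖ * (x ^ 2 + u ^ 2)⁻¹ := by
  rw [potentialKernel, norm_mul, norm_inv, Complex.norm_real, Real.norm_of_nonneg (by positivity)]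

theorem integral_exp_neg_mul_Ioi {c : ℝ} (hc : 0 < c) :
    ∫ s in Ioi (0 : ℝ), Real.exp (-c * s) = c⁻¹ := by
  rw [integral_exp_mul_Ioi (by linarith)]
  simp [neg_div, div_neg]

/-- Writing `1/(x² + u²)` as a Laplace integral turns the Gaussian mean of the potential kernel
into an integral of Weber's integral. -/
theorem integral_gaussian_potentialKernel {ν : ℂ} (hν : -1 < ν.re) {x y ε : ℝ} (hx : 0 < x)
    (hy : 0 < y) (hε : 0 < ε) :
    ∫ u in Ioi (0 : ℝ), (Real.exp (-ε * u ^ 2) : ℂ) * potentialKernel ν x y u =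
      ∫ s in Ioi (0 : ℝ), (Real.exp (-x ^ 2 * s) : ℂ) * besselHeat ν y (s + ε) := by
  set F : ℝ → ℝ → ℂ := fun u s => besselKernel ν y u * (Real.exp (-ε * u ^ 2) : ℂ) *
    (Real.exp (-(x ^ 2 + u ^ 2) * s) : ℂ) with hF
  have hF1 : Integrable (Function.uncurry F)
      ((volume.restrict (Ioi (0 : ℝ))).prod (volume.restrict (Ioi (0 : ℝ)))) := by
    have hdom := (integrableOn_besselKernel_gaussian hν hy hε).norm.mul_prod
      (integrableOn_exp_mul_Ioi (a := -x ^ 2) (by nlinarith) 0)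
    refine hdom.mono' ?_ ?_
    · rw [Measure.prod_restrict]
      refine ContinuousOn.aestronglyMeasurable ?_ (measurableSet_Ioi.prod measurableSet_Ioi)
      refine ContinuousOn.mul (ContinuousOn.mul ?_ (by fun_prop)) (by fun_prop)
      exact (continuousOn_besselKernel_right hν hy).comp (by fun_prop) fun p hp => hp.1
    · rw [Measure.prod_restrict]
      filter_upwards [ae_restrict_mem (measurableSet_Ioi.prod measurableSet_Ioi)] with p hp
      have hs : 0 < p.2 := hp.2
      simp only [Function.uncurry, hF]
      rw [norm_mul, Complex.norm_real, Real.norm_of_nonneg (Real.exp_pos _).le]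
      gcongr
      nlinarith [mul_nonneg (sq_nonneg p.1) hs.le]
  have hswap := integral_integral_swap hF1
  have hL : ∀ u ∈ Ioi (0 : ℝ), ∫ s in Ioi (0 : ℝ), F u s =
      (Real.exp (-ε * u ^ 2) : ℂ) * potentialKernel ν x y u := by
    intro u hu
    simp only [hF]
    rw [integral_const_mul, integral_complex_ofReal, integral_exp_neg_mul_Ioi (by positivity),
      potentialKernel]
    push_cast
    ring
  have hR : ∀ s ∈ Ioi (0 : ℝ), ∫ u in Ioi (0 : ℝ), F u s =
      (Real.exp (-x ^ 2 * s) : ℂ) * besselHeat ν y (s + ε) := by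
    intro s hs
    have hs : 0 < s := hs
    rw [← integral_besselKernel_mul_gaussian hν hy (show 0 < s + ε by linarith),
      ← integral_const_mul]
    congr 1
    ext u
    simp only [hF]
    rw [mul_assoc, ← Complex.ofReal_mul, ← Real.exp_add, mul_left_comm, ← Complex.ofReal_mul,
      ← Real.exp_add]
    congr 3
    ring
  rw [← setIntegral_congr_fun measurableSet_Ioi hL, hswap,
    setIntegral_congr_fun measurableSet_Ioi hR]

theorem integrableOn_gaussian_potentialKernel {ν : ℂ} (hν : -1 < ν.re) {x y ε : ℝ} (hx : 0 < x)
    (hy : 0 < y) (hε : 0 < ε) :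
    IntegrableOn (fun u : ℝ => (Real.exp (-ε * u ^ 2) : ℂ) * potentialKernel ν x y u) (Ioi 0) := by
  refine Integrable.mono' ((integrableOn_besselKernel_gaussian hν hy hε).norm.const_mul
    (x ^ 2)⁻¹) ?_ ?_
  · exact (ContinuousOn.mul (by fun_prop) (continuousOn_potentialKernel hν hx hy)).aestronglyMeasurable
      measurableSet_Ioi
  · refine ae_of_all _ fun u => ?_
    rw [norm_mul, norm_potentialKernel, norm_mul]
    have : (x ^ 2 + u ^ 2)⁻¹ ≤ (x ^ 2)⁻¹ := by
      gcongr
      nlinarith [sq_nonneg u]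
    calc _ = (x ^ 2 + u ^ 2)⁻¹ * (‖besselKernel ν y u‖ * ‖(Real.exp (-ε * u ^ 2) : ℂ)‖) := by ring
      _ ≤ _ := by gcongr

/-- The Gaussian means of the potential kernel are incomplete Macdonald integrals. -/
theorem integral_gaussian_potentialKernel_eq_incomplete {ν : ℂ} (hν : -1 < ν.re) {x y ε : ℝ}
    (hx : 0 < x) (hy : 0 < y) (hε : 0 < ε) :
    ∫ u in Ioi (0 : ℝ), (Real.exp (-ε * u ^ 2) : ℂ) * potentialKernel ν x y u =
      (Real.exp (ε * x ^ 2) : ℂ) *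
        ((x : ℂ) ^ ν * incompleteBesselK ν (Real.log (ε / (y / (2 * x)))) (x * y)) := by
  rw [integral_gaussian_potentialKernel hν hx hy hε, integral_Ioi_shift,
    integral_besselHeat_Ioi ν hx hy hε]

theorem exists_norm_integral_gaussian_potentialKernel_le {ν : ℂ} (hν : -1 < ν.re) {y : ℝ}
    (hy : 0 < y) :
    ∃ C : ℝ, 0 ≤ C ∧ ∀ x ε : ℝ, 0 < x → 0 < ε →
      ‖∫ u in Ioi (0 : ℝ), (Real.exp (-ε * u ^ 2) : ℂ) * potentialKernel ν x y u‖ ≤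
        C * (x ^ 2)⁻¹ := by
  obtain ⟨C, hC, h⟩ := exists_norm_besselHeat_le hν hy
  refine ⟨C, hC, fun x ε hx hε => ?_⟩
  have hx2 : 0 < x ^ 2 := by positivity
  rw [integral_gaussian_potentialKernel hν hx hy hε, ← integral_exp_neg_mul_Ioi hx2,
    ← integral_const_mul]
  refine norm_integral_le_of_norm_le
    ((integrableOn_exp_mul_Ioi (a := -x ^ 2) (by linarith) 0).const_mul C) ?_
  filter_upwards [ae_restrict_mem measurableSet_Ioi] with s hs
  rw [norm_mul, Complex.norm_real, Real.norm_of_nonneg (Real.exp_pos _).le, mul_comm]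
  gcongr
  exact h _ (by have : 0 < s := hs
                linarith)

theorem tendsto_integral_gaussian_potentialKernel {ν : ℂ} (hν : -1 < ν.re) {x y : ℝ}
    (hx : 0 < x) (hy : 0 < y) :
    Tendsto (fun ε : ℝ =>
      ∫ u in Ioi (0 : ℝ), (Real.exp (-ε * u ^ 2) : ℂ) * potentialKernel ν x y u) (𝓝[>] 0)
      (𝓝 ((x : ℂ) ^ ν * besselK ν (x * y))) := by
  obtain ⟨C, hC, h⟩ := exists_norm_besselHeat_le hν hy
  have hx2 : 0 < x ^ 2 := by positivity
  rw [← integral_besselHeat_Ioi_zero ν hx hy]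
  have key : Tendsto (fun ε : ℝ =>
      ∫ s in Ioi (0 : ℝ), (Real.exp (-x ^ 2 * s) : ℂ) * besselHeat ν y (s + ε)) (𝓝[>] 0)
      (𝓝 (∫ s in Ioi (0 : ℝ), (Real.exp (-x ^ 2 * s) : ℂ) * besselHeat ν y s)) := by
    refine tendsto_integral_filter_of_dominated_convergence
      (fun s => C * Real.exp (-x ^ 2 * s)) ?_ ?_
      ((integrableOn_exp_mul_Ioi (a := -x ^ 2) (by linarith) 0).const_mul C) ?_
    · filter_upwards [self_mem_nhdsWithin] with ε hε
      refine ContinuousOn.aestronglyMeasurable (ContinuousOn.mul (by fun_prop) ?_)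
        measurableSet_Ioi
      exact (continuousOn_besselHeat ν y).comp (by fun_prop) fun s hs =>
        mem_Ioi.2 (add_pos hs hε)
    · filter_upwards [self_mem_nhdsWithin] with ε hε
      filter_upwards [ae_restrict_mem measurableSet_Ioi] with s hs
      rw [norm_mul, Complex.norm_real, Real.norm_of_nonneg (Real.exp_pos _).le, mul_comm]
      gcongr
      exact h _ (add_pos hs hε)
    · filter_upwards [ae_restrict_mem measurableSet_Ioi] with s hs
      refine Tendsto.const_mul _ ?_
      have h1 : ContinuousAt (besselHeat ν y) s :=
        (continuousOn_besselHeat ν y).continuousAt (Ioi_mem_nhds hs)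
      have h2 : Tendsto (fun ε : ℝ => s + ε) (𝓝[>] 0) (𝓝 s) := by
        have : Tendsto (fun ε : ℝ => s + ε) (𝓝 0) (𝓝 (s + 0)) :=
          (continuous_const.add continuous_id).tendsto 0
        rw [add_zero] at this
        exact this.mono_left nhdsWithin_le_nhds
      exact h1.tendsto.comp h2
  refine key.congr' ?_
  filter_upwards [self_mem_nhdsWithin] with ε hε
  exact (integral_gaussian_potentialKernel hν hx hy hε).symm

theorem integrableOn_rpow_add_rpow_Ioc {μ : ℝ} (hμ : -1 < μ) (a : ℝ) (ha : 0 < a) :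
    IntegrableOn (fun u : ℝ => u ^ (μ + 1 / 2) + u ^ (2 * μ + 1)) (Ioc 0 a) := by
  rw [← intervalIntegrable_iff_integrableOn_Ioc_of_le ha.le]
  exact (intervalIntegral.intervalIntegrable_rpow' (by linarith)).add
    (intervalIntegral.intervalIntegrable_rpow' (by linarith))

theorem integral_Ioc_rpow_add_rpow_nonneg (μ a : ℝ) :
    0 ≤ ∫ u in Ioc 0 a, (u ^ (μ + 1 / 2) + u ^ (2 * μ + 1)) :=
  setIntegral_nonneg measurableSet_Ioc fun u hu => by
    have := hu.1
    positivity

theorem tendsto_integral_Ioc_rpow_add_rpow {μ : ℝ} (hμ : -1 < μ) :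
    Tendsto (fun a : ℝ => ∫ u in Ioc 0 a, (u ^ (μ + 1 / 2) + u ^ (2 * μ + 1))) (𝓝[>] 0) (𝓝 0) := by
  have h1 := integrableOn_rpow_add_rpow_Ioc hμ 1 one_pos
  rw [← integrableOn_Icc_iff_integrableOn_Ioc, ← uIcc_of_le zero_le_one] at h1
  have h2 := intervalIntegral.continuousOn_primitive_interval h1
  rw [uIcc_of_le zero_le_one] at h2
  have h3 := (h2 0 ⟨le_rfl, zero_le_one⟩).tendsto
  rw [intervalIntegral.integral_same] at h3
  refine (h3.mono_left (nhdsWithin_le_iff.2 (Icc_mem_nhdsGT one_pos))).congr' ?_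
  filter_upwards [self_mem_nhdsWithin] with a ha
  exact intervalIntegral.integral_of_le (le_of_lt ha)

/-- The part of the Gaussian mean of the potential kernel near `u = 0` is small, locally uniformly
in `x` and with an explicit dependence on `y`. -/
theorem exists_norm_integral_Ioc_potentialKernel_le {ν : ℂ} (hν : -1 < ν.re) :
    ∃ C : ℝ, 0 ≤ C ∧ ∀ x y ε : ℝ, 0 < x → 0 < y → 0 < ε →
      √y * ‖∫ u in Ioc 0 ε, (Real.exp (-ε * u ^ 2) : ℂ) * potentialKernel ν x y u‖ ≤
        C * besselWeight (ν.re + 1 / 2) y * (x ^ 2)⁻¹ *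
          ∫ u in Ioc 0 ε, (u ^ (ν.re + 1 / 2) + u ^ (2 * ν.re + 1)) := by
  obtain ⟨C, hC, h⟩ := exists_norm_besselKernel_le hν
  refine ⟨C, hC, fun x y ε hx hy hε => ?_⟩
  have hs : 0 < √y := Real.sqrt_pos.2 hy
  rw [← le_div_iff₀' hs, mul_div_right_comm, ← integral_const_mul]
  refine norm_integral_le_of_norm_le
    ((integrableOn_rpow_add_rpow_Ioc hν ε hε).const_mul _) ?_
  filter_upwards [ae_restrict_mem measurableSet_Ioc] with u hu
  have hu0 : 0 < u := hu.1
  have h1 := h y u hy hu0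
  have h2 : (x ^ 2 + u ^ 2)⁻¹ ≤ (x ^ 2)⁻¹ := by
    gcongr
    nlinarith [sq_nonneg u]
  have h3 : Real.exp (-ε * u ^ 2) ≤ 1 := Real.exp_le_one_iff.2 (by nlinarith [sq_nonneg u])
  rw [norm_mul, norm_potentialKernel, Complex.norm_real, Real.norm_of_nonneg (Real.exp_pos _).le]
  calc _ ≤ 1 * (‖besselKernel ν y u‖ * (x ^ 2)⁻¹) := by gcongr
    _ = (√y * ‖besselKernel ν y u‖) * ((x ^ 2)⁻¹ / √y) := by field_simp
    _ ≤ (C * besselWeight (ν.re + 1 / 2) y * (u ^ (ν.re + 1 / 2) + u ^ (2 * ν.re + 1))) *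
        ((x ^ 2)⁻¹ / √y) := by gcongr
    _ = _ := by ring

theorem besselKernel_eq {ν : ℂ} {y u : ℝ} (hy : 0 < y) (hu : 0 < u) :
    besselKernel ν y u = ((y / 2 : ℝ) : ℂ) ^ ν * (u : ℂ) ^ (2 * ν + 1) *
      besselSeries ν ((u * y / 2) ^ 2) := by
  have hu' : (u : ℂ) ≠ 0 := Complex.ofReal_ne_zero.2 hu.ne'
  have h1 : ((u * y / 2 : ℝ) : ℂ) ^ ν = (u : ℂ) ^ ν * ((y / 2 : ℝ) : ℂ) ^ ν := by
    rw [mul_div_assoc, Complex.ofReal_mul, Complex.mul_cpow_ofReal_nonneg hu.le (by positivity)]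
  rw [besselKernel, besselJ_eq, h1, show 2 * ν + 1 = (ν + 1) + ν by ring,
    Complex.cpow_add (ν + 1) ν hu']
  ring

theorem exists_norm_besselKernel_le_near_zero {ν : ℂ} (hν : -1 < ν.re) {y : ℝ} (hy : 0 < y) :
    ∃ C : ℝ, 0 ≤ C ∧ ∀ u : ℝ, 0 < u → u ≤ 1 →
      ‖besselKernel ν y u‖ ≤ C * u ^ (2 * ν.re + 1) := by
  obtain ⟨B, hB⟩ := (isCompact_Icc (a := (0 : ℝ)) (b := (y / 2) ^ 2)).exists_bound_of_continuousOn
    (continuous_besselSeries hν).continuousOn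
  have hB0 : 0 ≤ B := (norm_nonneg _).trans (hB 0 ⟨le_rfl, by positivity⟩)
  refine ⟨(y / 2) ^ ν.re * B, by positivity, fun u hu hu1 => ?_⟩
  have h1 : ‖besselSeries ν ((u * y / 2) ^ 2)‖ ≤ B := by
    refine hB _ ⟨by positivity, ?_⟩
    gcongr
    nlinarith
  rw [besselKernel_eq hy hu, norm_mul, norm_mul, norm_ofReal_cpow hu,
    norm_ofReal_cpow (half_pos hy)]
  have h2 : (2 * ν + 1).re = 2 * ν.re + 1 := by simp
  rw [h2]
  calc _ ≤ (y / 2) ^ ν.re * u ^ (2 * ν.re + 1) * B := by gcongr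
    _ = _ := by ring

/-- Near `u = 0` the kernel is a multiple of `u^(2ν+1)`, with a relative error `O(u²)`. -/
theorem exists_norm_gaussian_besselKernel_sub_le {ν : ℂ} (hν : -1 < ν.re) {y : ℝ} (hy : 0 < y) :
    ∃ C : ℝ, 0 ≤ C ∧ ∀ u ε : ℝ, 0 < u → u ≤ 1 → 0 < ε → ε ≤ 1 →
      ‖(Real.exp (-ε * u ^ 2) : ℂ) * besselKernel ν y u -
        ((y / 2 : ℝ) : ℂ) ^ ν * besselSeries ν 0 * (u : ℂ) ^ (2 * ν + 1)‖ ≤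
          C * u ^ 2 * u ^ (2 * ν.re + 1) := by
  have hν1 : -1 < (ν + 1).re := by simp; linarith
  obtain ⟨B, hB⟩ := (isCompact_Icc (a := (0 : ℝ)) (b := (y / 2) ^ 2)).exists_bound_of_continuousOn
    (continuous_besselSeries hν).continuousOn
  have hB0 : 0 ≤ B := (norm_nonneg _).trans (hB 0 ⟨le_rfl, by positivity⟩)
  obtain ⟨B', hB'⟩ := (isCompact_Icc (a := (0 : ℝ)) (b := (y / 2) ^ 2)).exists_bound_of_continuousOn
    (continuous_besselSeries hν1).continuousOn
  have hB0' : 0 ≤ B' := (norm_nonneg _).trans (hB' 0 ⟨le_rfl, by positivity⟩)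
  refine ⟨(y / 2) ^ ν.re * (B + B' * (y / 2) ^ 2), by positivity, fun u ε hu hu1 hε hε1 => ?_⟩
  have hmem : (u * y / 2) ^ 2 ∈ Icc (0 : ℝ) ((y / 2) ^ 2) := by
    refine ⟨by positivity, ?_⟩
    gcongr
    nlinarith
  have h1 : ‖besselSeries ν ((u * y / 2) ^ 2) - besselSeries ν 0‖ ≤ B' * (u * y / 2) ^ 2 := by
    have := (convex_Icc (0 : ℝ) ((y / 2) ^ 2)).norm_image_sub_le_of_norm_hasDerivWithin_le
      (fun t _ => (hasDerivAt_besselSeries hν t).hasDerivWithinAt)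
      (fun t ht => by rw [norm_neg]; exact hB' t ht) (show (0 : ℝ) ∈ _ from ⟨le_rfl, by positivity⟩)
      hmem
    rwa [sub_zero, Real.norm_of_nonneg (sq_nonneg _)] at this
  have h2 : |Real.exp (-ε * u ^ 2) - 1| ≤ u ^ 2 := by
    have h3 : Real.exp (-ε * u ^ 2) ≤ 1 := Real.exp_le_one_iff.2 (by nlinarith [sq_nonneg u])
    rw [abs_le]
    constructor <;> nlinarith [Real.add_one_le_exp (-ε * u ^ 2), sq_nonneg u]
  have h4 : (Real.exp (-ε * u ^ 2) : ℂ) * besselKernel ν y u -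
        ((y / 2 : ℝ) : ℂ) ^ ν * besselSeries ν 0 * (u : ℂ) ^ (2 * ν + 1) =
      ((y / 2 : ℝ) : ℂ) ^ ν * (u : ℂ) ^ (2 * ν + 1) *
        (((Real.exp (-ε * u ^ 2) - 1 : ℝ) : ℂ) * besselSeries ν ((u * y / 2) ^ 2) +
          (besselSeries ν ((u * y / 2) ^ 2) - besselSeries ν 0)) := by
    rw [besselKernel_eq hy hu]; push_cast; ring
  have h5 : (2 * ν + 1).re = 2 * ν.re + 1 := by simp
  rw [h4, norm_mul, norm_mul, norm_ofReal_cpow hu, norm_ofReal_cpow (half_pos hy), h5]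
  have h6 : ‖((Real.exp (-ε * u ^ 2) - 1 : ℝ) : ℂ) * besselSeries ν ((u * y / 2) ^ 2) +
      (besselSeries ν ((u * y / 2) ^ 2) - besselSeries ν 0)‖ ≤
      u ^ 2 * B + B' * (u * y / 2) ^ 2 := by
    refine (norm_add_le _ _).trans (add_le_add ?_ h1)
    rw [norm_mul, Complex.norm_real, Real.norm_eq_abs]
    gcongr
    exact hB _ hmem
  calc _ ≤ (y / 2) ^ ν.re * u ^ (2 * ν.re + 1) * (u ^ 2 * B + B' * (u * y / 2) ^ 2) := by gcongr
    _ = _ := by ring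

theorem integral_Ioc_rpow_mul_inv_le {μ x : ℝ} (hμ : -1 < μ) (hx : 0 < x) (hx1 : x ≤ 1) :
    IntegrableOn (fun u : ℝ => u ^ (2 * μ + 1) * (x ^ 2 + u ^ 2)⁻¹) (Ioc 0 1) ∧
    ∫ u in Ioc (0 : ℝ) 1, u ^ (2 * μ + 1) * (x ^ 2 + u ^ 2)⁻¹ ≤
      x ^ (2 * μ) / (2 * μ + 2) + ∫ u in x..1, u ^ (2 * μ - 1) := by
  have hi : IntegrableOn (fun u : ℝ => u ^ (2 * μ + 1) * (x ^ 2)⁻¹) (Ioc 0 1) := by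
    rw [← intervalIntegrable_iff_integrableOn_Ioc_of_le zero_le_one]
    exact (intervalIntegral.intervalIntegrable_rpow' (by linarith)).mul_const _
  have hle : ∀ u : ℝ, (x ^ 2 + u ^ 2)⁻¹ ≤ (x ^ 2)⁻¹ := fun u => by
    gcongr
    nlinarith [sq_nonneg u]
  have hi2 : IntegrableOn (fun u : ℝ => u ^ (2 * μ + 1) * (x ^ 2 + u ^ 2)⁻¹) (Ioc 0 1) := by
    refine Integrable.mono' hi (Measurable.aestronglyMeasurable (by fun_prop)) ?_
    filter_upwards [ae_restrict_mem measurableSet_Ioc] with u hu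
    have hu0 := hu.1
    rw [Real.norm_of_nonneg (by positivity)]
    exact mul_le_mul_of_nonneg_left (hle u) (by positivity)
  refine ⟨hi2, ?_⟩
  have hI : ∀ a b : ℝ, 0 ≤ a → b ≤ 1 → a ≤ b → IntervalIntegrable
      (fun u : ℝ => u ^ (2 * μ + 1) * (x ^ 2 + u ^ 2)⁻¹) volume a b := fun a b ha hb hab => by
    rw [intervalIntegrable_iff_integrableOn_Ioc_of_le hab]
    exact hi2.mono_set (Ioc_subset_Ioc ha hb)
  rw [← intervalIntegral.integral_of_le zero_le_one,
    ← intervalIntegral.integral_add_adjacent_intervals (hI 0 x le_rfl hx1 hx.le)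
      (hI x 1 hx.le le_rfl hx1)]
  refine add_le_add ?_ ?_
  · have h1 : ∫ u in (0 : ℝ)..x, u ^ (2 * μ + 1) * (x ^ 2 + u ^ 2)⁻¹ ≤
        ∫ u in (0 : ℝ)..x, u ^ (2 * μ + 1) * (x ^ 2)⁻¹ := by
      refine intervalIntegral.integral_mono_on hx.le (hI 0 x le_rfl hx1 hx.le) ?_ fun u hu => ?_
      · exact (intervalIntegral.intervalIntegrable_rpow' (by linarith)).mul_const _
      · have := Real.rpow_nonneg hu.1 (2 * μ + 1)
        exact mul_le_mul_of_nonneg_left (hle u) this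
    refine h1.trans (le_of_eq ?_)
    rw [intervalIntegral.integral_mul_const, integral_rpow (Or.inl (by linarith)),
      Real.zero_rpow (by linarith), sub_zero, show 2 * μ + 1 + 1 = 2 * μ + 2 by ring,
      Real.rpow_add hx, Real.rpow_two]
    field_simp
  · have hc : ContinuousOn (fun u : ℝ => u ^ (2 * μ - 1)) (uIcc x 1) := by
      rw [uIcc_of_le hx1]
      exact fun u hu => (Real.continuousAt_rpow_const _ _
        (Or.inl (hx.trans_le hu.1).ne')).continuousWithinAt
    refine intervalIntegral.integral_mono_on hx1 (hI x 1 hx.le le_rfl hx1)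
      hc.intervalIntegrable fun u hu => ?_
    have hu0 : 0 < u := hx.trans_le hu.1
    rw [show 2 * μ - 1 = (2 * μ + 1) + (-2) by ring, Real.rpow_add hu0 (2 * μ + 1) (-2),
      Real.rpow_neg hu0.le,
      Real.rpow_two]
    gcongr
    nlinarith [sq_nonneg x]

/-- Estimate by absolute values; the two terms account for `u ≤ x` and `u ≥ x`. -/
theorem exists_norm_integral_Ioc_le_absolute {ν : ℂ} (hν : -1 < ν.re) {y : ℝ} (hy : 0 < y) :
    ∃ C : ℝ, 0 ≤ C ∧ ∀ x ε : ℝ, 0 < x → x ≤ 1 → 0 < ε → ε ≤ 1 →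
      ‖∫ u in Ioc 0 ε, (Real.exp (-ε * u ^ 2) : ℂ) * potentialKernel ν x y u‖ ≤
        C * (x ^ (2 * ν.re) / (2 * ν.re + 2) + ∫ u in x..1, u ^ (2 * ν.re - 1)) := by
  obtain ⟨C, hC, h⟩ := exists_norm_besselKernel_le_near_zero hν hy
  refine ⟨C, hC, fun x ε hx hx1 hε hε1 => ?_⟩
  obtain ⟨h1, h2⟩ := integral_Ioc_rpow_mul_inv_le hν hx hx1
  have h3 : ‖∫ u in Ioc 0 ε, (Real.exp (-ε * u ^ 2) : ℂ) * potentialKernel ν x y u‖ ≤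
      ∫ u in Ioc 0 ε, C * (u ^ (2 * ν.re + 1) * (x ^ 2 + u ^ 2)⁻¹) := by
    refine norm_integral_le_of_norm_le
      ((h1.mono_set (Ioc_subset_Ioc le_rfl hε1)).const_mul _) ?_
    filter_upwards [ae_restrict_mem measurableSet_Ioc] with u hu
    have h4 : Real.exp (-ε * u ^ 2) ≤ 1 := Real.exp_le_one_iff.2 (by nlinarith [sq_nonneg u])
    rw [norm_mul, norm_potentialKernel, Complex.norm_real,
      Real.norm_of_nonneg (Real.exp_pos _).le, ← mul_assoc C]
    calc _ ≤ 1 * (‖besselKernel ν y u‖ * (x ^ 2 + u ^ 2)⁻¹) := by gcongr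
      _ ≤ _ := by
        rw [one_mul]
        gcongr
        exact h u hu.1 (hu.2.trans hε1)
  rw [integral_const_mul] at h3
  refine h3.trans (mul_le_mul_of_nonneg_left (le_trans ?_ h2) hC)
  refine setIntegral_mono_set h1 ?_ (Ioc_subset_Ioc le_rfl hε1).eventuallyLE
  filter_upwards [ae_restrict_mem measurableSet_Ioc] with u hu
  have := hu.1
  simp only [Pi.zero_apply]
  positivity

/-- For `Re ν ≥ 0`, `ν ≠ 0`, the integrals of `u^(2ν+1)/(x² + u²)` near zero are bounded uniformly
in `x`; when `Re ν = 0` this rests on the oscillation of `u^(2ν)`, seen by partial integration. -/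
theorem norm_integral_cpow_mul_inv_le {ν : ℂ} (hν : 0 ≤ ν.re) (hν0 : ν ≠ 0) {x ε : ℝ} (hx : 0 < x)
    (hε : 0 < ε) (hε1 : ε ≤ 1) :
    ‖∫ u in Ioc 0 ε, (u : ℂ) ^ (2 * ν + 1) * ((x ^ 2 + u ^ 2 : ℝ) : ℂ)⁻¹‖ ≤ 1 / ‖ν‖ := by
  have hden : ∀ u : ℝ, ((x ^ 2 + u ^ 2 : ℝ) : ℂ) ≠ 0 := fun u =>
    Complex.ofReal_ne_zero.2 (by positivity)
  have hcinv : Continuous fun u : ℝ => ((x ^ 2 + u ^ 2 : ℝ) : ℂ)⁻¹ :=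
    Continuous.inv₀ (by fun_prop) hden
  have hc1 : Continuous fun u : ℝ => (u : ℂ) ^ (2 * ν + 1) :=
    Complex.continuous_ofReal_cpow_const (by simp; linarith)
  have hc2 : Continuous fun u : ℝ => (u : ℂ) ^ (2 * ν + 2) :=
    Complex.continuous_ofReal_cpow_const (by simp; linarith)
  set g₁ : ℝ → ℂ := fun u => (u : ℂ) ^ (2 * ν + 1) * ((x ^ 2 + u ^ 2 : ℝ) : ℂ)⁻¹ with hg₁
  set g₂ : ℝ → ℂ := fun u => (u : ℂ) ^ (2 * ν + 1) * ((2 * x ^ 2 : ℝ) : ℂ) *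
    (((x ^ 2 + u ^ 2 : ℝ) : ℂ)⁻¹) ^ 2 with hg₂
  have hcg₁ : Continuous g₁ := hc1.mul hcinv
  have hcg₂ : Continuous g₂ := (hc1.mul continuous_const).mul (hcinv.pow 2)
  have hder : ∀ u ∈ Ioo 0 ε, HasDerivAt
      (fun u : ℝ => (u : ℂ) ^ (2 * ν + 2) * ((x ^ 2 + u ^ 2 : ℝ) : ℂ)⁻¹)
      (2 * ν * g₁ u + g₂ u) u := by
    intro u hu
    have hu' : (u : ℂ) ≠ 0 := Complex.ofReal_ne_zero.2 hu.1.ne'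
    have h1 := (Complex.hasStrictDerivAt_cpow_const (x := (u : ℂ)) (c := 2 * ν + 2)
      (Complex.ofReal_mem_slitPlane.2 hu.1)).hasDerivAt.comp_ofReal
    have h2 : HasDerivAt (fun u : ℝ => ((x ^ 2 + u ^ 2 : ℝ) : ℂ)) (2 * u) u := by
      have := ((hasDerivAt_pow 2 u).const_add (x ^ 2)).ofReal_comp
      simpa using this
    refine (h1.mul (h2.fun_inv (hden u))).congr_deriv ?_
    have h3 : (u : ℂ) ^ (2 * ν + 2) = (u : ℂ) ^ (2 * ν + 1) * u := by
      rw [show 2 * ν + 2 = (2 * ν + 1) + 1 by ring, Complex.cpow_add (2 * ν + 1) 1 hu',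
        Complex.cpow_one]
    have h4 : (u : ℂ) ^ (2 * ν + 2 - 1) = (u : ℂ) ^ (2 * ν + 1) := by congr 1; ring
    have h5 := hden u
    rw [h3, h4, hg₁, hg₂]
    field_simp
    push_cast
    ring
  have hftc := intervalIntegral.integral_eq_sub_of_hasDerivAt_of_le hε.le
    (hc2.mul hcinv).continuousOn hder ((hcg₁.const_mul (2 * ν)).add hcg₂ |>.intervalIntegrable 0 ε)
  have hzero : ((0 : ℝ) : ℂ) ^ (2 * ν + 2) = 0 := by
    rw [Complex.ofReal_zero, Complex.zero_cpow]
    intro h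
    have := congrArg Complex.re h
    simp at this
    linarith
  simp only [Pi.mul_apply] at hftc
  rw [hzero, zero_mul, sub_zero, intervalIntegral.integral_add
    ((hcg₁.const_mul (2 * ν)).intervalIntegrable 0 ε) (hcg₂.intervalIntegrable 0 ε),
    intervalIntegral.integral_const_mul] at hftc
  have hre : (2 * ν + 1).re = 2 * ν.re + 1 := by simp
  have hre2 : (2 * ν + 2).re = 2 * ν.re + 2 := by simp
  have hpow : ∀ u : ℝ, 0 < u → u ≤ 1 → u ^ (2 * ν.re) ≤ 1 := fun u hu hu1 =>
    Real.rpow_le_one hu.le hu1 (by linarith)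
  have hb1 : ‖(ε : ℂ) ^ (2 * ν + 2) * ((x ^ 2 + ε ^ 2 : ℝ) : ℂ)⁻¹‖ ≤ 1 := by
    rw [norm_mul, norm_ofReal_cpow hε, hre2, norm_inv, Complex.norm_real,
      Real.norm_of_nonneg (by positivity), mul_inv_le_iff₀ (by positivity), Real.rpow_add hε,
      Real.rpow_two]
    nlinarith [hpow ε hε hε1, sq_nonneg x, sq_nonneg ε]
  have hb2 : ‖∫ u in (0 : ℝ)..ε, g₂ u‖ ≤ 1 := by
    have hd : ∀ u ∈ uIcc 0 ε, HasDerivAt (fun u : ℝ => -(x ^ 2 * (x ^ 2 + u ^ 2)⁻¹))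
        (u * (2 * x ^ 2) * ((x ^ 2 + u ^ 2)⁻¹) ^ 2) u := by
      intro u _
      have h1 : HasDerivAt (fun u : ℝ => x ^ 2 + u ^ 2) (2 * u) u := by
        simpa using (hasDerivAt_pow 2 u).const_add (x ^ 2)
      refine (((h1.fun_inv (by positivity)).const_mul (x ^ 2)).neg).congr_deriv ?_
      field_simp
    have hci : Continuous fun u : ℝ => u * (2 * x ^ 2) * ((x ^ 2 + u ^ 2)⁻¹) ^ 2 := by
      refine (by fun_prop : Continuous fun u : ℝ => u * (2 * x ^ 2)).mul ?_
      exact (Continuous.inv₀ (by fun_prop) fun u => by positivity).pow 2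
    have h2 := intervalIntegral.integral_eq_sub_of_hasDerivAt hd (hci.intervalIntegrable 0 ε)
    have h3 : ‖∫ u in (0 : ℝ)..ε, g₂ u‖ ≤
        ∫ u in (0 : ℝ)..ε, u * (2 * x ^ 2) * ((x ^ 2 + u ^ 2)⁻¹) ^ 2 := by
      refine intervalIntegral.norm_integral_le_of_norm_le hε.le (ae_of_all _ fun u hu => ?_)
        (hci.intervalIntegrable 0 ε)
      rw [hg₂, norm_mul, norm_mul, norm_pow, norm_inv, Complex.norm_real, Complex.norm_real,
        norm_ofReal_cpow hu.1, hre, Real.norm_of_nonneg (by positivity),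
        Real.norm_of_nonneg (by positivity), Real.rpow_add hu.1, Real.rpow_one]
      have := hu.1
      gcongr
      exact mul_le_of_le_one_left hu.1.le (hpow u hu.1 (hu.2.trans hε1))
    refine h3.trans ?_
    rw [h2]
    have h5 : x ^ 2 * (x ^ 2 + 0 ^ 2)⁻¹ = 1 := by field_simp; ring
    have h6 : 0 ≤ x ^ 2 * (x ^ 2 + ε ^ 2)⁻¹ := by positivity
    rw [h5]; linarith
  have hν0' : 0 < ‖ν‖ := norm_pos_iff.2 hν0
  rw [← intervalIntegral.integral_of_le hε.le, le_div_iff₀ hν0']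
  have h7 : ‖2 * ν * ∫ u in (0 : ℝ)..ε, g₁ u‖ ≤ 1 + 1 := by
    rw [eq_sub_of_add_eq hftc]
    exact (norm_sub_le _ _).trans (add_le_add hb1 hb2)
  rw [norm_mul, norm_mul, Complex.norm_two] at h7
  linarith

/-- For `Re ν ≥ 0`, `ν ≠ 0`, the leading term of the kernel contributes a bounded amount by
`norm_integral_cpow_mul_inv_le`, and the remainder cancels the singularity of `1/(x² + u²)`. -/
theorem exists_norm_integral_Ioc_le_oscillating {ν : ℂ} (hν : 0 ≤ ν.re) (hν0 : ν ≠ 0) {y : ℝ}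
    (hy : 0 < y) :
    ∃ C : ℝ, ∀ x ε : ℝ, 0 < x → 0 < ε → ε ≤ 1 →
      ‖∫ u in Ioc 0 ε, (Real.exp (-ε * u ^ 2) : ℂ) * potentialKernel ν x y u‖ ≤ C := by
  have hν' : -1 < ν.re := by linarith
  obtain ⟨C, hC, h⟩ := exists_norm_gaussian_besselKernel_sub_le hν' hy
  set c : ℂ := ((y / 2 : ℝ) : ℂ) ^ ν * besselSeries ν 0 with hc
  refine ⟨C + ‖c‖ * (1 / ‖ν‖), fun x ε hx hε hε1 => ?_⟩
  have hden : ∀ u : ℝ, ((x ^ 2 + u ^ 2 : ℝ) : ℂ) ≠ 0 := fun u =>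
    Complex.ofReal_ne_zero.2 (by positivity)
  have hc1 : Continuous fun u : ℝ => (u : ℂ) ^ (2 * ν + 1) * ((x ^ 2 + u ^ 2 : ℝ) : ℂ)⁻¹ :=
    (Complex.continuous_ofReal_cpow_const (by simp; linarith)).mul
      (Continuous.inv₀ (by fun_prop) hden)
  have hi1 : IntegrableOn (fun u : ℝ => c * ((u : ℂ) ^ (2 * ν + 1) *
      ((x ^ 2 + u ^ 2 : ℝ) : ℂ)⁻¹)) (Ioc 0 ε) :=
    ((hc1.const_mul c).intervalIntegrable 0 ε).1
  have hi2 : IntegrableOn (fun u : ℝ => (Real.exp (-ε * u ^ 2) : ℂ) * potentialKernel ν x y u)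
      (Ioc 0 ε) :=
    (integrableOn_gaussian_potentialKernel hν' hx hy hε).mono_set Ioc_subset_Ioi_self
  have h1 : ‖∫ u in Ioc 0 ε, ((Real.exp (-ε * u ^ 2) : ℂ) * potentialKernel ν x y u -
      c * ((u : ℂ) ^ (2 * ν + 1) * ((x ^ 2 + u ^ 2 : ℝ) : ℂ)⁻¹))‖ ≤ C := by
    have h2 : ∀ u ∈ Ioc 0 ε, ‖(Real.exp (-ε * u ^ 2) : ℂ) * potentialKernel ν x y u -
        c * ((u : ℂ) ^ (2 * ν + 1) * ((x ^ 2 + u ^ 2 : ℝ) : ℂ)⁻¹)‖ ≤ C := by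
      intro u hu
      have hu0 := hu.1
      have h3 := h u ε hu.1 (hu.2.trans hε1) hε hε1
      have h4 : (Real.exp (-ε * u ^ 2) : ℂ) * potentialKernel ν x y u -
          c * ((u : ℂ) ^ (2 * ν + 1) * ((x ^ 2 + u ^ 2 : ℝ) : ℂ)⁻¹) =
          ((Real.exp (-ε * u ^ 2) : ℂ) * besselKernel ν y u - c * (u : ℂ) ^ (2 * ν + 1)) *
            ((x ^ 2 + u ^ 2 : ℝ) : ℂ)⁻¹ := by rw [potentialKernel]; ring
      rw [h4, norm_mul, norm_inv, Complex.norm_real, Real.norm_of_nonneg (by positivity),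
        mul_inv_le_iff₀ (by positivity)]
      refine h3.trans ?_
      have h5 : u ^ (2 * ν.re + 1) ≤ 1 :=
        Real.rpow_le_one hu.1.le (hu.2.trans hε1) (by linarith)
      have h6 : C * u ^ 2 * u ^ (2 * ν.re + 1) ≤ C * u ^ 2 * 1 := by gcongr
      nlinarith [mul_nonneg hC (sq_nonneg x)]
    refine (norm_setIntegral_le_of_norm_le_const (by simp) h2).trans ?_
    simp only [measureReal_def, Real.volume_Ioc, sub_zero, ENNReal.toReal_ofReal hε.le]
    nlinarith
  rw [integral_sub hi2 hi1, integral_const_mul] at h1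
  have h3 := norm_integral_cpow_mul_inv_le hν hν0 hx hε hε1
  have h4 := norm_le_norm_add_norm_sub' (∫ u in Ioc 0 ε, (Real.exp (-ε * u ^ 2) : ℂ) *
    potentialKernel ν x y u) (c * ∫ u in Ioc 0 ε, (u : ℂ) ^ (2 * ν + 1) *
      ((x ^ 2 + u ^ 2 : ℝ) : ℂ)⁻¹)
  rw [norm_mul] at h4
  have h5 := mul_le_mul_of_nonneg_left h3 (norm_nonneg c)
  linarith

/-! ### The incomplete Macdonald function near the origin -/

theorem norm_incompleteBesselK_le_rpow {ν : ℂ} {N : ℝ} (hN0 : 0 < N) (hN : |ν.re| ≤ N) :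
    ∃ C : ℝ, 0 ≤ C ∧ ∀ T z : ℝ, 0 < z → ‖incompleteBesselK ν T z‖ ≤ C * z ^ (-N) := by
  have hG := Real.Gamma_pos_of_pos hN0
  refine ⟨2 ^ N * Real.Gamma N, by positivity, fun T z hz => ?_⟩
  refine (norm_incompleteBesselK_le ν hz).trans ?_
  have h1 := integral_norm_macdonaldDensity_le hN0 hN hz
  rw [Real.div_rpow (by norm_num) hz.le] at h1
  rw [Real.rpow_neg hz.le]
  have h2 : 2 ^ N / z ^ N * Real.Gamma N = 2 ^ N * Real.Gamma N * (z ^ N)⁻¹ := by ring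
  linarith

/-- The leading behaviour of `K_ν` at zero for `Re ν > 0`. -/
theorem tendsto_cpow_mul_besselK {ν : ℂ} (hν : 0 < ν.re) :
    Tendsto (fun z : ℝ => (z : ℂ) ^ ν * besselK ν z) (𝓝[>] 0)
      (𝓝 (1 / 2 * ((2 : ℂ) ^ ν * Complex.Gamma ν))) := by
  have himg := image_mul_exp_univ one_pos
  have hlimit : ∫ σ : ℝ, (Real.exp (-(1 / 2) * Real.exp σ) : ℂ) * Complex.exp (ν * σ) =
      (2 : ℂ) ^ ν * Complex.Gamma ν := by
    have h1 := Complex.integral_cpow_mul_exp_neg_mul_Ioi hν (show (0 : ℝ) < 1 / 2 by norm_num)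
    rw [← himg, integral_image_mul_exp one_pos MeasurableSet.univ, setIntegral_univ] at h1
    rw [show (1 / ((1 / 2 : ℝ) : ℂ)) = 2 by norm_num] at h1
    rw [← h1]
    congr 1
    ext σ
    have h2 : (Real.exp σ : ℂ) ≠ 0 := Complex.ofReal_ne_zero.2 (Real.exp_pos σ).ne'
    rw [one_mul, Complex.real_smul, Complex.cpow_sub _ _ h2, Complex.cpow_one, ofReal_exp_cpow]
    push_cast
    rw [Complex.ofReal_exp] at h2
    field_simp
  -- The substitution `σ = τ + log z` in the integral for `K_{-ν} = K_ν`.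
  have hfun : ∀ z : ℝ, 0 < z → (z : ℂ) ^ ν * besselK ν z = 1 / 2 *
      ∫ σ : ℝ, (Real.exp (-(1 / 2) * Real.exp σ + -(z ^ 2 / 2) * Real.exp (-σ)) : ℂ) *
        Complex.exp (ν * σ) := by
    intro z hz
    rw [← besselK_neg, besselK_eq_integral _ hz, mul_left_comm, ← integral_const_mul,
      ← integral_add_right_eq_self (fun σ : ℝ =>
        (Real.exp (-(1 / 2) * Real.exp σ + -(z ^ 2 / 2) * Real.exp (-σ)) : ℂ) *
          Complex.exp (ν * σ)) (Real.log z)]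
    congr 2
    ext τ
    have h1 : (z : ℂ) ^ ν = Complex.exp (ν * Real.log z) := by
      rw [← ofReal_exp_cpow, Real.exp_log hz]
    have h2 : Real.exp (τ + Real.log z) = Real.exp τ * z := by
      rw [Real.exp_add, Real.exp_log hz]
    have h3 : Real.exp (-(τ + Real.log z)) = Real.exp (-τ) * z⁻¹ := by
      rw [neg_add, Real.exp_add, Real.exp_neg (Real.log z), Real.exp_log hz]
    rw [h1, h2, h3, macdonaldDensity, neg_neg, Real.cosh_eq, mul_left_comm, ← Complex.exp_add]
    congr 2
    · congr 1
      field_simp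
      ring
    · push_cast
      ring
  have hdom := (integrable_exp_neg_exp hν one_pos).1
  have key : Tendsto (fun z : ℝ => 1 / 2 *
      ∫ σ : ℝ, (Real.exp (-(1 / 2) * Real.exp σ + -(z ^ 2 / 2) * Real.exp (-σ)) : ℂ) *
        Complex.exp (ν * σ)) (𝓝[>] 0)
      (𝓝 (1 / 2 * ∫ σ : ℝ, (Real.exp (-(1 / 2) * Real.exp σ) : ℂ) * Complex.exp (ν * σ))) := by
    refine Tendsto.const_mul _ ?_
    refine tendsto_integral_filter_of_dominated_convergence _ ?_ ?_ hdom ?_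
    · exact Eventually.of_forall fun z => Continuous.aestronglyMeasurable (by fun_prop)
    · refine Eventually.of_forall fun z => ae_of_all _ fun σ => ?_
      rw [norm_mul, Complex.norm_real, Real.norm_of_nonneg (Real.exp_pos _).le, Complex.norm_exp,
        ← Real.exp_add]
      refine Real.exp_le_exp.2 ?_
      have : 0 ≤ z ^ 2 / 2 * Real.exp (-σ) := by positivity
      simp
      linarith
    · refine ae_of_all _ fun σ => ?_
      have hcont : Continuous fun z : ℝ =>
          (Real.exp (-(1 / 2) * Real.exp σ + -(z ^ 2 / 2) * Real.exp (-σ)) : ℂ) *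
            Complex.exp (ν * σ) := by fun_prop
      have := (hcont.tendsto 0).mono_left (nhdsWithin_le_nhds (s := Ioi 0))
      simpa using this
  rw [hlimit] at key
  refine key.congr' ?_
  filter_upwards [self_mem_nhdsWithin] with z hz using (hfun z hz).symm

theorem exists_le_norm_besselK_of_re_pos {ν : ℂ} (hν : 0 < ν.re) :
    ∃ c > 0, ∃ δ > 0, ∀ z : ℝ, 0 < z → z < δ → c * z ^ (-ν.re) ≤ ‖besselK ν z‖ := by
  have hne : 1 / 2 * ((2 : ℂ) ^ ν * Complex.Gamma ν) ≠ 0 := by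
    have h1 := Complex.Gamma_ne_zero_of_re_pos hν
    have h2 := norm_pos_iff.1 (norm_two_cpow_pos ν)
    exact mul_ne_zero (by norm_num) (mul_ne_zero h2 h1)
  have h1 := (tendsto_cpow_mul_besselK hν).norm.eventually
    (lt_mem_nhds (half_lt_self (norm_pos_iff.2 hne)))
  obtain ⟨δ, hδ, h2⟩ := mem_nhdsGT_iff_exists_Ioo_subset.1 h1
  refine ⟨_, half_pos (norm_pos_iff.2 hne), δ, hδ, fun z hz hzδ => ?_⟩
  have h3 : _ < ‖(z : ℂ) ^ ν * besselK ν z‖ := h2 ⟨hz, hzδ⟩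
  rw [norm_mul ((z : ℂ) ^ ν), norm_ofReal_cpow hz] at h3
  rw [Real.rpow_neg hz.le, ← div_eq_mul_inv, div_le_iff₀ (by positivity)]
  linarith

theorem exists_le_norm_besselK {ν : ℂ} (hν : ν.re ≠ 0) :
    ∃ c > 0, ∃ δ > 0, ∀ z : ℝ, 0 < z → z < δ → c * z ^ (-|ν.re|) ≤ ‖besselK ν z‖ := by
  rcases lt_or_gt_of_ne hν with h | h
  · have := exists_le_norm_besselK_of_re_pos (ν := -ν) (by simpa using h)
    simp only [besselK_neg, Complex.neg_re] at this
    simpa only [abs_of_neg h] using this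
  · simpa only [abs_of_pos h] using exists_le_norm_besselK_of_re_pos h

theorem norm_besselK_zero {z : ℝ} (hz : 0 < z) :
    ‖besselK 0 z‖ = 1 / 2 * ∫ τ : ℝ, ‖macdonaldDensity 0 z τ‖ := by
  have h1 : ∀ τ, macdonaldDensity 0 z τ = ((‖macdonaldDensity 0 z τ‖ : ℝ) : ℂ) := fun τ => by
    rw [norm_macdonaldDensity]; simp [macdonaldDensity]
  rw [besselK_eq_integral _ hz, norm_mul, integral_congr_ae (ae_of_all _ h1),
    integral_complex_ofReal, Complex.norm_real,
    Real.norm_of_nonneg (integral_nonneg fun _ => norm_nonneg _)]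
  norm_num

theorem norm_incompleteBesselK_zero_le {T z : ℝ} (hz : 0 < z) :
    ‖incompleteBesselK 0 T z‖ ≤ ‖besselK 0 z‖ := by
  rw [norm_besselK_zero hz]
  exact norm_incompleteBesselK_le 0 hz

/-- The logarithmic growth of `K_0` at zero. -/
theorem log_inv_le_norm_besselK_zero {z : ℝ} (hz : 0 < z) (hz1 : z ≤ 1) :
    Real.log z⁻¹ ≤ 2 * Real.exp 1 * ‖besselK 0 z‖ := by
  have hL : 0 ≤ Real.log z⁻¹ := Real.log_nonneg ((one_le_inv₀ hz).2 hz1)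
  have hi := (integrable_macdonaldDensity 0 hz).norm
  have h1 : ∫ τ in Icc 0 (Real.log z⁻¹), Real.exp (-1) ≤ ∫ τ : ℝ, ‖macdonaldDensity 0 z τ‖ := by
    refine le_trans ?_ (setIntegral_le_integral hi (s := Icc 0 (Real.log z⁻¹))
      (ae_of_all _ fun _ => norm_nonneg _))
    refine setIntegral_mono_on (by simp) hi.integrableOn measurableSet_Icc fun τ hτ => ?_
    rw [norm_macdonaldDensity]
    refine Real.exp_le_exp.2 ?_
    have h2 : Real.exp τ ≤ z⁻¹ := by
      rw [← Real.exp_log (inv_pos.2 hz)]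
      exact Real.exp_le_exp.2 hτ.2
    have h3 : Real.cosh τ ≤ Real.exp τ := by
      rw [Real.cosh_eq]
      have : Real.exp (-τ) ≤ Real.exp τ := Real.exp_le_exp.2 (by linarith [hτ.1])
      linarith
    have h4 : z * Real.cosh τ ≤ z * z⁻¹ := by gcongr; exact h3.trans h2
    rw [mul_inv_cancel₀ hz.ne'] at h4
    simp
    linarith
  simp only [setIntegral_const, measureReal_def, Real.volume_Icc, sub_zero,
    ENNReal.toReal_ofReal hL, smul_eq_mul] at h1
  rw [norm_besselK_zero hz]
  rw [Real.exp_neg, ← div_eq_mul_inv, div_le_iff₀ (Real.exp_pos 1)] at h1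
  linarith

theorem integral_Ioi_zero_mul_sinh_mul_exp {z : ℝ} (hz : 0 < z) :
    IntegrableOn (fun τ : ℝ => z * Real.sinh τ * Real.exp (-z * Real.cosh τ)) (Ioi 0) ∧
    ∫ τ in Ioi (0 : ℝ), z * Real.sinh τ * Real.exp (-z * Real.cosh τ) = Real.exp (-z) := by
  have hd : ∀ τ ∈ Ici (0 : ℝ), HasDerivAt (fun τ : ℝ => -Real.exp (-z * Real.cosh τ))
      (z * Real.sinh τ * Real.exp (-z * Real.cosh τ)) τ := fun τ _ => by
    refine (((Real.hasDerivAt_cosh τ).const_mul (-z)).exp.neg).congr_deriv ?_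
    ring
  have hlim : Tendsto (fun τ : ℝ => -Real.exp (-z * Real.cosh τ)) atTop (𝓝 0) := by
    rw [← neg_zero]
    refine (Real.tendsto_exp_atBot.comp ?_).neg
    refine Tendsto.const_mul_atTop_of_neg (by linarith) ?_
    refine tendsto_atTop_mono' _ ?_ tendsto_id
    filter_upwards [eventually_ge_atTop 0] with τ hτ
    exact (Real.self_le_sinh_iff.2 hτ).trans (Real.sinh_lt_cosh τ).le
  have hi := integrableOn_Ioi_deriv_of_nonneg' hd (fun τ hτ => by
    have := Real.sinh_nonneg_iff.2 (le_of_lt hτ)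
    positivity) hlim
  refine ⟨hi, ?_⟩
  rw [integral_Ioi_of_hasDerivAt_of_tendsto' hd hi hlim]
  simp

/-- For imaginary `ν ≠ 0` the incomplete integrals are bounded, because `exp(-ν τ)` oscillates and
`exp(-z cosh τ)` is unimodal. -/
theorem norm_incompleteBesselK_le_of_re_eq_zero {ν : ℂ} (hν : ν.re = 0) (hν0 : ν ≠ 0) {T z : ℝ}
    (hz : 0 < z) : ‖incompleteBesselK ν T z‖ ≤ 3 / ‖ν‖ := by
  set d : ℝ → ℂ := macdonaldDensity ν z with hd
  have hnd : ∀ τ, ‖d τ‖ = Real.exp (-z * Real.cosh τ) := fun τ => by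
    rw [hd, norm_macdonaldDensity, hν]; simp
  have hder : ∀ τ, HasDerivAt d (((-(z * Real.sinh τ) : ℝ) : ℂ) * d τ - ν * d τ) τ := by
    intro τ
    have h1 := (((Real.hasDerivAt_cosh τ).const_mul (-z)).exp).ofReal_comp
    have h2 : HasDerivAt (fun τ : ℝ => Complex.exp (-ν * τ)) (Complex.exp (-ν * τ) * -ν) τ := by
      have := ((hasDerivAt_id (τ : ℂ)).const_mul (-ν)).cexp.comp_ofReal
      simpa using this
    refine (h1.mul h2).congr_deriv ?_
    rw [hd, macdonaldDensity]
    push_cast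
    ring
  set s : ℝ → ℝ := fun τ => z * Real.sinh τ * Real.exp (-z * Real.cosh τ) with hs
  obtain ⟨hi0, hv0⟩ := integral_Ioi_zero_mul_sinh_mul_exp hz
  have hsodd : ∀ τ, |s (-τ)| = |s τ| := fun τ => by simp [hs]
  have hi1 : IntegrableOn (fun τ => |s τ|) (Ioi 0) := hi0.abs
  have hv1 : ∫ τ in Ioi (0 : ℝ), |s τ| ≤ 1 := by
    have : ∫ τ in Ioi (0 : ℝ), |s τ| = ∫ τ in Ioi (0 : ℝ), s τ := by
      refine setIntegral_congr_fun measurableSet_Ioi fun τ hτ => abs_of_nonneg ?_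
      have := Real.sinh_nonneg_iff.2 (le_of_lt (mem_Ioi.1 hτ))
      simp only [hs]; positivity
    rw [this, hv0]
    exact Real.exp_le_one_iff.2 (by linarith)
  have hi2 : IntegrableOn (fun τ => |s τ|) (Iic 0) := by
    have := (integrable_indicator_iff measurableSet_Ioi).2 hi1
    have h2 := this.comp_neg
    rw [integrableOn_Iic_iff_integrableOn_Iio, ← integrable_indicator_iff measurableSet_Iio]
    refine h2.congr (ae_of_all _ fun τ => ?_)
    beta_reduce
    by_cases h : τ < 0
    · rw [indicator_of_mem (mem_Ioi.2 (by linarith)), indicator_of_mem (mem_Iio.2 h), hsodd]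
    · rw [indicator_of_notMem (by simpa using h), indicator_of_notMem (by simpa using h)]
  have hi3 : Integrable (fun τ => |s τ|) := by
    rw [← integrableOn_univ, ← Iic_union_Ioi (a := (0 : ℝ))]
    exact hi2.union hi1
  have hv3 : ∫ τ, |s τ| ≤ 2 := by
    rw [← intervalIntegral.integral_Iic_add_Ioi hi2 hi1]
    have h1 := integral_comp_neg_Iic 0 (fun τ => |s τ|)
    simp only [hsodd, neg_zero] at h1
    linarith
  have hsd : ∀ τ, ‖((-(z * Real.sinh τ) : ℝ) : ℂ) * d τ‖ = |s τ| := fun τ => by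
    rw [norm_mul, hnd, Complex.norm_real, norm_neg, Real.norm_eq_abs, hs, abs_mul _ (Real.exp _),
      abs_of_pos (Real.exp_pos _)]
  have hcd : Continuous d := continuous_macdonaldDensity ν z
  have hi4 : Integrable (fun τ => ((-(z * Real.sinh τ) : ℝ) : ℂ) * d τ) :=
    hi3.mono' (Continuous.aestronglyMeasurable (by fun_prop)) (ae_of_all _ fun τ => (hsd τ).le)
  have hid : Integrable d := integrable_macdonaldDensity ν hz
  have hlim : Tendsto d atTop (𝓝 0) :=
    tendsto_zero_of_hasDerivAt_of_integrableOn_Ioi (a := T) (fun τ _ => hder τ)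
      (hi4.sub (hid.const_mul ν)).integrableOn hid.integrableOn
  have hftc := integral_Ioi_of_hasDerivAt_of_tendsto' (a := T) (fun τ _ => hder τ)
    (hi4.sub (hid.const_mul ν)).integrableOn hlim
  rw [integral_sub hi4.integrableOn (hid.const_mul ν).integrableOn, integral_const_mul] at hftc
  have hb : ‖∫ τ in Ioi T, ((-(z * Real.sinh τ) : ℝ) : ℂ) * d τ‖ ≤ 2 := by
    refine (norm_integral_le_integral_norm _).trans ?_
    simp only [hsd]
    exact (setIntegral_le_integral hi3 (ae_of_all _ fun _ => abs_nonneg _)).trans hv3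
  have hT : ‖d T‖ ≤ 1 := by
    rw [hnd]
    exact Real.exp_le_one_iff.2 (by nlinarith [Real.one_le_cosh T])
  have h5 : ν * ∫ τ in Ioi T, d τ =
      (∫ τ in Ioi T, ((-(z * Real.sinh τ) : ℝ) : ℂ) * d τ) + d T := by
    linear_combination -hftc
  have h6 : ‖ν‖ * ‖∫ τ in Ioi T, d τ‖ ≤ 3 := by
    rw [← norm_mul, h5]
    exact (norm_add_le _ _).trans (by linarith)
  have hν' : 0 < ‖ν‖ := norm_pos_iff.2 hν0
  rw [incompleteBesselK, norm_mul, le_div_iff₀ hν']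
  have h7 : ‖(1 / 2 : ℂ)‖ = 1 / 2 := by norm_num
  rw [h7]
  linarith [mul_nonneg hν'.le (norm_nonneg (∫ τ in Ioi T, d τ))]

/-- Unless `ν` is imaginary and nonzero, `K_ν` itself controls its incomplete integrals near
zero. -/
theorem exists_norm_incompleteBesselK_le_besselK {ν : ℂ} (hν : ν.re ≠ 0 ∨ ν = 0) :
    ∃ C : ℝ, 0 ≤ C ∧ ∃ δ > 0, ∀ T z : ℝ, 0 < z → z < δ →
      ‖incompleteBesselK ν T z‖ ≤ C * ‖besselK ν z‖ := by
  rcases hν with hν | rfl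
  · obtain ⟨c, hc, δ, hδ, h1⟩ := exists_le_norm_besselK hν
    obtain ⟨C, hC, h2⟩ := norm_incompleteBesselK_le_rpow (abs_pos.2 hν) le_rfl
    refine ⟨C / c, by positivity, δ, hδ, fun T z hz hzδ => (h2 T z hz).trans ?_⟩
    rw [div_mul_eq_mul_div, le_div_iff₀ hc]
    nlinarith [h1 z hz hzδ]
  · exact ⟨1, zero_le_one, 1, one_pos, fun T z hz _ => by
      rw [one_mul]; exact norm_incompleteBesselK_zero_le hz⟩

/-! ### Integrability forced by an everywhere convergent Hankel transform -/

open scoped ENNReal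

theorem exists_le_integral_norm_sqrtBesselJ_exp {ν : ℂ} (hν : -1 < ν.re) {t₁ t₂ : ℝ}
    (ht : t₁ < t₂) :
    ∃ c > 0, ∃ X > 0, ∀ x : ℝ, X ≤ x →
      c ≤ ∫ t in t₁..t₂, ‖sqrtBesselJ ν (x * Real.exp t)‖ := by
  obtain ⟨c, hc, C, z₀, hz₀, h⟩ := exists_le_integral_norm_sqrtBesselJ hν
  set α := Real.exp t₁ with hα
  set β := Real.exp t₂ with hβ
  have hα0 : 0 < α := Real.exp_pos _
  have hβ0 : 0 < β := Real.exp_pos _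
  have hαβ : α < β := Real.exp_lt_exp.2 ht
  have hd : 0 < c * (β - α) := mul_pos hc (sub_pos.2 hαβ)
  refine ⟨c * (β - α) / (2 * β), by positivity,
    max (z₀ / α) (2 * |C| / (c * (β - α))), lt_max_of_lt_left (by positivity), fun x hx => ?_⟩
  have hx1 : z₀ ≤ x * α := by
    have := (le_max_left _ _).trans hx
    rwa [div_le_iff₀ hα0] at this
  have hx2 : 2 * |C| ≤ x * (c * (β - α)) := by
    have := (le_max_right _ _).trans hx
    rwa [div_le_iff₀ hd] at this
  have hx0 : 0 < x := (lt_max_of_lt_left (by positivity)).trans_le hx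
  have h1 := h (x * α) (x * β) hx1 (by gcongr)
  have hcont : Continuous fun t : ℝ => ‖sqrtBesselJ ν (x * Real.exp t)‖ :=
    ((continuousOn_sqrtBesselJ hν).comp_continuous (by fun_prop)
      fun t => mem_Ioi.2 (mul_pos hx0 (Real.exp_pos t))).norm
  have h2 : ∫ t in t₁..t₂, ‖sqrtBesselJ ν (x * Real.exp t)‖ * (x * Real.exp t) =
      ∫ z in (x * α)..(x * β), ‖sqrtBesselJ ν z‖ := by
    refine intervalIntegral.integral_comp_mul_deriv' (f := fun t => x * Real.exp t)
      (g := fun z => ‖sqrtBesselJ ν z‖)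
      (fun t _ => (Real.hasDerivAt_exp t).const_mul x) (by fun_prop) ?_
    refine (continuousOn_sqrtBesselJ hν).norm.mono ?_
    rintro _ ⟨t, _, rfl⟩
    exact mem_Ioi.2 (mul_pos hx0 (Real.exp_pos t))
  have h3 : ∫ t in t₁..t₂, ‖sqrtBesselJ ν (x * Real.exp t)‖ * (x * Real.exp t) ≤
      ∫ t in t₁..t₂, ‖sqrtBesselJ ν (x * Real.exp t)‖ * (x * β) := by
    refine intervalIntegral.integral_mono_on ht.le
      ((hcont.mul (by fun_prop)).intervalIntegrable _ _)
      ((hcont.mul (by fun_prop)).intervalIntegrable _ _) fun t ht' => ?_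
    gcongr
    exact Real.exp_le_exp.2 ht'.2
  rw [intervalIntegral.integral_mul_const, h2] at h3
  rw [div_le_iff₀ (by positivity)]
  have h4 : C ≤ |C| := le_abs_self C
  have h5 : c * (x * β - x * α) = x * (c * (β - α)) := by ring
  have h6 : x * (c * (β - α)) ≤
      x * ((∫ t in t₁..t₂, ‖sqrtBesselJ ν (x * Real.exp t)‖) * (2 * β)) := by
    rw [h5] at h1
    nlinarith
  exact le_of_mul_le_mul_left h6 hx0

section Hankel

variable {ν : ℂ} {f : ℝ → ℂ}

theorem hankelIntegrand_eq (ν : ℂ) (f : ℝ → ℂ) (u x : ℝ) :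
    hankelIntegrand ν f u x = sqrtBesselJ ν (x * u) * f x := rfl

theorem integrableOn_Ioc_rpow_mul_of_hankel (hν : -1 < ν.re)
    (hf : AEStronglyMeasurable f (volume.restrict (Ioi (0 : ℝ))))
    (h : ∀ u : ℝ, 0 < u → AbsConverges (hankelIntegrand ν f u)) {X : ℝ} (hX : 0 < X) :
    IntegrableOn (fun x : ℝ => x ^ (ν.re + 1 / 2) * ‖f x‖) (Ioc 0 X) := by
  obtain ⟨c, hc, z₁, hz₁, hlow⟩ := exists_le_norm_sqrtBesselJ hν
  have hu : 0 < z₁ / X := by positivity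
  have hint := ((h _ hu).mono_set (Ioc_subset_Ioi_self : Ioc 0 X ⊆ Ioi 0)).norm.const_mul
    ((c * (z₁ / X) ^ (ν.re + 1 / 2))⁻¹)
  refine hint.mono' ?_ ?_
  · have hf' := hf.mono_set (Ioc_subset_Ioi_self : Ioc 0 X ⊆ Ioi 0)
    exact (Measurable.aestronglyMeasurable (by fun_prop)).mul hf'.norm
  · filter_upwards [ae_restrict_mem measurableSet_Ioc] with x hx
    have hx0 := hx.1
    have h1 := hlow (x * (z₁ / X)) (by positivity) (by
      rw [mul_div_assoc', div_le_iff₀ hX, mul_comm]; gcongr; exact hx.2)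
    rw [Real.mul_rpow hx0.le hu.le] at h1
    rw [Real.norm_of_nonneg (show 0 ≤ x ^ (ν.re + 1 / 2) * ‖f x‖ by positivity),
      hankelIntegrand_eq, norm_mul (sqrtBesselJ ν _), ← div_eq_inv_mul,
      le_div_iff₀ (by positivity)]
    calc _ = c * (x ^ (ν.re + 1 / 2) * (z₁ / X) ^ (ν.re + 1 / 2)) * ‖f x‖ := by ring
      _ ≤ _ := by gcongr

/-- Closedness by Fatou's lemma. -/
theorem isClosed_setOf_lintegral_le (hν : -1 < ν.re)
    (hf : AEStronglyMeasurable f (volume.restrict (Ioi (0 : ℝ)))) (M : ℝ≥0∞) :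
    IsClosed {t : ℝ | ∫⁻ x in Ioi (0 : ℝ), ‖sqrtBesselJ ν (x * Real.exp t) * f x‖ₑ ≤ M} := by
  refine IsSeqClosed.isClosed fun t a ht hta => ?_
  have hmeas : ∀ t : ℝ, AEStronglyMeasurable (fun x => sqrtBesselJ ν (x * Real.exp t) * f x)
      (volume.restrict (Ioi (0 : ℝ))) := fun t => by
    refine AEStronglyMeasurable.mul (ContinuousOn.aestronglyMeasurable ?_ measurableSet_Ioi) hf
    exact (continuousOn_sqrtBesselJ hν).comp (by fun_prop)
      fun x hx => mem_Ioi.2 (mul_pos hx (Real.exp_pos t))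
  have h1 : ∫⁻ x in Ioi (0 : ℝ), ‖sqrtBesselJ ν (x * Real.exp a) * f x‖ₑ =
      ∫⁻ x in Ioi (0 : ℝ), liminf
        (fun n => ‖sqrtBesselJ ν (x * Real.exp (t n)) * f x‖ₑ) atTop := by
    refine setLIntegral_congr_fun measurableSet_Ioi fun x hx => ?_
    refine (Tendsto.liminf_eq ?_).symm
    have hc : ContinuousAt (sqrtBesselJ ν) (x * Real.exp a) :=
      (continuousOn_sqrtBesselJ hν).continuousAt
        (Ioi_mem_nhds (mul_pos hx (Real.exp_pos a)))
    have h2 : Tendsto (fun n => x * Real.exp (t n)) atTop (𝓝 (x * Real.exp a)) :=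
      ((Real.continuous_exp.tendsto a).comp hta).const_mul x
    exact ((hc.tendsto.comp h2).mul_const (f x)).enorm
  rw [mem_ofPred_eq, h1]
  refine (lintegral_liminf_le' fun n => (hmeas (t n)).enorm).trans ?_
  exact (liminf_le_liminf (Eventually.of_forall ht)).trans (by simp)

/-- Absolute convergence of the Hankel transform at every point forces integrability at infinity.
By Baire's theorem its absolute values are bounded for `u` in some interval, and averaging over
this interval replaces the oscillating kernel by a constant. -/
theorem exists_integrableOn_Ioi_of_hankel (hν : -1 < ν.re)
    (hf : AEStronglyMeasurable f (volume.restrict (Ioi (0 : ℝ))))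
    (h : ∀ u : ℝ, 0 < u → AbsConverges (hankelIntegrand ν f u)) :
    ∃ X > 0, IntegrableOn f (Ioi X) := by
  set Φ : ℝ → ℝ≥0∞ := fun t =>
    ∫⁻ x in Ioi (0 : ℝ), ‖sqrtBesselJ ν (x * Real.exp t) * f x‖ₑ with hΦ
  have hfin : ∀ t, Φ t < ∞ := fun t => (h (Real.exp t) (Real.exp_pos t)).2
  have hU : ⋃ n : ℕ, {t : ℝ | Φ t ≤ n} = univ := by
    refine eq_univ_of_forall fun t => mem_iUnion.2 ?_
    obtain ⟨n, hn⟩ := ENNReal.exists_nat_gt (hfin t).ne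
    exact ⟨n, hn.le⟩
  obtain ⟨n, t₀, ht₀⟩ := nonempty_interior_of_iUnion_of_closed
    (fun n : ℕ => isClosed_setOf_lintegral_le hν hf n) hU
  obtain ⟨r, hr, hball⟩ := Metric.mem_nhds_iff.1 (mem_interior_iff_mem_nhds.1 ht₀)
  have ht : t₀ - r / 2 < t₀ + r / 2 := by linarith
  set t₁ := t₀ - r / 2 with ht₁
  set t₂ := t₀ + r / 2 with ht₂
  have hb : ∀ t ∈ Ioc t₁ t₂, Φ t ≤ n := fun t ht => hball (by
    rw [Metric.mem_ball, Real.dist_eq, abs_lt]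
    constructor <;> linarith [ht.1, ht.2])
  obtain ⟨c, hc, X, hX, hlow⟩ := exists_le_integral_norm_sqrtBesselJ_exp hν ht
  refine ⟨X, hX, hf.mono_set (Ioi_subset_Ioi hX.le), ?_⟩
  have hmeas : AEMeasurable (Function.uncurry fun t x : ℝ =>
      ‖sqrtBesselJ ν (x * Real.exp t) * f x‖ₑ)
      ((volume.restrict (Ioc t₁ t₂)).prod (volume.restrict (Ioi (0 : ℝ)))) := by
    refine AEStronglyMeasurable.enorm (AEStronglyMeasurable.mul ?_ hf.comp_snd)
    rw [Measure.prod_restrict]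
    refine ContinuousOn.aestronglyMeasurable ?_ (measurableSet_Ioc.prod measurableSet_Ioi)
    exact (continuousOn_sqrtBesselJ hν).comp (f := fun p : ℝ × ℝ => p.2 * Real.exp p.1)
      (by fun_prop) fun p hp => mem_Ioi.2 (mul_pos hp.2 (Real.exp_pos _))
  have hswap := lintegral_lintegral_swap hmeas
  have hup : ∫⁻ t in Ioc t₁ t₂, Φ t < ∞ := by
    refine (setLIntegral_mono measurable_const hb).trans_lt ?_
    rw [setLIntegral_const, Real.volume_Ioc]
    exact ENNReal.mul_lt_top (ENNReal.natCast_lt_top n) ENNReal.ofReal_lt_top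
  have hin : ∀ x ∈ Ioi X, ENNReal.ofReal c * ‖f x‖ₑ ≤
      ∫⁻ t in Ioc t₁ t₂, ‖sqrtBesselJ ν (x * Real.exp t) * f x‖ₑ := by
    intro x hx
    have hx : X < x := hx
    have hx0 : 0 < x := hX.trans hx
    have hcont : Continuous fun t : ℝ => sqrtBesselJ ν (x * Real.exp t) :=
      (continuousOn_sqrtBesselJ hν).comp_continuous (by fun_prop)
        fun t => mem_Ioi.2 (mul_pos hx0 (Real.exp_pos t))
    simp only [enorm_mul]
    rw [lintegral_mul_const _ hcont.enorm.measurable]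
    gcongr
    have h1 := hlow x hx.le
    rw [intervalIntegral.integral_of_le ht.le] at h1
    refine (ENNReal.ofReal_le_ofReal h1).trans (le_of_eq ?_)
    rw [ofReal_integral_eq_lintegral_ofReal (hcont.norm.intervalIntegrable t₁ t₂).1
      (ae_of_all _ fun _ => norm_nonneg _)]
    simp only [ofReal_norm]
  have h2 : ENNReal.ofReal c * ∫⁻ x in Ioi X, ‖f x‖ₑ < ∞ := by
    rw [← lintegral_const_mul'' _ (hf.mono_set (Ioi_subset_Ioi hX.le)).enorm]
    refine lt_of_le_of_lt ?_ hup
    simp only [hΦ]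
    rw [hswap]
    refine le_trans (setLIntegral_mono' measurableSet_Ioi hin) ?_
    exact lintegral_mono_set (Ioi_subset_Ioi hX.le)
  exact ENNReal.lt_top_of_mul_ne_top_right h2.ne (ENNReal.ofReal_pos.2 hc).ne'

/-- If the Hankel transform of `f` converges absolutely everywhere, then `f` is integrable against
the majorant of `√z J_ν(z)`. -/
theorem integrableOn_besselWeight_mul_of_hankel (hν : -1 < ν.re)
    (hf : AEStronglyMeasurable f (volume.restrict (Ioi (0 : ℝ))))
    (h : ∀ u : ℝ, 0 < u → AbsConverges (hankelIntegrand ν f u)) :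
    IntegrableOn (fun x : ℝ => besselWeight (ν.re + 1 / 2) x * ‖f x‖) (Ioi 0) := by
  obtain ⟨X, hX, hfX⟩ := exists_integrableOn_Ioi_of_hankel hν hf h
  set Y := max X 1
  have hY : 1 ≤ Y := le_max_right _ _
  have hmeas : AEStronglyMeasurable (fun x : ℝ => besselWeight (ν.re + 1 / 2) x * ‖f x‖)
      (volume.restrict (Ioi 0)) :=
    (measurable_besselWeight _).aestronglyMeasurable.mul hf.norm
  -- On `(1, Y]` the weights `1` and `x^(Re ν + 1/2)` are comparable.
  rw [← Ioc_union_Ioi_eq_Ioi (zero_le_one.trans hY)]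
  have hmeasc := hmeas.mono_set (Ioc_subset_Ioi_self : Ioc 0 Y ⊆ Ioi 0)
  refine IntegrableOn.union ?_ ?_
  · have h1 := integrableOn_Ioc_rpow_mul_of_hankel hν hf h (zero_lt_one.trans_le hY)
    have hcpt : ∃ B : ℝ, ∀ x ∈ Icc 1 Y, ‖x ^ (-(ν.re + 1 / 2))‖ ≤ B := by
      refine isCompact_Icc.exists_bound_of_continuousOn fun x hx => ?_
      exact (Real.continuousAt_rpow_const _ _
        (Or.inl (zero_lt_one.trans_le hx.1).ne')).continuousWithinAt
    obtain ⟨B, hB⟩ := hcpt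
    refine Integrable.mono' (h1.const_mul (1 + |B|)) hmeasc ?_
    filter_upwards [ae_restrict_mem measurableSet_Ioc] with x hx
    have hx0 := hx.1
    rw [Real.norm_of_nonneg (mul_nonneg (besselWeight_pos _ hx0).le (norm_nonneg _)), ← mul_assoc]
    gcongr
    unfold besselWeight
    have hp : 0 < x ^ (ν.re + 1 / 2) := by positivity
    split_ifs with h2
    · nlinarith [abs_nonneg B]
    · have h3 := (hB x ⟨(not_le.1 h2).le, hx.2⟩).trans (le_abs_self B)
      rw [Real.norm_of_nonneg (by positivity), Real.rpow_neg hx0.le, inv_le_iff_one_le_mul₀ hp] at h3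
      linarith
  · refine (hfX.mono_set (Ioi_subset_Ioi (le_max_left _ _))).norm.congr ?_
    filter_upwards [ae_restrict_mem measurableSet_Ioi] with x hx
    have : ¬ x ≤ 1 := not_le.2 (hY.trans_lt hx)
    simp [besselWeight, this]

end Hankel

/-! ### Passage to the limit in the Gaussian means -/

/-- Exchange of an absolutely convergent integral with an improper one. The Gaussian means of
`u ↦ ∫ φ(x) k(x,u) dx` may be computed by Fubini's theorem; they tend to the improper integral on
one side, and by dominated convergence to `∫ φ K` on the other. -/
theorem eq_integral_of_gaussian_means {φ g K : ℝ → ℂ} {k : ℝ → ℝ → ℂ} {D : ℝ → ℝ} {c : ℂ}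
    (hg : ∀ u, 0 < u → g u = ∫ x in Ioi (0 : ℝ), φ x * k x u)
    (hloc : LocallyIntegrableOn g (Ioi (0 : ℝ)))
    (hc : Tendsto (fun p : ℝ × ℝ => ∫ u in p.1..p.2, g u) (𝓝[>] (0 : ℝ) ×ˢ atTop) (𝓝 c))
    (hprod : ∀ ε : ℝ, 0 < ε → Integrable
      (Function.uncurry fun x u : ℝ => φ x * ((Real.exp (-ε * u ^ 2) : ℂ) * k x u))
      ((volume.restrict (Ioi (0 : ℝ))).prod (volume.restrict (Ioi ε))))
    (hD : IntegrableOn D (Ioi 0))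
    (hbound : ∀ ε x : ℝ, 0 < ε → ε ≤ 1 → 0 < x →
      ‖φ x * ∫ u in Ioi ε, (Real.exp (-ε * u ^ 2) : ℂ) * k x u‖ ≤ D x)
    (hlim : ∀ x : ℝ, 0 < x → Tendsto
      (fun ε : ℝ => ∫ u in Ioi ε, (Real.exp (-ε * u ^ 2) : ℂ) * k x u) (𝓝[>] 0) (𝓝 (K x))) :
    c = ∫ x in Ioi (0 : ℝ), φ x * K x := by
  have hgε : ∀ ε : ℝ, 0 < ε → ∀ u ∈ Ioi ε, (Real.exp (-ε * u ^ 2) : ℂ) * g u =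
      ∫ x in Ioi (0 : ℝ), φ x * ((Real.exp (-ε * u ^ 2) : ℂ) * k x u) := by
    intro ε hε u hu
    rw [hg u (hε.trans hu), ← integral_const_mul]
    congr 1
    ext x
    ring
  have h1 := tendsto_integral_gaussian hloc hc (by
    filter_upwards [self_mem_nhdsWithin] with ε hε
    refine (hprod ε hε).integral_prod_right.congr ?_
    filter_upwards [ae_restrict_mem measurableSet_Ioi] with u hu
    exact (hgε ε hε u hu).symm)
  have h2 : Tendsto (fun ε : ℝ => ∫ x in Ioi (0 : ℝ),
      φ x * ∫ u in Ioi ε, (Real.exp (-ε * u ^ 2) : ℂ) * k x u) (𝓝[>] 0)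
      (𝓝 (∫ x in Ioi (0 : ℝ), φ x * K x)) := by
    refine tendsto_integral_filter_of_dominated_convergence D ?_ ?_ hD ?_
    · filter_upwards [self_mem_nhdsWithin] with ε hε
      have := (hprod ε hε).integral_prod_left.aestronglyMeasurable
      simpa only [Function.uncurry, integral_const_mul] using this
    · filter_upwards [Ioc_mem_nhdsGT one_pos] with ε hε
      filter_upwards [ae_restrict_mem measurableSet_Ioi] with x hx
      exact hbound ε x hε.1 hε.2 hx
    · filter_upwards [ae_restrict_mem measurableSet_Ioi] with x hx
      exact (hlim x hx).const_mul _
  refine tendsto_nhds_unique h1 (h2.congr' ?_)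
  filter_upwards [self_mem_nhdsWithin] with ε hε
  rw [setIntegral_congr_fun measurableSet_Ioi (hgε ε hε), ← integral_integral_swap (hprod ε hε)]
  simp only [integral_const_mul]

theorem integral_Ioi_gaussian_potentialKernel_eq {ν : ℂ} (hν : -1 < ν.re) {x y ε : ℝ}
    (hx : 0 < x) (hy : 0 < y) (hε : 0 < ε) :
    ∫ u in Ioi ε, (Real.exp (-ε * u ^ 2) : ℂ) * potentialKernel ν x y u =
      (∫ u in Ioi (0 : ℝ), (Real.exp (-ε * u ^ 2) : ℂ) * potentialKernel ν x y u) -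
        ∫ u in Ioc 0 ε, (Real.exp (-ε * u ^ 2) : ℂ) * potentialKernel ν x y u := by
  have hi := integrableOn_gaussian_potentialKernel hν hx hy hε
  rw [← Ioc_union_Ioi_eq_Ioi hε.le, setIntegral_union (Ioc_disjoint_Ioi le_rfl) measurableSet_Ioi
    (hi.mono_set Ioc_subset_Ioi_self) (hi.mono_set (Ioi_subset_Ioi hε.le))]
  ring

theorem tendsto_integral_Ioi_gaussian_potentialKernel {ν : ℂ} (hν : -1 < ν.re) {x y : ℝ}
    (hx : 0 < x) (hy : 0 < y) :
    Tendsto (fun ε : ℝ => ∫ u in Ioi ε, (Real.exp (-ε * u ^ 2) : ℂ) * potentialKernel ν x y u)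
      (𝓝[>] 0) (𝓝 ((x : ℂ) ^ ν * besselK ν (x * y))) := by
  obtain ⟨C, hC, h⟩ := exists_norm_integral_Ioc_potentialKernel_le hν
  have hs : 0 < √y := Real.sqrt_pos.2 hy
  have hR : Tendsto (fun ε : ℝ => ∫ u in Ioc 0 ε,
      (Real.exp (-ε * u ^ 2) : ℂ) * potentialKernel ν x y u) (𝓝[>] 0) (𝓝 0) := by
    refine squeeze_zero_norm' (a := fun ε => C * besselWeight (ν.re + 1 / 2) y * (x ^ 2)⁻¹ / √y *
      ∫ u in Ioc 0 ε, (u ^ (ν.re + 1 / 2) + u ^ (2 * ν.re + 1))) ?_ ?_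
    · filter_upwards [self_mem_nhdsWithin] with ε hε
      have := h x y ε hx hy hε
      rw [div_mul_eq_mul_div, le_div_iff₀ hs]
      linarith
    · simpa using (tendsto_integral_Ioc_rpow_add_rpow hν).const_mul
        (C * besselWeight (ν.re + 1 / 2) y * (x ^ 2)⁻¹ / √y)
  have h2 := (tendsto_integral_gaussian_potentialKernel hν hx hy).sub hR
  rw [sub_zero] at h2
  refine h2.congr' ?_
  filter_upwards [self_mem_nhdsWithin] with ε hε
  exact (integral_Ioi_gaussian_potentialKernel_eq hν hx hy hε).symm

theorem norm_integral_gaussian_potentialKernel_eq {ν : ℂ} (hν : -1 < ν.re) {x y ε : ℝ}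
    (hx : 0 < x) (hy : 0 < y) (hε : 0 < ε) :
    ‖∫ u in Ioi (0 : ℝ), (Real.exp (-ε * u ^ 2) : ℂ) * potentialKernel ν x y u‖ =
      Real.exp (ε * x ^ 2) * (x ^ ν.re *
        ‖incompleteBesselK ν (Real.log (ε / (y / (2 * x)))) (x * y)‖) := by
  rw [integral_gaussian_potentialKernel_eq_incomplete hν hx hy hε, norm_mul, norm_mul,
    norm_ofReal_cpow hx, Complex.norm_real, Real.norm_of_nonneg (Real.exp_pos _).le]

/-- The full Gaussian means near `x = 0`: oscillation (imaginary `ν`) or the size of `K_ν`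
controls them. -/
theorem exists_norm_integral_gaussian_le_near_zero {ν : ℂ} (hν : -1 < ν.re) {y : ℝ} (hy : 0 < y) :
    ∃ C : ℝ, 0 ≤ C ∧ ∃ δ > 0, ∀ x ε : ℝ, 0 < x → x < δ → x ≤ 1 → 0 < ε → ε ≤ 1 →
      ‖∫ u in Ioi (0 : ℝ), (Real.exp (-ε * u ^ 2) : ℂ) * potentialKernel ν x y u‖ ≤
        C * (x ^ ν.re * ‖besselK ν (x * y)‖ + 1) := by
  have hexp : ∀ x ε : ℝ, 0 < x → x ≤ 1 → 0 < ε → ε ≤ 1 → ε * x ^ 2 ≤ 1 := by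
    intro x ε hx hx1 hε hε1
    have : x ^ 2 ≤ 1 := by nlinarith
    nlinarith [sq_nonneg x]
  by_cases hcase : ν.re ≠ 0 ∨ ν = 0
  · obtain ⟨C, hC, δ, hδ, h⟩ := exists_norm_incompleteBesselK_le_besselK hcase
    refine ⟨Real.exp 1 * C, by positivity, δ / y, by positivity, fun x ε hx hxδ hx1 hε hε1 => ?_⟩
    rw [norm_integral_gaussian_potentialKernel_eq hν hx hy hε]
    rw [lt_div_iff₀ hy] at hxδ
    calc _ ≤ Real.exp 1 * (x ^ ν.re * (C * ‖besselK ν (x * y)‖)) := by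
          gcongr
          · exact hexp x ε hx hx1 hε hε1
          · exact h _ _ (by positivity) hxδ
      _ = Real.exp 1 * C * (x ^ ν.re * ‖besselK ν (x * y)‖) := by ring
      _ ≤ _ := by gcongr; linarith
  · push Not at hcase
    refine ⟨Real.exp 1 * (3 / ‖ν‖), by positivity, 1, one_pos, fun x ε hx _ hx1 hε hε1 => ?_⟩
    rw [norm_integral_gaussian_potentialKernel_eq hν hx hy hε]
    have h1 := norm_incompleteBesselK_le_of_re_eq_zero hcase.1 hcase.2
      (T := Real.log (ε / (y / (2 * x)))) (mul_pos hx hy)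
    have h2 : x ^ ν.re = 1 := by rw [hcase.1, Real.rpow_zero]
    rw [h2, one_mul, one_mul]
    calc _ ≤ Real.exp 1 * (3 / ‖ν‖) := by
          gcongr
          exact hexp x ε hx hx1 hε hε1
      _ ≤ _ := le_mul_of_one_le_right (by positivity) (by linarith [norm_nonneg (besselK ν (x * y))])

/-- The part `∫_0^ε` of the Gaussian means near `x = 0`: absolute values suffice for `Re ν < 0` and
for `ν = 0`, where `|K_0(z)|` makes up for the logarithm; otherwise the part is bounded. -/
theorem exists_norm_integral_Ioc_le_near_zero {ν : ℂ} (hν : -1 < ν.re) {y : ℝ} (hy : 0 < y) :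
    ∃ C : ℝ, 0 ≤ C ∧ ∃ δ > 0, ∀ x ε : ℝ, 0 < x → x < δ → x ≤ 1 → 0 < ε → ε ≤ 1 →
      ‖∫ u in Ioc 0 ε, (Real.exp (-ε * u ^ 2) : ℂ) * potentialKernel ν x y u‖ ≤
        C * (x ^ ν.re * ‖besselK ν (x * y)‖ + 1) := by
  by_cases hν0 : ν = 0
  · subst hν0
    obtain ⟨C, hC, h⟩ := exists_norm_integral_Ioc_le_absolute hν hy
    refine ⟨C * (1 + |Real.log y| + 2 * Real.exp 1), by positivity, 1 / y, by positivity,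
      fun x ε hx hxδ hx1 hε hε1 => (h x ε hx hx1 hε hε1).trans ?_⟩
    rw [lt_div_iff₀ hy] at hxδ
    have h1 := log_inv_le_norm_besselK_zero (mul_pos hx hy) hxδ.le
    rw [Real.log_inv, Real.log_mul hx.ne' hy.ne'] at h1
    have h2 : ∫ u in x..1, u ^ (2 * (0 : ℂ).re - 1) = -Real.log x := by
      simp only [Complex.zero_re, mul_zero, zero_sub, Real.rpow_neg_one]
      rw [integral_inv_of_pos hx one_pos, one_div, Real.log_inv]
    have h3 := le_abs_self (Real.log y)
    have h4 := norm_nonneg (besselK 0 (x * y))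
    have h5 := Real.exp_pos 1
    rw [h2, mul_assoc]
    refine mul_le_mul_of_nonneg_left ?_ hC
    simp only [Complex.zero_re, mul_zero, Real.rpow_zero, one_mul, zero_add]
    nlinarith [mul_nonneg (abs_nonneg (Real.log y)) h4]
  rcases lt_or_ge ν.re 0 with hneg | hpos
  · obtain ⟨C, hC, h⟩ := exists_norm_integral_Ioc_le_absolute hν hy
    obtain ⟨c, hc, δ, hδ, hlow⟩ := exists_le_norm_besselK hneg.ne
    have hA : 0 < 1 / (2 * ν.re + 2) + 1 / (-(2 * ν.re)) := by
      have : 0 < 2 * ν.re + 2 := by linarith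
      have : 0 < -(2 * ν.re) := by linarith
      positivity
    refine ⟨C * ((1 / (2 * ν.re + 2) + 1 / (-(2 * ν.re))) * (1 / (c * y ^ ν.re))), by positivity,
      δ / y, by positivity, fun x ε hx hxδ hx1 hε hε1 => (h x ε hx hx1 hε hε1).trans ?_⟩
    rw [lt_div_iff₀ hy] at hxδ
    have h1 := hlow (x * y) (by positivity) hxδ
    rw [abs_of_neg hneg, neg_neg, Real.mul_rpow hx.le hy.le] at h1
    have hx2 : x ^ (2 * ν.re) = x ^ ν.re * x ^ ν.re := by
      rw [← Real.rpow_add hx]; ring_nf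
    have h2 : ∫ u in x..1, u ^ (2 * ν.re - 1) ≤ x ^ (2 * ν.re) * (1 / (-(2 * ν.re))) := by
      rw [integral_rpow (Or.inr ⟨by linarith, by
        rw [uIcc_of_le hx1]; intro h0; linarith [h0.1]⟩), sub_add_cancel, Real.one_rpow,
        mul_one_div, div_neg, ← neg_div]
      rw [div_le_div_right_of_neg (by linarith)]
      linarith
    have h3 : x ^ (2 * ν.re) ≤ 1 / (c * y ^ ν.re) * (x ^ ν.re * ‖besselK ν (x * y)‖) := by
      rw [one_div, ← div_eq_inv_mul, le_div_iff₀ (by positivity), hx2]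
      have hxp : 0 < x ^ ν.re := by positivity
      calc _ = x ^ ν.re * (c * (x ^ ν.re * y ^ ν.re)) := by ring
        _ ≤ _ := by gcongr
    have h4 : 0 < 1 / (c * y ^ ν.re) := by positivity
    rw [mul_assoc]
    refine mul_le_mul_of_nonneg_left ?_ hC
    calc _ ≤ x ^ (2 * ν.re) / (2 * ν.re + 2) + x ^ (2 * ν.re) * (1 / (-(2 * ν.re))) := by gcongr
      _ = (1 / (2 * ν.re + 2) + 1 / (-(2 * ν.re))) * x ^ (2 * ν.re) := by ring
      _ ≤ (1 / (2 * ν.re + 2) + 1 / (-(2 * ν.re))) *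
          (1 / (c * y ^ ν.re) * (x ^ ν.re * ‖besselK ν (x * y)‖)) := by gcongr
      _ ≤ _ := by
        rw [mul_assoc]
        gcongr
        linarith
  · obtain ⟨C, h⟩ := exists_norm_integral_Ioc_le_oscillating hpos hν0 hy
    refine ⟨|C|, abs_nonneg C, 1, one_pos, fun x ε hx _ hx1 hε hε1 => ?_⟩
    refine ((h x ε hx hε hε1).trans (le_abs_self C)).trans
      (le_mul_of_one_le_right (abs_nonneg C) ?_)
    have : 0 ≤ x ^ ν.re * ‖besselK ν (x * y)‖ := by positivity
    linarith

/-- Domination of the truncated Gaussian means, uniformly in `ε`, when `y` is fixed and `x` is the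
variable of integration. -/
theorem exists_norm_integral_Ioi_gaussian_le {ν : ℂ} (hν : -1 < ν.re) {y : ℝ} (hy : 0 < y) :
    ∃ C : ℝ, 0 ≤ C ∧ ∀ x ε : ℝ, 0 < x → 0 < ε → ε ≤ 1 →
      ‖∫ u in Ioi ε, (Real.exp (-ε * u ^ 2) : ℂ) * potentialKernel ν x y u‖ ≤
        C * (x ^ ν.re * ‖besselK ν (x * y)‖ + (x ^ 2 + 1)⁻¹) := by
  obtain ⟨C₁, hC₁, δ₁, hδ₁, h₁⟩ := exists_norm_integral_gaussian_le_near_zero hν hy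
  obtain ⟨C₂, hC₂, δ₂, hδ₂, h₂⟩ := exists_norm_integral_Ioc_le_near_zero hν hy
  obtain ⟨C₃, hC₃, h₃⟩ := exists_norm_integral_gaussian_potentialKernel_le hν hy
  obtain ⟨C₄, hC₄, h₄⟩ := exists_norm_integral_Ioc_potentialKernel_le hν
  set δ := min (min δ₁ δ₂) 1
  have hδ : 0 < δ := by positivity
  have hs : 0 < √y := Real.sqrt_pos.2 hy
  set I := ∫ u in Ioc (0 : ℝ) 1, (u ^ (ν.re + 1 / 2) + u ^ (2 * ν.re + 1))
  have hI : 0 ≤ I := integral_Ioc_rpow_add_rpow_nonneg _ _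
  set B := C₃ + C₄ * besselWeight (ν.re + 1 / 2) y * I / √y
  have hB : 0 ≤ B := by
    have := besselWeight_pos (ν.re + 1 / 2) hy
    positivity
  refine ⟨2 * (C₁ + C₂) + B * (1 + (δ ^ 2)⁻¹), by positivity, fun x ε hx hε hε1 => ?_⟩
  rw [integral_Ioi_gaussian_potentialKernel_eq hν hx hy hε]
  refine (norm_sub_le _ _).trans ?_
  have hK : 0 ≤ x ^ ν.re * ‖besselK ν (x * y)‖ := by positivity
  have hx1 : 0 < (x ^ 2 + 1)⁻¹ := by positivity
  rcases lt_or_ge x δ with hxδ | hxδ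
  · have hx1' : x ≤ 1 := hxδ.le.trans (min_le_right _ _)
    have hle := min_le_left (min δ₁ δ₂) 1
    have ha := h₁ x ε hx (hxδ.trans_le (hle.trans (min_le_left _ _))) hx1' hε hε1
    have hb := h₂ x ε hx (hxδ.trans_le (hle.trans (min_le_right _ _))) hx1' hε hε1
    have hc : 1 ≤ 2 * (x ^ 2 + 1)⁻¹ := by
      rw [← div_eq_mul_inv, le_div_iff₀ (by positivity)]
      nlinarith
    have hd : (C₁ + C₂) * (x ^ ν.re * ‖besselK ν (x * y)‖ + 1) ≤
        (C₁ + C₂) * (2 * (x ^ ν.re * ‖besselK ν (x * y)‖ + (x ^ 2 + 1)⁻¹)) := by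
      gcongr
      linarith
    have he : 0 ≤ B * (1 + (δ ^ 2)⁻¹) *
        (x ^ ν.re * ‖besselK ν (x * y)‖ + (x ^ 2 + 1)⁻¹) := by positivity
    linarith
  · have ha := h₃ x ε hx hε
    have hb := h₄ x y ε hx hy hε
    have hmono : ∫ u in Ioc (0 : ℝ) ε, (u ^ (ν.re + 1 / 2) + u ^ (2 * ν.re + 1)) ≤ I := by
      refine setIntegral_mono_set (integrableOn_rpow_add_rpow_Ioc hν 1 one_pos) ?_
        (Ioc_subset_Ioc le_rfl hε1).eventuallyLE
      filter_upwards [ae_restrict_mem measurableSet_Ioc] with u hu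
      have := hu.1
      simp only [Pi.zero_apply]
      positivity
    have hw := besselWeight_pos (ν.re + 1 / 2) hy
    have hc : ‖∫ u in Ioc 0 ε, (Real.exp (-ε * u ^ 2) : ℂ) * potentialKernel ν x y u‖ ≤
        C₄ * besselWeight (ν.re + 1 / 2) y * I / √y * (x ^ 2)⁻¹ := by
      rw [div_mul_eq_mul_div, le_div_iff₀ hs]
      calc _ = √y * ‖∫ u in Ioc 0 ε, (Real.exp (-ε * u ^ 2) : ℂ) * potentialKernel ν x y u‖ := by
            ring
        _ ≤ _ := hb
        _ ≤ C₄ * besselWeight (ν.re + 1 / 2) y * (x ^ 2)⁻¹ * I := by gcongr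
        _ = _ := by ring
    have hd : (x ^ 2)⁻¹ ≤ (1 + (δ ^ 2)⁻¹) * (x ^ 2 + 1)⁻¹ := by
      rw [← div_eq_mul_inv, le_div_iff₀ (by positivity), inv_mul_le_iff₀ (by positivity)]
      have : 1 ≤ x ^ 2 * (δ ^ 2)⁻¹ := by
        rw [← div_eq_mul_inv, le_div_iff₀ (by positivity), one_mul]
        gcongr
      linarith
    have he : B * (x ^ 2)⁻¹ ≤ B * ((1 + (δ ^ 2)⁻¹) * (x ^ 2 + 1)⁻¹) := by gcongr
    have hf : 0 ≤ 2 * (C₁ + C₂) * (x ^ ν.re * ‖besselK ν (x * y)‖ + (x ^ 2 + 1)⁻¹) := by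
      positivity
    have hg : 0 ≤ B * (1 + (δ ^ 2)⁻¹) * (x ^ ν.re * ‖besselK ν (x * y)‖) := by positivity
    have hh : B * (x ^ 2)⁻¹ =
      C₃ * (x ^ 2)⁻¹ + C₄ * besselWeight (ν.re + 1 / 2) y * I / √y * (x ^ 2)⁻¹ := by
      simp only [B]; ring
    linarith

/-- Domination of the incomplete integrals in all cases: by `K_ν` near zero unless `ν` is imaginary
and nonzero, by `besselWeight` otherwise. -/
theorem exists_sqrt_mul_norm_incompleteBesselK_le (ν : ℂ) {x : ℝ} (hx : 0 < x) :
    ∃ C : ℝ, 0 ≤ C ∧ ∀ T y : ℝ, 0 < y → √y * ‖incompleteBesselK ν T (x * y)‖ ≤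
      C * (√y * ‖besselK ν (x * y)‖ + besselWeight (ν.re + 1 / 2) y) := by
  have hsmall : ∃ C : ℝ, 0 ≤ C ∧ ∃ δ > 0, δ ≤ 1 ∧ ∀ T y : ℝ, 0 < y → y < δ →
      √y * ‖incompleteBesselK ν T (x * y)‖ ≤
        C * (√y * ‖besselK ν (x * y)‖ + besselWeight (ν.re + 1 / 2) y) := by
    by_cases hcase : ν.re ≠ 0 ∨ ν = 0
    · obtain ⟨C, hC, δ, hδ, h⟩ := exists_norm_incompleteBesselK_le_besselK hcase
      refine ⟨C, hC, min (δ / x) 1, by positivity, min_le_right _ _, fun T y hy hyδ => ?_⟩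
      have h1 := h T (x * y) (by positivity) (by
        have := hyδ.trans_le (min_le_left _ _)
        rwa [lt_div_iff₀ hx, mul_comm] at this)
      have h2 := besselWeight_pos (ν.re + 1 / 2) hy
      calc _ ≤ √y * (C * ‖besselK ν (x * y)‖) := by gcongr
        _ = C * (√y * ‖besselK ν (x * y)‖) := by ring
        _ ≤ _ := by gcongr; linarith
    · push Not at hcase
      refine ⟨3 / ‖ν‖, by positivity, 1, one_pos, le_rfl, fun T y hy hy1 => ?_⟩
      have h1 := norm_incompleteBesselK_le_of_re_eq_zero hcase.1 hcase.2
        (T := T) (mul_pos hx hy)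
      have h2 : besselWeight (ν.re + 1 / 2) y = √y := by
        rw [besselWeight, if_pos hy1.le, hcase.1, zero_add, Real.sqrt_eq_rpow]
      rw [h2]
      calc _ ≤ √y * (3 / ‖ν‖) := by gcongr
        _ = 3 / ‖ν‖ * √y := by ring
        _ ≤ _ := by
          gcongr
          have : 0 ≤ √y * ‖besselK ν (x * y)‖ := by positivity
          linarith
  obtain ⟨C₁, hC₁, δ, hδ, hδ1, h₁⟩ := hsmall
  obtain ⟨C₂, hC₂, h₂⟩ := norm_incompleteBesselK_le_rpow (ν := ν) (N := |ν.re| + 1 / 2)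
    (by positivity) (by linarith)
  set r := |ν.re| + (ν.re + 1 / 2)
  have hr : 0 ≤ r := by
    have := neg_abs_le ν.re
    simp only [r]
    linarith
  have hδr : 1 ≤ δ ^ (-r) := Real.one_le_rpow_of_pos_of_le_one_of_nonpos hδ hδ1 (by linarith)
  have hweight : ∀ y : ℝ, δ ≤ y → y ^ (-|ν.re|) ≤ δ ^ (-r) * besselWeight (ν.re + 1 / 2) y := by
    intro y hyδ
    have hy := hδ.trans_le hyδ
    rw [besselWeight]
    split_ifs with hy1
    · have h3 : y ^ (-|ν.re|) = y ^ (-r) * y ^ (ν.re + 1 / 2) := by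
        rw [← Real.rpow_add hy]
        congr 1
        simp only [r]
        ring
      rw [h3]
      gcongr ?_ * _
      exact Real.rpow_le_rpow_of_nonpos hδ hyδ (by linarith)
    · rw [mul_one]
      exact (Real.rpow_le_one_of_one_le_of_nonpos (not_le.1 hy1).le
        (by linarith [abs_nonneg ν.re])).trans hδr
  refine ⟨C₁ + C₂ * x ^ (-(|ν.re| + 1 / 2)) * δ ^ (-r), by positivity, fun T y hy => ?_⟩
  have hw := besselWeight_pos (ν.re + 1 / 2) hy
  have hK : 0 ≤ √y * ‖besselK ν (x * y)‖ := by positivity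
  have hsum : 0 ≤ √y * ‖besselK ν (x * y)‖ + besselWeight (ν.re + 1 / 2) y := by linarith
  rcases lt_or_ge y δ with hyδ | hyδ
  · refine (h₁ T y hy hyδ).trans ?_
    gcongr
    have : 0 ≤ C₂ * x ^ (-(|ν.re| + 1 / 2)) * δ ^ (-r) := by positivity
    linarith
  · have h3 : √y * y ^ (-(|ν.re| + 1 / 2)) = y ^ (-|ν.re|) := by
      rw [Real.sqrt_eq_rpow, ← Real.rpow_add hy]
      ring_nf
    calc _ ≤ √y * (C₂ * (x * y) ^ (-(|ν.re| + 1 / 2))) := by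
          gcongr
          exact h₂ _ _ (by positivity)
      _ = C₂ * x ^ (-(|ν.re| + 1 / 2)) * (√y * y ^ (-(|ν.re| + 1 / 2))) := by
          rw [Real.mul_rpow hx.le hy.le]
          ring
      _ ≤ C₂ * x ^ (-(|ν.re| + 1 / 2)) * (δ ^ (-r) * besselWeight (ν.re + 1 / 2) y) := by
          rw [h3]
          gcongr
          exact hweight y hyδ
      _ = C₂ * x ^ (-(|ν.re| + 1 / 2)) * δ ^ (-r) * besselWeight (ν.re + 1 / 2) y := by ring
      _ ≤ _ := by gcongr <;> linarith

/-- Domination of the truncated Gaussian means, uniformly in `ε`, when `x` is fixed and `y` is the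
variable of integration. -/
theorem exists_sqrt_mul_norm_integral_Ioi_gaussian_le {ν : ℂ} (hν : -1 < ν.re) {x : ℝ}
    (hx : 0 < x) :
    ∃ C : ℝ, 0 ≤ C ∧ ∀ y ε : ℝ, 0 < y → 0 < ε → ε ≤ 1 →
      √y * ‖∫ u in Ioi ε, (Real.exp (-ε * u ^ 2) : ℂ) * potentialKernel ν x y u‖ ≤
        C * (√y * ‖besselK ν (x * y)‖ + besselWeight (ν.re + 1 / 2) y) := by
  obtain ⟨C₁, hC₁, h₁⟩ := exists_sqrt_mul_norm_incompleteBesselK_le ν hx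
  obtain ⟨C₂, hC₂, h₂⟩ := exists_norm_integral_Ioc_potentialKernel_le hν
  have hI₀ := fun ε => integral_Ioc_rpow_add_rpow_nonneg ν.re ε
  set I := ∫ u in Ioc (0 : ℝ) 1, (u ^ (ν.re + 1 / 2) + u ^ (2 * ν.re + 1))
  have hI : 0 ≤ I := hI₀ 1
  refine ⟨Real.exp (x ^ 2) * x ^ ν.re * C₁ + C₂ * (x ^ 2)⁻¹ * I, by positivity,
    fun y ε hy hε hε1 => ?_⟩
  have hw := besselWeight_pos (ν.re + 1 / 2) hy
  have hK : 0 ≤ √y * ‖besselK ν (x * y)‖ := by positivity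
  have ha : √y * ‖∫ u in Ioi (0 : ℝ), (Real.exp (-ε * u ^ 2) : ℂ) * potentialKernel ν x y u‖ ≤
      Real.exp (x ^ 2) * x ^ ν.re *
        (C₁ * (√y * ‖besselK ν (x * y)‖ + besselWeight (ν.re + 1 / 2) y)) := by
    rw [norm_integral_gaussian_potentialKernel_eq hν hx hy hε]
    have h3 : ε * x ^ 2 ≤ x ^ 2 := by nlinarith [sq_nonneg x]
    calc _ = Real.exp (ε * x ^ 2) * x ^ ν.re *
          (√y * ‖incompleteBesselK ν (Real.log (ε / (y / (2 * x)))) (x * y)‖) := by ring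
      _ ≤ _ := mul_le_mul (by gcongr) (h₁ _ _ hy) (by positivity) (by positivity)
  have hb : √y * ‖∫ u in Ioc 0 ε, (Real.exp (-ε * u ^ 2) : ℂ) * potentialKernel ν x y u‖ ≤
      C₂ * (x ^ 2)⁻¹ * I * besselWeight (ν.re + 1 / 2) y := by
    refine (h₂ x y ε hx hy hε).trans ?_
    calc _ ≤ C₂ * besselWeight (ν.re + 1 / 2) y * (x ^ 2)⁻¹ * I := by
          gcongr
          refine setIntegral_mono_set (integrableOn_rpow_add_rpow_Ioc hν 1 one_pos) ?_
            (Ioc_subset_Ioc le_rfl hε1).eventuallyLE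
          filter_upwards [ae_restrict_mem measurableSet_Ioc] with u hu
          have := hu.1
          simp only [Pi.zero_apply]
          positivity
      _ = _ := by ring
  rw [integral_Ioi_gaussian_potentialKernel_eq hν hx hy hε]
  have hc : 0 ≤ C₂ * (x ^ 2)⁻¹ * I * (√y * ‖besselK ν (x * y)‖) := by positivity
  calc _ ≤ √y * (_ + _) := by gcongr; exact norm_sub_le _ _
    _ = _ + _ := mul_add _ _ _
    _ ≤ _ := by linarith

/-! ### The iteration identities -/

section

variable {ν : ℂ} {f φ : ℝ → ℂ}

/-- Fubini's theorem applies to the means of iterated potential transforms: on `u > ε` the factor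
`1/(x² + u²)` is at most `1/(x² + ε²)`, which separates the variables. -/
theorem integrable_prod_of_integrableOn_mul_inv (hν : -1 < ν.re) {y ε : ℝ} (hy : 0 < y)
    (hε : 0 < ε) (hφ : AEStronglyMeasurable φ (volume.restrict (Ioi (0 : ℝ))))
    (h : IntegrableOn (fun x : ℝ => φ x * ((x ^ 2 + ε ^ 2 : ℝ) : ℂ)⁻¹) (Ioi 0)) :
    Integrable (Function.uncurry fun x u : ℝ =>
        φ x * ((Real.exp (-ε * u ^ 2) : ℂ) * potentialKernel ν x y u))
      ((volume.restrict (Ioi (0 : ℝ))).prod (volume.restrict (Ioi ε))) := by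
  have hmaj := (Integrable.mul_prod h
    ((integrableOn_besselKernel_gaussian hν hy hε).mono_set (Ioi_subset_Ioi hε.le))).norm
  refine hmaj.mono' (hφ.comp_fst.mul ?_) ?_
  · rw [Measure.prod_restrict]
    refine ContinuousOn.aestronglyMeasurable ?_ (measurableSet_Ioi.prod measurableSet_Ioi)
    refine ContinuousOn.mul (by fun_prop) (ContinuousOn.mul ?_ (ContinuousOn.inv₀ (by fun_prop) ?_))
    · exact (continuousOn_besselKernel hν).comp (f := fun p : ℝ × ℝ => (y, p.2)) (by fun_prop)
        fun p hp => ⟨hy, hε.trans hp.2⟩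
    · intro p hp
      have : 0 < p.1 := hp.1
      exact Complex.ofReal_ne_zero.2 (by positivity)
  · rw [Measure.prod_restrict]
    filter_upwards [ae_restrict_mem (measurableSet_Ioi.prod measurableSet_Ioi)] with p hp
    have hu : ε < p.2 := hp.2
    simp only [Function.uncurry, norm_mul, norm_potentialKernel, norm_inv, Complex.norm_real]
    rw [Real.norm_of_nonneg (show 0 ≤ p.1 ^ 2 + ε ^ 2 by positivity)]
    calc _ = ‖φ p.1‖ * (p.1 ^ 2 + p.2 ^ 2)⁻¹ *
          (‖besselKernel ν y p.2‖ * ‖Real.exp (-ε * p.2 ^ 2)‖) := by ring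
      _ ≤ _ := by gcongr

/-- Fubini's theorem applies to the means of iterated Hankel transforms, by
`exists_norm_besselKernel_le`, which separates the variables. -/
theorem integrable_prod_of_integrableOn_besselWeight (hν : -1 < ν.re) {y ε : ℝ} (hy : 0 < y)
    (hε : 0 < ε) (hf : AEStronglyMeasurable f (volume.restrict (Ioi (0 : ℝ))))
    (h : IntegrableOn (fun x : ℝ => besselWeight (ν.re + 1 / 2) x * ‖f x‖) (Ioi 0)) :
    Integrable (Function.uncurry fun x u : ℝ =>
        (√x : ℂ) * f x * ((Real.exp (-ε * u ^ 2) : ℂ) * potentialKernel ν y x u))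
      ((volume.restrict (Ioi (0 : ℝ))).prod (volume.restrict (Ioi ε))) := by
  obtain ⟨C, hC, hk⟩ := exists_norm_besselKernel_le hν
  have hmaj := (Integrable.mul_prod h
    ((integrableOn_rpow_add_rpow_gaussian hν hε).mono_set (Ioi_subset_Ioi hε.le))).const_mul
      (C * (y ^ 2)⁻¹)
  have hsqrt : AEStronglyMeasurable (fun x : ℝ => (√x : ℂ) * f x)
      (volume.restrict (Ioi (0 : ℝ))) :=
    (Continuous.aestronglyMeasurable (by fun_prop)).mul hf
  refine hmaj.mono' (hsqrt.comp_fst.mul ?_) ?_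
  · rw [Measure.prod_restrict]
    refine ContinuousOn.aestronglyMeasurable ?_ (measurableSet_Ioi.prod measurableSet_Ioi)
    refine ContinuousOn.mul (by fun_prop) (ContinuousOn.mul ?_ (ContinuousOn.inv₀ (by fun_prop) ?_))
    · exact (continuousOn_besselKernel hν).comp (f := fun p : ℝ × ℝ => (p.1, p.2)) (by fun_prop)
        fun p hp => ⟨hp.1, hε.trans hp.2⟩
    · intro p hp
      exact Complex.ofReal_ne_zero.2 (by positivity)
  · rw [Measure.prod_restrict]
    filter_upwards [ae_restrict_mem (measurableSet_Ioi.prod measurableSet_Ioi)] with p hp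
    have hx : 0 < p.1 := hp.1
    have hu : 0 < p.2 := hε.trans hp.2
    have hw := besselWeight_pos (ν.re + 1 / 2) hx
    have h1 := hk p.1 p.2 hx hu
    simp only [Function.uncurry, norm_mul, norm_potentialKernel, Complex.norm_real]
    rw [Real.norm_of_nonneg (Real.sqrt_nonneg _), Real.norm_of_nonneg (Real.exp_pos _).le]
    calc _ = (√p.1 * ‖besselKernel ν p.1 p.2‖) * ‖f p.1‖ * Real.exp (-ε * p.2 ^ 2) *
          (y ^ 2 + p.2 ^ 2)⁻¹ := by ring
      _ ≤ C * besselWeight (ν.re + 1 / 2) p.1 *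
          (p.2 ^ (ν.re + 1 / 2) + p.2 ^ (2 * ν.re + 1)) * ‖f p.1‖ *
          Real.exp (-ε * p.2 ^ 2) * (y ^ 2)⁻¹ := by
        gcongr
        exact le_add_of_nonneg_right (sq_nonneg _)
      _ = _ := by ring

theorem hankel_powMul_widder (hν : -1 < ν.re)
    (hf : AEStronglyMeasurable f (volume.restrict (Ioi (0 : ℝ)))) {y : ℝ} (hy : 0 < y)
    (h : HankelWidderExists ν f y) :
    hankel ν (powMul (ν + 1 / 2) (widder (powMul (-ν - 1 / 2) f))) y = macdonald ν f y := by
  obtain ⟨hW, hM, hloc, c, hc⟩ := h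
  obtain ⟨C, hC, hdom⟩ := exists_norm_integral_Ioi_gaussian_le hν hy
  set φ : ℝ → ℂ := fun x => (√y : ℂ) * ((x : ℂ) ^ (-ν + 1 / 2) * f x) with hφdef
  have hφW : ∀ u x : ℝ, 0 < x →
      (√y : ℂ) * widderIntegrand (powMul (-ν - 1 / 2) f) u x =
        φ x * ((x ^ 2 + u ^ 2 : ℝ) : ℂ)⁻¹ := by
    intro u x hx
    have hx' : (x : ℂ) ≠ 0 := Complex.ofReal_ne_zero.2 hx.ne'
    have hpow : (x : ℂ) ^ (-ν + 1 / 2) = (x : ℂ) ^ (-ν - 1 / 2) * x := by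
      rw [show -ν + 1 / 2 = -ν - 1 / 2 + 1 by ring, Complex.cpow_add _ _ hx', Complex.cpow_one]
    simp only [widderIntegrand, powMul, hφdef, hpow]
    push_cast
    ring
  have hφi : ∀ u : ℝ, 0 < u →
      IntegrableOn (fun x : ℝ => φ x * ((x ^ 2 + u ^ 2 : ℝ) : ℂ)⁻¹) (Ioi 0) := fun u hu =>
    IntegrableOn.congr_fun (Integrable.const_mul (hW u hu) (√y : ℂ)) (fun x hx => hφW u x hx)
      measurableSet_Ioi
  have hφm : AEStronglyMeasurable φ (volume.restrict (Ioi (0 : ℝ))) := by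
    refine AEStronglyMeasurable.const_mul (AEStronglyMeasurable.mul ?_ hf) _
    refine ContinuousOn.aestronglyMeasurable (fun x hx => ?_) measurableSet_Ioi
    exact (Complex.continuousAt_ofReal_cpow_const x _ (Or.inr (ne_of_gt hx))).continuousWithinAt
  have hφK : ∀ x : ℝ, 0 < x →
      φ x * ((x : ℂ) ^ ν * besselK ν (x * y)) = macdonaldIntegrand ν f y x := by
    intro x hx
    have hx' : (x : ℂ) ≠ 0 := Complex.ofReal_ne_zero.2 hx.ne'
    have hs : (√x : ℂ) = (x : ℂ) ^ (-ν + 1 / 2) * (x : ℂ) ^ ν := by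
      rw [← Complex.cpow_add _ _ hx', Real.sqrt_eq_rpow, Complex.ofReal_cpow hx.le]
      congr 1
      push_cast
      ring
    rw [macdonaldIntegrand, Real.sqrt_mul hx.le, Complex.ofReal_mul, hs, hφdef]
    ring
  have key := eq_integral_of_gaussian_means (φ := φ) (k := fun x u => potentialKernel ν x y u)
    (K := fun x => (x : ℂ) ^ ν * besselK ν (x * y))
    (D := fun x => C * (‖macdonaldIntegrand ν f y x‖ + ‖φ x * ((x ^ 2 + 1 ^ 2 : ℝ) : ℂ)⁻¹‖))
    ?_ hloc hc (fun ε hε => integrable_prod_of_integrableOn_mul_inv hν hy hε hφm (hφi ε hε))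
    ((Integrable.add hM.norm (hφi 1 one_pos).norm).const_mul C) ?_
    fun x hx => tendsto_integral_Ioi_gaussian_potentialKernel hν hx hy
  · rw [hankel, improperIntegral_eq_of_tendsto hc, macdonald, improperIntegral_eq_integral hM, key]
    exact setIntegral_congr_fun measurableSet_Ioi hφK
  · intro u hu
    have h1 : hankelIntegrand ν (powMul (ν + 1 / 2) (widder (powMul (-ν - 1 / 2) f))) y u =
        besselKernel ν y u * ((√y : ℂ) * widder (powMul (-ν - 1 / 2) f) u) := by
      rw [hankelIntegrand_eq, powMul, mul_left_comm, ← mul_assoc, ← mul_assoc, mul_comm u y,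
        ← sqrt_mul_besselKernel ν hy hu]
      ring
    rw [h1, widder, improperIntegral_eq_integral (hW u hu), ← integral_const_mul,
      ← integral_const_mul]
    refine setIntegral_congr_fun measurableSet_Ioi fun x hx => ?_
    simp only [hφW u x hx, potentialKernel]
    ring
  · intro ε x hε hε1 hx
    rw [norm_mul, ← hφK x hx]
    simp only [norm_mul, norm_inv, norm_ofReal_cpow hx, Complex.norm_real]
    rw [Real.norm_of_nonneg (show 0 ≤ x ^ 2 + 1 ^ 2 by positivity), one_pow]
    calc _ ≤ ‖φ x‖ * (C * (x ^ ν.re * ‖besselK ν (x * y)‖ + (x ^ 2 + 1)⁻¹)) := by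
          gcongr
          exact hdom x ε hx hε hε1
      _ = _ := by ring

theorem widder_powMul_hankel (hν : -1 < ν.re)
    (hf : AEStronglyMeasurable f (volume.restrict (Ioi (0 : ℝ)))) {y : ℝ} (hy : 0 < y)
    (h : WidderHankelExists ν f y) :
    widder (powMul (ν - 1 / 2) (hankel ν f)) y = (y : ℂ) ^ (ν - 1 / 2) * macdonald ν f y := by
  obtain ⟨hH, hM, hloc, c, hc⟩ := h
  obtain ⟨C, hC, hdom⟩ := exists_sqrt_mul_norm_integral_Ioi_gaussian_le hν hy
  have hweight := integrableOn_besselWeight_mul_of_hankel hν hf hH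
  have hy' : (y : ℂ) ≠ 0 := Complex.ofReal_ne_zero.2 hy.ne'
  have hφK : ∀ x : ℝ, 0 < x → (√x : ℂ) * f x * ((y : ℂ) ^ ν * besselK ν (y * x)) =
      (y : ℂ) ^ (ν - 1 / 2) * macdonaldIntegrand ν f y x := by
    intro x hx
    have hs : (y : ℂ) ^ ν = (y : ℂ) ^ (ν - 1 / 2) * (√y : ℂ) := by
      rw [Real.sqrt_eq_rpow, Complex.ofReal_cpow hy.le, ← Complex.cpow_add _ _ hy']
      congr 1
      push_cast
      ring
    rw [macdonaldIntegrand, Real.sqrt_mul hx.le, Complex.ofReal_mul, hs, mul_comm y x]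
    ring
  have key := eq_integral_of_gaussian_means (φ := fun x => (√x : ℂ) * f x)
    (k := fun x u => potentialKernel ν y x u)
    (K := fun x => (y : ℂ) ^ ν * besselK ν (y * x))
    (D := fun x => C * ((√y)⁻¹ * ‖macdonaldIntegrand ν f y x‖ +
      besselWeight (ν.re + 1 / 2) x * ‖f x‖))
    ?_ hloc hc (fun ε hε => integrable_prod_of_integrableOn_besselWeight hν hy hε hf hweight)
    ((Integrable.add (hM.norm.const_mul (√y)⁻¹) hweight).const_mul C) ?_
    fun x hx => tendsto_integral_Ioi_gaussian_potentialKernel hν hy hx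
  · rw [widder, improperIntegral_eq_of_tendsto hc, macdonald, improperIntegral_eq_integral hM, key,
      ← integral_const_mul]
    exact setIntegral_congr_fun measurableSet_Ioi hφK
  · intro u hu
    have hu' : (u : ℂ) ≠ 0 := Complex.ofReal_ne_zero.2 hu.ne'
    have hpow : (u : ℂ) ^ (ν + 1 / 2) = (u : ℂ) ^ (ν - 1 / 2) * u := by
      rw [show ν + 1 / 2 = ν - 1 / 2 + 1 by ring, Complex.cpow_add _ _ hu', Complex.cpow_one]
    have h1 : widderIntegrand (powMul (ν - 1 / 2) (hankel ν f)) y u =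
        (u : ℂ) ^ (ν + 1 / 2) * ((y ^ 2 + u ^ 2 : ℝ) : ℂ)⁻¹ * hankel ν f u := by
      rw [widderIntegrand, powMul, hpow, add_comm ((u : ℂ) ^ 2)]
      push_cast
      ring
    rw [h1, hankel, improperIntegral_eq_integral (hH u hu), ← integral_const_mul]
    refine setIntegral_congr_fun measurableSet_Ioi fun x hx => ?_
    have h2 := sqrt_mul_besselKernel ν hx hu
    simp only [hankelIntegrand_eq, potentialKernel]
    linear_combination (-f x * ((y ^ 2 + u ^ 2 : ℝ) : ℂ)⁻¹) * h2
  · intro ε x hε hε1 hx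
    have h1 := hdom x ε hx hε hε1
    have hM' : ‖macdonaldIntegrand ν f y x‖ = √x * √y * ‖besselK ν (y * x)‖ * ‖f x‖ := by
      rw [macdonaldIntegrand, norm_mul, norm_mul, Complex.norm_real,
        Real.norm_of_nonneg (Real.sqrt_nonneg _), Real.sqrt_mul hx.le, mul_comm y x]
    have hs : √y ≠ 0 := (Real.sqrt_pos.2 hy).ne'
    rw [norm_mul, norm_mul, Complex.norm_real, Real.norm_of_nonneg (Real.sqrt_nonneg _), hM']
    calc _ = ‖f x‖ * (√x * ‖∫ u in Ioi ε, (Real.exp (-ε * u ^ 2) : ℂ) *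
          potentialKernel ν y x u‖) := by ring
      _ ≤ ‖f x‖ * (C * (√x * ‖besselK ν (y * x)‖ + besselWeight (ν.re + 1 / 2) x)) := by gcongr
      _ = _ := by field_simp

end

end IterationIdentities

theorem corollary1 (ν : ℂ) (hν : -1 < ν.re) (f : ℝ → ℂ)
    (hf : MeasureTheory.AEStronglyMeasurable f
      (MeasureTheory.volume.restrict (Set.Ioi (0 : ℝ))))
    (y : ℝ) (hy : 0 < y) :
    (IterationIdentities.HankelWidderExists ν f y →
      IterationIdentities.hankel ν
          (IterationIdentities.powMul (ν + 1 / 2)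
            (IterationIdentities.widder (IterationIdentities.powMul (-ν - 1 / 2) f))) y
        = IterationIdentities.macdonald ν f y) ∧
    (IterationIdentities.WidderHankelExists ν f y →
      IterationIdentities.widder
          (IterationIdentities.powMul (ν - 1 / 2) (IterationIdentities.hankel ν f)) y
        = (y : ℂ) ^ (ν - 1 / 2) * IterationIdentities.macdonald ν f y) ∧
    (IterationIdentities.HankelWidderExists ν f y →
      IterationIdentities.WidderHankelExists ν f y →
      IterationIdentities.hankel ν
          (IterationIdentities.powMul (ν + 1 / 2)
            (IterationIdentities.widder (IterationIdentities.powMul (-ν - 1 / 2) f))) y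
        = (y : ℂ) ^ (-ν + 1 / 2) *
            IterationIdentities.widder
              (IterationIdentities.powMul (ν - 1 / 2) (IterationIdentities.hankel ν f)) y) := by
  refine ⟨IterationIdentities.hankel_powMul_widder hν hf hy,
    IterationIdentities.widder_powMul_hankel hν hf hy, fun h₁ h₂ => ?_⟩
  rw [IterationIdentities.hankel_powMul_widder hν hf hy h₁,
    IterationIdentities.widder_powMul_hankel hν hf hy h₂, ← mul_assoc,
    ← Complex.cpow_add _ _ (Complex.ofReal_ne_zero.2 hy.ne')]
  rw [show -ν + 1 / 2 + (ν - 1 / 2) = 0 by ring, Complex.cpow_zero, one_mul]
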